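/- Let $\Gamma=\mathrm{PSL}_2(\mathbb Z)$ act on the upper half-plane $\mathbb H$, equipped with the measure $d\mu=dx\,dy/y^2$, let $V=\mathrm{vol}(\Gamma\backslash\mathbb H)$, and let $\Gamma_\infty$ be the stabilizer of $\infty$ in $\Gamma$. For $z\in\mathbb H$ and $\mathrm{Re}(s)>1$ let $$E(z,s)=\sum_{\gamma\in\Gamma_\infty\backslash\Gamma}\mathrm{Im}(\gamma z)^s,\qquad \widetilde E(z,s)=E(z,s)-\frac{1}{V\,(s-1)} .$$ Let $f(z)=\sum_{n\ge1}a_f(n)e^{2\pi i nz}$ be a holomorphic cusp form of weight $k$ on $\Gamma$ that is an eigenfunction of all Hecke operators and is normalized by $a_f(1)=1$. Put $\Psi(z)=|f(z)|^2y^k$ and $\|f\|^2=\int_{\Gamma\backslash\mathbb H}\Psi\,d\mu$. For each prime $p$ let $\alpha_p,\beta_p$ be the complex numbers with $\alpha_p+\beta_p=a_f(p)p^{-(k-1)/2}$ and $\alpha_p\beta_p=1$, and for $\mathrm{Re}(s)>1$ let $$L(\mathrm{sym}^2f,s)=\prod_p\Big((1-\alpha_p^2p^{-s})(1-\alpha_p\beta_pp^{-s})(1-\beta_p^2p^{-s})\Big)^{-1},\qquad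 \Lambda(\mathrm{sym}^2f,s)=(4\pi)^{-(s+k-1)}\,\Gamma(s+k-1)\,L(\mathrm{sym}^2f,s).$$ Then the series $E(z,s)$ and the Euler product $L(\mathrm{sym}^2f,s)$ converge for $\mathrm{Re}(s)>1$; the functions $s\mapsto\widetilde E(z,s)$ (for every $z\in\mathbb H$) and $s\mapsto L(\mathrm{sym}^2f,s)$ continue analytically to a neighbourhood of $s=1$; $\Lambda(\mathrm{sym}^2f,1)\ne0$; the functions $\Psi$ and $\Psi\,\overline{\widetilde E(\cdot,1)}$ are integrable on $\Gamma\backslash\mathbb H$; and $$\big\langle\Psi,\widetilde E(\cdot,1)\big\rangle=\int_{\Gamma\backslash\mathbb H}\Psi(z)\,\overline{\widetilde E(z,1)}\,d\mu(z)=\frac{\|f\|^2}{V}\left(\frac{\Lambda'}{\Lambda}(\mathrm{sym}^2f,1)+\gamma-2\,\frac{\zeta'}{\zeta}(2)\right),$$ where $\gamma$ is Euler's constant and $\zeta$ is the Riemann zeta function. -/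

import Mathlib

open scoped MatrixGroups ComplexConjugate Modular Real
open MeasureTheory UpperHalfPlane

noncomputable section

namespace RegEis

/-! ### Analytic continuation to `s = 1` -/

/-- `g` continues `F` analytically from the half-plane `Re s > 1` to a neighbourhood of `s = 1`.
By the identity theorem the germ of `g` at `1` is uniquely determined by `F`. -/
def IsContinuation (F g : ℂ → ℂ) : Prop :=
  AnalyticAt ℂ g 1 ∧ ∀ s : ℂ, 1 < s.re → g s = F s

open Classical in
/-- The analytic continuation of `F` from `Re s > 1` to a neighbourhood of `s = 1`
(and `F` itself if there is none). -/
def continuation (F : ℂ → ℂ) : ℂ → ℂ :=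
  if h : ∃ g, IsContinuation F g then h.choose else F

/-! ### The Eisenstein series of the modular group -/

/-- The stabiliser of the cusp `∞` in `SL₂(ℤ)`: the matrices `± (1 n; 0 1)`. -/
def GammaInf : Subgroup SL(2, ℤ) where
  carrier := {γ | γ 1 0 = 0}
  one_mem' := by simp
  mul_mem' := by
    intro a b ha hb
    simp only [Set.mem_ofPred_eq] at ha hb ⊢
    simp [Matrix.mul_apply, ha, hb]
  inv_mem' := by
    intro a ha
    simp only [Set.mem_ofPred_eq] at ha ⊢
    simp [Matrix.SpecialLinearGroup.coe_inv, Matrix.adjugate_fin_two, ha]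

theorem im_smul_of_mem (γ : SL(2, ℤ)) (hγ : γ ∈ GammaInf) (z : ℍ) : (γ • z).im = z.im := by
  have h0 : γ 1 0 = 0 := hγ
  have hdet : γ 0 0 * γ 1 1 = 1 := by
    have := Matrix.SpecialLinearGroup.det_coe γ
    rw [Matrix.det_fin_two, h0] at this
    simpa using this
  have hd : γ 1 1 = 1 ∨ γ 1 1 = -1 := Int.isUnit_iff.mp (IsUnit.of_mul_eq_one _ (by rw [mul_comm]; exact hdet))
  rw [ModularGroup.im_smul_eq_div_normSq, ModularGroup.denom_apply, h0]
  rcases hd with h | h <;> simp [h]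

/-- `Im (γ z)` as a function of the coset `Γ_∞ γ`. -/
def cosetIm (z : ℍ) : Quotient (QuotientGroup.rightRel GammaInf) → ℝ :=
  Quotient.lift (fun γ : SL(2, ℤ) => (γ • z).im) (by
    intro a b hab
    have h : b * a⁻¹ ∈ GammaInf := QuotientGroup.rightRel_apply.mp hab
    have := im_smul_of_mem _ h (a • z)
    rw [smul_smul, inv_mul_cancel_right] at this
    exact this.symm)

/-- `E(z, s) = ∑_{γ ∈ Γ_∞ \ Γ} Im(γ z)^s` for `Re s > 1`. As `-1 ∈ Γ_∞`, the cosets are those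
of the images of the two groups in `PSL₂(ℤ)`. -/
def eisenstein (z : ℍ) (s : ℂ) : ℂ :=
  ∑' c : Quotient (QuotientGroup.rightRel GammaInf), (cosetIm z c : ℂ) ^ s

/-- The hyperbolic area of `Γ \ ℍ`, for the measure `dx dy / y²`. -/
def vol : ℝ := (volume : Measure ℍ).real 𝒟

/-- `E(z, s) - 1 / (vol(Γ \ ℍ) (s - 1))` for `Re s > 1`. -/
def regEisensteinSeries (z : ℍ) (s : ℂ) : ℂ :=
  eisenstein z s - 1 / ((vol : ℂ) * (s - 1))

/-- The regularized Eisenstein series `Ẽ(z, s)`, continued to a neighbourhood of `s = 1`. -/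
def regEisenstein (z : ℍ) : ℂ → ℂ := continuation (regEisensteinSeries z)

/-! ### Hecke cusp forms of level one -/

/-- The Fourier coefficient `a_f(n)` in `f(z) = ∑ a_f(n) e(n z)`. -/
def fourierCoeff {k : ℤ} (f : CuspForm 𝒮ℒ k) (n : ℕ) : ℂ :=
  (qExpansion 1 f).coeff n

/-- The Hecke operator
`(T_n f)(z) = n^(k-1) ∑_{a d = n} ∑_{0 ≤ b < d} d^(-k) f((a z + b) / d)`. -/
def heckeOp (k : ℤ) (n : ℕ) (f : ℍ → ℂ) (z : ℍ) : ℂ :=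
  (n : ℂ) ^ (k - 1) * ∑ x ∈ n.divisorsAntidiagonal, ∑ b ∈ Finset.range x.2,
    (x.2 : ℂ) ^ (-k) * f (ofComplex (((x.1 : ℂ) * z + b) / x.2))

/-- A Hecke cusp form: an eigenform of all Hecke operators, normalized by `a_f(1) = 1`. -/
structure IsHeckeForm {k : ℤ} (f : CuspForm 𝒮ℒ k) : Prop where
  coeff_one : fourierCoeff f 1 = 1
  eigen : ∀ n : ℕ, 1 ≤ n → ∃ c : ℂ, ∀ z : ℍ, heckeOp k n f z = c * f z

/-- `Ψ(z) = |f(z)|² y^k`. -/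
def Psi {k : ℤ} (f : CuspForm 𝒮ℒ k) (z : ℍ) : ℝ := ‖f z‖ ^ 2 * z.im ^ k

/-- The square of the Petersson norm of `f`. -/
def normSqPet {k : ℤ} (f : CuspForm 𝒮ℒ k) : ℝ := ∫ z in 𝒟, Psi f z

/-! ### The symmetric square `L`-function -/

/-- The normalized coefficient `λ_f(n) = a_f(n) / n^((k-1)/2)`. -/
def heckeEig {k : ℤ} (f : CuspForm 𝒮ℒ k) (n : ℕ) : ℂ :=
  fourierCoeff f n / (n : ℂ) ^ (((k : ℂ) - 1) / 2)

/-- The Satake parameter `α_p`, one of the two roots of `X² - λ_f(p) X + 1`. -/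
def satakeA {k : ℤ} (f : CuspForm 𝒮ℒ k) (p : ℕ) : ℂ :=
  (heckeEig f p + (heckeEig f p ^ 2 - 4) ^ (1 / 2 : ℂ)) / 2

/-- The second root `β_p`; so `α_p + β_p = λ_f(p)` and `α_p β_p = 1`. -/
def satakeB {k : ℤ} (f : CuspForm 𝒮ℒ k) (p : ℕ) : ℂ :=
  (heckeEig f p - (heckeEig f p ^ 2 - 4) ^ (1 / 2 : ℂ)) / 2

/-- The Euler factor at `p` of `L(sym² f, s)`. -/
def symSqFactor {k : ℤ} (f : CuspForm 𝒮ℒ k) (s : ℂ) (p : ℕ) : ℂ :=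
  ((1 - satakeA f p ^ 2 * (p : ℂ) ^ (-s)) * (1 - satakeA f p * satakeB f p * (p : ℂ) ^ (-s)) *
    (1 - satakeB f p ^ 2 * (p : ℂ) ^ (-s)))⁻¹

/-- The Euler product of `L(sym² f, s)`, for `Re s > 1`. -/
def symSqEulerProduct {k : ℤ} (f : CuspForm 𝒮ℒ k) (s : ℂ) : ℂ :=
  ∏' p : Nat.Primes, symSqFactor f s p

/-- `L(sym² f, s)`, continued to a neighbourhood of `s = 1`. -/
def symSqL {k : ℤ} (f : CuspForm 𝒮ℒ k) : ℂ → ℂ := continuation (symSqEulerProduct f)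

/-- `Λ(sym² f, s) = (4π)^(-(s+k-1)) Γ(s+k-1) L(sym² f, s)`. -/
def symSqLambda {k : ℤ} (f : CuspForm 𝒮ℒ k) (s : ℂ) : ℂ :=
  (4 * π : ℂ) ^ (-(s + k - 1)) * Complex.Gamma (s + k - 1) * symSqL f s

end RegEis

end

open RegEis

open scoped MatrixGroups ComplexConjugate Modular Real
open MeasureTheory UpperHalfPlane

noncomputable section

namespace RegEis

section

/-! ### The Eisenstein series as a sum over lattice points -/

/-! Write `H(s)` for the integral over `𝒟` of `Ψ(z) (s - 1) E(z, s)`; this is `rankinIntegral`.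
Unfolding `E` and applying Parseval on horizontal lines gives `H(s) = (s - 1) (4π)^(-(s+k-1))
Γ(s+k-1) ∑ λ_f(n)² n^(-s)`. Comparing Euler factors gives `∑ λ_f(n)² n^(-s) = ζ(s) L(sym² f, s) /
ζ(2s)`. Hence `Λ(sym² f, s) = ζ(2s) H(s) / ((s - 1) ζ(s))`.

The function `(s - 1) E(z, s)` is holomorphic at `1`, with value `1 / V` and derivative `Ẽ(z, 1)`,
which is real. So `H(1) = ‖f‖² / V` and `H'(1) = ⟨Ψ, Ẽ(·, 1)⟩`. Since `(s - 1) ζ(s) = 1 + γ (s - 1)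
+ ...`, the logarithmic derivative at `1` reads `Λ'/Λ = 2 ζ'/ζ(2) + H'/H - γ`, which is the claim.
Moreover `Λ(sym² f, 1) = ζ(2) H(1)` is nonzero.

Three inputs carry the argument. Continuation of `E`: `2 ζ(2s) E` is `y^s` times a lattice sum,
which is compared row by row with integrals. The integrals add up to a multiple of `ζ(2s - 1)`,
which holds the pole; the errors converge absolutely near `s = 1`, uniformly on `𝒟`
(`norm_remTerm_le`, `eisReg_eq`, `exists_norm_eisReg_le`). Unfolding: `rankinSelberg` works in
`ℝ≥0∞` at real `s`, where Tonelli needs no convergence. Finiteness of the integral then yields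
convergence of the Dirichlet series for `Re s > 1` without any bound on coefficients, and the
identity theorem passes to complex `s`. Reality of `a_f(n)`: unfolding produces `|a_f(n)|²`, while
the Euler product needs `a_f(n)²`. The two agree because `T_n` is symmetric
(`IsHeckeForm.conj_fourierCoeff`). -/

/-- The quadratic form `|m z + x|²`, for real `m` and `x`. -/
def quadForm (z : ℍ) (m x : ℝ) : ℝ := (m * z.re + x) ^ 2 + (m * z.im) ^ 2

lemma quadForm_eq_normSq (z : ℍ) (m x : ℝ) :
    quadForm z m x = Complex.normSq ((m : ℂ) * z + x) := by
  simp [quadForm, Complex.normSq_apply]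
  ring

lemma quadForm_nonneg (z : ℍ) (m x : ℝ) : 0 ≤ quadForm z m x := by
  unfold quadForm; positivity

/-- `ρ` is a lower bound for the quadratic form `|m z + x|²` relative to `m² + x²`. -/
def IsLowerBound (z : ℍ) (ρ : ℝ) : Prop :=
  0 < ρ ∧ ∀ m x : ℝ, ρ * (m ^ 2 + x ^ 2) ≤ quadForm z m x

/-- The witness is determinant over trace of the Gram matrix `M` of the form. By Cayley–Hamilton,
`tr M · Q(v) - det M · |v|² = |M v|² ≥ 0`. -/
lemma exists_isLowerBound (z : ℍ) : ∃ ρ, IsLowerBound z ρ := by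
  have hy := z.im_pos
  have hD : 0 < 1 + z.re ^ 2 + z.im ^ 2 := by positivity
  refine ⟨z.im ^ 2 / (1 + z.re ^ 2 + z.im ^ 2), by positivity, fun m x => ?_⟩
  rw [div_mul_eq_mul_div, div_le_iff₀ hD, quadForm]
  nlinarith [sq_nonneg (m * z.re + x + z.re * (m * (z.re ^ 2 + z.im ^ 2) + z.re * x)),
    sq_nonneg (m * (z.re ^ 2 + z.im ^ 2) + z.re * x), sq_nonneg (m * z.re + x)]

/-- With `|z| ≥ 1` and `|Re z| ≤ 1/2` the cross term is at most `|m x| ≤ (m² + x²) / 2`. That `1 /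
2` serves all of `𝒟` is what makes later bounds uniform in `z`. -/
lemma isLowerBound_half_of_mem_fd {z : ℍ} (hz : z ∈ 𝒟) : IsLowerBound z (1 / 2) := by
  refine ⟨by norm_num, fun m x => ?_⟩
  obtain ⟨h1, h2⟩ := hz
  rw [Complex.normSq_apply] at h1
  change 1 ≤ z.re * z.re + z.im * z.im at h1
  have h3 : |m * x * z.re| ≤ |m * x| / 2 := by
    rw [abs_mul]; nlinarith [abs_nonneg (m * x)]
  have h4 := neg_abs_le (m * x * z.re)
  have h5 : |m * x| ≤ (m ^ 2 + x ^ 2) / 2 := by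
    rw [abs_le]; constructor <;> nlinarith [sq_nonneg (m + x), sq_nonneg (m - x)]
  unfold quadForm
  nlinarith [sq_nonneg m]

lemma IsLowerBound.mono {z : ℍ} {ρ ρ' : ℝ} (h : IsLowerBound z ρ) (h0 : 0 < ρ') (h1 : ρ' ≤ ρ) :
    IsLowerBound z ρ' :=
  ⟨h0, fun m x => (mul_le_mul_of_nonneg_right h1 (by positivity)).trans (h.2 m x)⟩

lemma IsLowerBound.pos {z : ℍ} {ρ m x : ℝ} (h : IsLowerBound z ρ) (hm : m ≠ 0) :
    0 < quadForm z m x :=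
  (mul_pos h.1 (by positivity)).trans_le (h.2 m x)

lemma quadForm_pos {z : ℍ} {m : ℝ} (hm : m ≠ 0) (x : ℝ) : 0 < quadForm z m x :=
  (exists_isLowerBound z).elim fun _ h => h.pos hm

lemma norm_sq_le (v : Fin 2 → ℤ) : ‖v‖ ^ 2 ≤ (v 0 : ℝ) ^ 2 + (v 1 : ℝ) ^ 2 := by
  rw [EisensteinSeries.norm_eq_max_natAbs]
  push_cast
  have h0 : ((v 0).natAbs : ℝ) ^ 2 = (v 0 : ℝ) ^ 2 := by rw [Nat.cast_natAbs]; simp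
  have h1 : ((v 1).natAbs : ℝ) ^ 2 = (v 1 : ℝ) ^ 2 := by rw [Nat.cast_natAbs]; simp
  rcases max_cases ((v 0).natAbs : ℝ) ((v 1).natAbs : ℝ) with ⟨h, -⟩ | ⟨h, -⟩ <;> rw [h] <;>
    nlinarith [sq_nonneg (v 0 : ℝ), sq_nonneg (v 1 : ℝ)]

/-- The general term of the lattice sum: `|m z + n|^(-2 s)`. -/
def latTerm (z : ℍ) (s : ℂ) (v : Fin 2 → ℤ) : ℂ := (quadForm z (v 0) (v 1) : ℂ) ^ (-s)

/-- Because `0 ^ (-s) = 0`, sums over all of `ℤ²` need no removal of the origin. -/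
lemma latTerm_zero (z : ℍ) {s : ℂ} (hs : s ≠ 0) : latTerm z s 0 = 0 := by
  simp [latTerm, quadForm, hs]

lemma norm_latTerm_le {z : ℍ} {ρ : ℝ} (h : IsLowerBound z ρ) {s : ℂ} (hs : 0 < s.re)
    (v : Fin 2 → ℤ) : ‖latTerm z s v‖ ≤ ρ ^ (-s.re) * ‖v‖ ^ (-(2 * s.re)) := by
  have hρ := h.1
  rcases eq_or_ne v 0 with rfl | hv
  · rw [latTerm_zero z (by rintro rfl; simp at hs), norm_zero]
    positivity
  have hv' : 0 < ‖v‖ := norm_pos_iff.mpr hv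
  have h1 : ρ * ‖v‖ ^ 2 ≤ quadForm z (v 0) (v 1) :=
    (mul_le_mul_of_nonneg_left (norm_sq_le v) hρ.le).trans (h.2 _ _)
  have h2 : 0 < ρ * ‖v‖ ^ 2 := by positivity
  rw [latTerm, Complex.norm_cpow_eq_rpow_re_of_pos (h2.trans_le h1), Complex.neg_re]
  refine (Real.rpow_le_rpow_of_nonpos h2 h1 (by linarith)).trans ?_
  rw [Real.mul_rpow hρ.le (by positivity), ← Real.rpow_natCast, ← Real.rpow_mul hv'.le]
  simp

lemma summable_norm_latTerm (z : ℍ) {s : ℂ} (hs : 1 < s.re) :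
    Summable fun v => ‖latTerm z s v‖ := by
  obtain ⟨ρ, h⟩ := exists_isLowerBound z
  refine Summable.of_nonneg_of_le (fun _ => norm_nonneg _)
    (fun v => norm_latTerm_le h (by linarith) v) ?_
  exact (EisensteinSeries.summable_one_div_norm_rpow (by linarith)).mul_left _

lemma latTerm_smul (z : ℍ) (s : ℂ) (r : ℕ) (v : Fin 2 → ℤ) :
    latTerm z s (r • v) = 1 / (r : ℂ) ^ (2 * s) * latTerm z s v := by
  have h : quadForm z ((r • v) 0 : ℤ) ((r • v) 1 : ℤ) = (r : ℝ) ^ 2 * quadForm z (v 0) (v 1) := by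
    simp [quadForm]; ring
  rw [latTerm, h, Complex.ofReal_mul,
    Complex.mul_cpow_ofReal_nonneg (by positivity) (quadForm_nonneg _ _ _), latTerm]
  congr 1
  have h2 : (2 : ℂ) * s = ((2 : ℕ) : ℂ) * s := by norm_num
  rw [h2, Complex.cpow_nat_mul' (by simp [Complex.natCast_arg, Real.pi_pos])
    (by simp [Complex.natCast_arg, Real.pi_pos.le]), Complex.cpow_neg]
  simp

open EisensteinSeries in
/-- The lattice sum is `ζ(2 s)` times the sum over coprime pairs. -/
lemma tsum_latTerm (z : ℍ) {s : ℂ} (hs : 1 < s.re) :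
    ∑' v, latTerm z s v = riemannZeta (2 * s) * ∑' v : gammaSet 1 1 0, latTerm z s v := by
  have hsum := summable_norm_latTerm z hs
  have hs2 : 1 < (2 * s).re := by simp; linarith
  have hz : Summable fun n : ℕ => ‖1 / (n : ℂ) ^ (2 * s)‖ :=
    (Complex.summable_one_div_nat_cpow.mpr hs2).norm
  have hsub : Summable fun v : gammaSet 1 1 0 => ‖latTerm z s v‖ := hsum.subtype _
  have hsig : Summable fun v : Σ r : ℕ, gammaSet 1 r 0 =>
      latTerm z s (gammaSetDivGcdSigmaEquiv.symm v) :=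
    (Equiv.summable_iff gammaSetDivGcdSigmaEquiv.symm (f := latTerm z s)).mpr hsum.of_norm
  rw [← gammaSetDivGcdSigmaEquiv.symm.tsum_eq, hsig.tsum_sigma,
    zeta_eq_tsum_one_div_nat_cpow hs2, tsum_mul_tsum_of_summable_norm hz hsub,
    Summable.tsum_prod' (summable_mul_of_summable_norm hz hsub)
      fun b => hsub.of_norm.mul_left (1 / (b : ℂ) ^ (2 * s))]
  refine tsum_congr fun b => ?_
  have key : ∀ v : gammaSet 1 b 0,
      latTerm z s v = 1 / (b : ℂ) ^ (2 * s) * latTerm z s (divIntMap b v) := fun v => by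
    rw [← latTerm_smul, ← gammaSet_eq_gcd_mul_divIntMap v.2]
  simp_rw [gammaSetDivGcdSigmaEquiv_symm_eq, key, tsum_mul_left]
  -- A pair with gcd `0` is the origin; there `0 ^ (2 * s) = 0` and `1 / 0 = 0` make both sides
  -- vanish.
  rcases eq_or_ne b 0 with rfl | hb
  · rw [Nat.cast_zero, Complex.zero_cpow (by intro h; simp [h] at hs2; linarith)]
    simp
  · have : NeZero b := ⟨hb⟩
    congr 1
    exact (gammaSetDivGcdEquiv b).tsum_eq (fun v => latTerm z s v)

/-! ### Cosets of `Γ_∞` and coprime pairs. -/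

/-- The cosets of `Γ_∞`. -/
abbrev Cosets : Type := Quotient (QuotientGroup.rightRel GammaInf)

/-- The bottom row of a representative of a coset. -/
def cosetRow (c : Cosets) : Fin 2 → ℤ := c.out 1

lemma cosetIm_eq (z : ℍ) (c : Cosets) : cosetIm z c = (c.out • z).im := by
  conv_lhs => rw [← Quotient.out_eq c]
  rfl

lemma cosetIm_pos (z : ℍ) (c : Cosets) : 0 < cosetIm z c := by
  rw [cosetIm_eq]; exact UpperHalfPlane.im_pos _

lemma cosetIm_eq_div (z : ℍ) (c : Cosets) :
    cosetIm z c = z.im / quadForm z (cosetRow c 0) (cosetRow c 1) := by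
  rw [cosetIm_eq, ModularGroup.im_smul_eq_div_normSq, ModularGroup.denom_apply, quadForm_eq_normSq]
  simp [cosetRow]

lemma mem_GammaInf_iff {γ : SL(2, ℤ)} : γ ∈ GammaInf ↔ γ 1 0 = 0 := Iff.rfl

/-- The lower left entry of `b a⁻¹` is, up to sign, the determinant of the two bottom rows. -/
lemma coset_eq_iff (a b : SL(2, ℤ)) :
    (Quotient.mk (QuotientGroup.rightRel GammaInf) a = Quotient.mk _ b) ↔
      b 1 0 * a 1 1 = b 1 1 * a 1 0 := by
  rw [Quotient.eq, QuotientGroup.rightRel_apply, mem_GammaInf_iff]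
  simp [Matrix.mul_apply, Matrix.SpecialLinearGroup.coe_inv, Matrix.adjugate_fin_two]
  constructor <;> intro h <;> linarith

lemma row_eq_of_proportional {a b : SL(2, ℤ)} (h : b 1 0 * a 1 1 = b 1 1 * a 1 0) :
    ∃ ε : ℤˣ, b 1 = (ε : ℤ) • a 1 := by
  have hm : b * a⁻¹ ∈ GammaInf :=
    QuotientGroup.rightRel_apply.mp (Quotient.eq.mp ((coset_eq_iff a b).mpr h))
  set η := b * a⁻¹ with hη
  have hb : b = η * a := by simp [hη]
  have h0 : η 1 0 = 0 := hm
  have hdet : η 0 0 * η 1 1 = 1 := by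
    have := Matrix.SpecialLinearGroup.det_coe η
    rw [Matrix.det_fin_two, h0] at this
    simpa using this
  refine ⟨⟨η 1 1, η 0 0, by rw [mul_comm]; exact hdet, hdet⟩, ?_⟩
  rw [hb]
  ext j
  simp [Matrix.mul_apply, h0]

/-- Coprime pairs, up to sign, are the bottom rows of cosets of `Γ_∞`. -/
def cosetsEquiv : Cosets × ℤˣ ≃ EisensteinSeries.gammaSet 1 1 0 :=
  Equiv.ofBijective
    (fun p => ⟨(p.2 : ℤ) • cosetRow p.1, by
      rw [EisensteinSeries.mem_gammaSet_one]
      have := ModularGroup.bottom_row_coprime p.1.out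
      rcases Int.units_eq_one_or p.2 with h | h
      · simpa [h, cosetRow] using this
      · simpa [h, cosetRow] using this.neg_neg⟩) (by
    constructor
    · rintro ⟨c, ε⟩ ⟨c', ε'⟩ h
      simp only [Subtype.mk.injEq] at h
      have h0 := congr_fun h 0
      have h1 := congr_fun h 1
      simp only [Pi.smul_apply, smul_eq_mul, cosetRow] at h0 h1
      have hε : (ε : ℤ) * ε = 1 := Int.units_coe_mul_self ε
      have hε' : (ε' : ℤ) * ε' = 1 := Int.units_coe_mul_self ε'
      have hc : c = c' := by
        rw [← Quotient.out_eq c, ← Quotient.out_eq c', coset_eq_iff]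
        have e0 : c.out 1 0 = ε * (ε' * c'.out 1 0) := by
          rw [← h0, ← mul_assoc, hε, one_mul]
        have e1 : c.out 1 1 = ε * (ε' * c'.out 1 1) := by
          rw [← h1, ← mul_assoc, hε, one_mul]
        rw [e0, e1]; ring
      subst hc
      have hcop := ModularGroup.bottom_row_coprime c.out
      -- A Bézout relation for the bottom row recovers the sign from the signed row.
      have : (ε : ℤ) = ε' := by
        obtain ⟨u, w, huw⟩ := hcop
        calc (ε : ℤ) = u * (ε * c.out 1 0) + w * (ε * c.out 1 1) := by linear_combination -(ε : ℤ) * huw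
          _ = ε' := by rw [h0, h1]; linear_combination (ε' : ℤ) * huw
      simp [Units.ext this]
    · rintro ⟨v, hv⟩
      rw [EisensteinSeries.mem_gammaSet_one] at hv
      obtain ⟨g, -, hg⟩ := ModularGroup.bottom_row_surj hv
      have h := Quotient.out_eq (Quotient.mk (QuotientGroup.rightRel GammaInf) g)
      rw [coset_eq_iff] at h
      obtain ⟨ε, hε⟩ := row_eq_of_proportional h
      refine ⟨(Quotient.mk _ g, ε), ?_⟩
      simp only [Subtype.mk.injEq]
      rw [← hg]; exact hε.symm)

lemma cosetsEquiv_apply (p : Cosets × ℤˣ) :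
    (cosetsEquiv p : Fin 2 → ℤ) = (p.2 : ℤ) • cosetRow p.1 := rfl

lemma cosetIm_cpow (z : ℍ) (s : ℂ) (p : Cosets × ℤˣ) :
    (cosetIm z p.1 : ℂ) ^ s = (z.im : ℂ) ^ s * latTerm z s (cosetsEquiv p) := by
  have h : quadForm z ((cosetsEquiv p : Fin 2 → ℤ) 0) ((cosetsEquiv p : Fin 2 → ℤ) 1) =
      quadForm z (cosetRow p.1 0) (cosetRow p.1 1) := by
    rw [cosetsEquiv_apply]
    rcases Int.units_eq_one_or p.2 with h | h <;> simp [h, quadForm]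
    ring
  have hq := quadForm_nonneg z (cosetRow p.1 0) (cosetRow p.1 1)
  rw [cosetIm_eq_div, latTerm, h, div_eq_mul_inv, Complex.ofReal_mul,
    Complex.mul_cpow_ofReal_nonneg z.im_pos.le (inv_nonneg.mpr hq), Complex.ofReal_inv,
    Complex.inv_cpow _ _ (by rw [Complex.arg_ofReal_of_nonneg hq]; exact Real.pi_pos.ne),
    Complex.cpow_neg]

lemma summable_cosets_prod (z : ℍ) {s : ℂ} (hs : 1 < s.re) :
    Summable fun p : Cosets × ℤˣ => (cosetIm z p.1 : ℂ) ^ s := by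
  simp_rw [cosetIm_cpow]
  refine Summable.mul_left _ ?_
  exact cosetsEquiv.summable_iff.mpr ((summable_norm_latTerm z hs).of_norm.subtype _)

lemma summable_cosetIm_cpow (z : ℍ) {s : ℂ} (hs : 1 < s.re) :
    Summable fun c : Cosets => (cosetIm z c : ℂ) ^ s := by
  have := (summable_cosets_prod z hs).comp_injective
    (i := fun c : Cosets => (c, (1 : ℤˣ))) (fun a b h => by simpa using h)
  exact this

/-- The factor `2` counts the two signs of a coprime pair. -/
lemma two_mul_eisenstein (z : ℍ) {s : ℂ} (hs : 1 < s.re) :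
    2 * eisenstein z s =
      (z.im : ℂ) ^ s * ∑' v : EisensteinSeries.gammaSet 1 1 0, latTerm z s v := by
  rw [← cosetsEquiv.tsum_eq, ← tsum_mul_left]
  simp_rw [← cosetIm_cpow]
  rw [(summable_cosets_prod z hs).tsum_prod' fun c => (hasSum_fintype _).summable, eisenstein,
    ← tsum_mul_left]
  refine tsum_congr fun c => ?_
  simp

/-- The Eisenstein series as a lattice sum. -/
lemma two_mul_zeta_mul_eisenstein (z : ℍ) {s : ℂ} (hs : 1 < s.re) :
    2 * riemannZeta (2 * s) * eisenstein z s = (z.im : ℂ) ^ s * ∑' v, latTerm z s v := by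
  rw [tsum_latTerm z hs, mul_left_comm, ← two_mul_eisenstein z hs]
  ring

end

section

/-! ### Analyticity of parameter integrals -/

/-- A parameter integral of holomorphic functions with an integrable majorant is holomorphic, and
may be differentiated under the integral sign. -/
lemma hasDerivAt_integral_of_norm_le {α : Type*} [MeasurableSpace α] {μ : Measure α}
    {F : ℂ → α → ℂ} {U : Set ℂ} (hU : IsOpen U) {g : α → ℝ} (hg : Integrable g μ)
    (hm : ∀ s ∈ U, AEStronglyMeasurable (F s) μ)
    (hd : ∀ᵐ a ∂μ, DifferentiableOn ℂ (fun s => F s a) U)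
    (hb : ∀ᵐ a ∂μ, ∀ s ∈ U, ‖F s a‖ ≤ g a) {s₀ : ℂ} (h₀ : s₀ ∈ U) :
    Integrable (fun a => deriv (fun s => F s a) s₀) μ ∧
      HasDerivAt (fun s => ∫ a, F s a ∂μ) (∫ a, deriv (fun s => F s a) s₀ ∂μ) s₀ := by
  obtain ⟨r, hr, hball⟩ := Metric.isOpen_iff.mp hU s₀ h₀
  have hr2 : 0 < r / 2 := by positivity
  have hsub : ∀ s ∈ Metric.ball s₀ (r / 2), Metric.closedBall s (r / 4) ⊆ U := by
    intro s hs w hw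
    refine hball ?_
    have h1 := Metric.mem_ball.mp hs
    have h2 := Metric.mem_closedBall.mp hw
    have h3 := dist_triangle w s s₀
    exact Metric.mem_ball.mpr (by linarith)
  have hInt : Integrable (F s₀) μ :=
    hg.mono' (hm s₀ h₀) (hb.mono fun a ha => ha s₀ h₀)
  have hda : ∀ᵐ a ∂μ, ∀ s ∈ Metric.ball s₀ (r / 2),
      HasDerivAt (fun s => F s a) (deriv (fun s => F s a) s) s := by
    filter_upwards [hd] with a ha s hs
    exact (ha.differentiableAt (hU.mem_nhds (hsub s hs (Metric.mem_closedBall_self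
      (by positivity))))).hasDerivAt
  refine hasDerivAt_integral_of_dominated_loc_of_deriv_le (s := Metric.ball s₀ (r / 2))
    (bound := fun a => g a / (r / 4)) (F' := fun s a => deriv (fun s => F s a) s)
    (Metric.ball_mem_nhds s₀ hr2) ?_ hInt ?_ ?_ (hg.div_const _) hda
  · filter_upwards [hU.mem_nhds h₀] with s hs using hm s hs
  -- The derivative is measurable as an a.e. limit of difference quotients along a sequence.
  · have hu : ∃ u : ℕ → ℂ, Filter.Tendsto u Filter.atTop (nhdsWithin s₀ {s₀}ᶜ) :=
      Filter.exists_seq_tendsto _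
    obtain ⟨u, hu⟩ := hu
    have hu' : ∀ᶠ n in Filter.atTop, u n ∈ U :=
      (hu.mono_right nhdsWithin_le_nhds).eventually (hU.mem_nhds h₀)
    obtain ⟨N, hN⟩ := Filter.eventually_atTop.mp hu'
    have hu2 := hu.comp (Filter.tendsto_add_atTop_nat N)
    refine aestronglyMeasurable_of_tendsto_ae Filter.atTop
      (f := fun n a => slope (fun s => F s a) s₀ (u (n + N))) (fun n => ?_) ?_
    · simp only [slope_def_field]
      simp only [div_eq_mul_inv]
      exact ((hm _ (hN (n + N) (Nat.le_add_left N n))).sub (hm _ h₀)).mul_const _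
    · filter_upwards [hda] with a ha
      have := ha s₀ (Metric.mem_ball_self hr2)
      exact (hasDerivAt_iff_tendsto_slope.mp this).comp hu2
  -- Cauchy's estimate on the circle of radius `r / 4` about `s` turns the majorant `g` into one for
  -- the derivative.
  · filter_upwards [hd, hb] with a ha hba s hs
    refine Complex.norm_deriv_le_of_forall_mem_sphere_norm_le (by positivity) ?_ ?_
    · exact (ha.mono (hsub s hs)).diffContOnCl_ball (U := Metric.closedBall s (r / 4)) (by rfl)
    · intro w hw
      exact hba w (hsub s hs (Metric.sphere_subset_closedBall hw))

/-! ### The regularized zeta function -/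

/-- The entire function `(w - 1) ζ(w)`. -/
def zetaReg : ℂ → ℂ := Function.update (fun w => (w - 1) * riemannZeta w) 1 1

lemma zetaReg_one : zetaReg 1 = 1 := by simp [zetaReg]

lemma zetaReg_of_ne {w : ℂ} (hw : w ≠ 1) : zetaReg w = (w - 1) * riemannZeta w := by
  simp [zetaReg, hw]

/-- At `w = 1` the singularity is removable, the residue of `ζ` being the assigned value `1`. -/
lemma analyticAt_zetaReg (w : ℂ) : AnalyticAt ℂ zetaReg w := by
  rcases eq_or_ne w 1 with rfl | hw
  · refine Complex.analyticAt_of_differentiable_on_punctured_nhds_of_continuousAt ?_ ?_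
    · filter_upwards [self_mem_nhdsWithin] with w hw
      have : zetaReg =ᶠ[nhds w] fun w => (w - 1) * riemannZeta w := by
        filter_upwards [isOpen_ne.mem_nhds hw] with u hu using zetaReg_of_ne hu
      refine DifferentiableAt.congr_of_eventuallyEq ?_ this
      exact ((differentiableAt_id.sub_const _).mul (differentiableAt_riemannZeta hw))
    · exact continuousAt_update_same.mpr riemannZeta_residue_one
  · have hd : DifferentiableOn ℂ zetaReg {1}ᶜ := by
      intro u hu
      refine DifferentiableWithinAt.congr (f := fun w => (w - 1) * riemannZeta w) ?_
        (fun v hv => zetaReg_of_ne hv) (zetaReg_of_ne hu)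
      exact ((differentiableAt_id.sub_const _).mul
        (differentiableAt_riemannZeta hu)).differentiableWithinAt
    exact hd.analyticAt (isOpen_ne.mem_nhds hw)

lemma differentiable_zetaReg : Differentiable ℂ zetaReg :=
  fun w => (analyticAt_zetaReg w).differentiableAt

/-- The derivative of `(w - 1) ζ(w)` at `1` is Euler's constant. -/
lemma deriv_zetaReg_one : deriv zetaReg 1 = Real.eulerMascheroniConstant := by
  have h1 := hasDerivAt_iff_tendsto_slope.mp (differentiable_zetaReg 1).hasDerivAt
  refine tendsto_nhds_unique h1 (tendsto_riemannZeta_sub_one_div.congr' ?_)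
  filter_upwards [self_mem_nhdsWithin] with w hw
  have hw : w - 1 ≠ 0 := sub_ne_zero.mpr hw
  rw [slope_def_field, zetaReg_of_ne (by simpa [sub_eq_zero] using hw), zetaReg_one]
  field_simp

lemma tsum_int_abs_cpow {w : ℂ} (hw : 1 < w.re) :
    ∑' n : ℤ, ((|(n : ℝ)| : ℝ) : ℂ) ^ (-w) = 2 * riemannZeta w := by
  have h0 : w ≠ 0 := Complex.ne_zero_of_one_lt_re hw
  have hs : Summable fun n : ℤ => ((|(n : ℝ)| : ℝ) : ℂ) ^ (-w) := by
    have : Summable fun n : ℕ => ((n : ℝ) : ℂ) ^ (-w) := by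
      simpa [Complex.cpow_neg] using Complex.summable_one_div_nat_cpow.mpr hw
    refine Summable.of_nat_of_neg ?_ ?_ <;> simpa using this
  rw [tsum_int_eq_zero_add_two_mul_tsum_pnat (fun n => by simp) hs,
    zeta_eq_tsum_one_div_nat_add_one_cpow hw,
    tsum_pnat_eq_tsum_succ (f := fun n : ℕ => ((|((n : ℤ) : ℝ)| : ℝ) : ℂ) ^ (-w))]
  have habs : ∀ n : ℕ, |(n : ℝ) + 1| = n + 1 := fun n => abs_of_pos (by positivity)
  simp [h0, Complex.cpow_neg, habs]

end

section

/-! ### Comparison of the lattice sum with an integral -/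

lemma hasDerivAt_quadForm_cpow (z : ℍ) {m : ℝ} (hm : m ≠ 0) (s : ℂ) (x : ℝ) :
    HasDerivAt (fun x : ℝ => (quadForm z m x : ℂ) ^ (-s))
      (-s * (quadForm z m x : ℂ) ^ (-s - 1) * ((2 * (m * z.re + x) : ℝ) : ℂ)) x := by
  have hq := quadForm_pos (z := z) hm x
  have h1 : HasDerivAt (fun x : ℝ => quadForm z m x) (2 * (m * z.re + x)) x := by
    have := (((hasDerivAt_id x).const_add (m * z.re)).pow 2).add_const ((m * z.im) ^ 2)
    simpa [quadForm] using this
  have h2 : HasDerivAt (fun w : ℂ => w ^ (-s)) (-s * (quadForm z m x : ℂ) ^ (-s - 1))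
      (quadForm z m x : ℂ) := by
    simpa using (hasDerivAt_id (quadForm z m x : ℂ)).cpow_const (c := -s)
      (Complex.ofReal_mem_slitPlane.mpr hq)
  exact h2.comp x h1.ofReal_comp

lemma continuous_quadForm_cpow (z : ℍ) {m : ℝ} (hm : m ≠ 0) (s : ℂ) :
    Continuous fun x : ℝ => (quadForm z m x : ℂ) ^ (-s) :=
  continuous_iff_continuousAt.mpr fun x => (hasDerivAt_quadForm_cpow z hm s x).continuousAt

/-- Since `|m Re z + x| ≤ Q^(1/2)`, differentiating in `x` gains half a power of the form `Q`. This
gain makes the sum of the errors converge to the left of `Re s = 1`. -/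
lemma norm_deriv_quadForm_cpow_le (z : ℍ) {m : ℝ} (hm : m ≠ 0) (s : ℂ) (x : ℝ) :
    ‖-s * (quadForm z m x : ℂ) ^ (-s - 1) * ((2 * (m * z.re + x) : ℝ) : ℂ)‖ ≤
      2 * ‖s‖ * quadForm z m x ^ (-(s.re + 1 / 2)) := by
  have hq := quadForm_pos (z := z) hm x
  have h1 : |m * z.re + x| ≤ quadForm z m x ^ (1 / 2 : ℝ) := by
    rw [← Real.sqrt_eq_rpow]
    exact Real.abs_le_sqrt (by unfold quadForm; nlinarith [sq_nonneg (m * z.im)])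
  rw [norm_mul, norm_mul, norm_neg, Complex.norm_cpow_eq_rpow_re_of_pos hq, Complex.norm_real,
    Real.norm_eq_abs, abs_mul, abs_two]
  have h2 : quadForm z m x ^ (-(s.re + 1 / 2)) =
      quadForm z m x ^ (-s - 1).re * quadForm z m x ^ (1 / 2 : ℝ) := by
    rw [← Real.rpow_add hq]; congr 1; simp; ring
  rw [h2]
  calc ‖s‖ * quadForm z m x ^ (-s - 1).re * (2 * |m * z.re + x|)
      ≤ ‖s‖ * quadForm z m x ^ (-s - 1).re * (2 * quadForm z m x ^ (1 / 2 : ℝ)) := by gcongr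
    _ = _ := by ring

/-- The integral of `|m z + x|^(-2 s)` over `v₁ ≤ x ≤ v₁ + 1`, for `m = v₀ ≠ 0`. -/
def intTerm (z : ℍ) (s : ℂ) (v : Fin 2 → ℤ) : ℂ :=
  if v 0 = 0 then 0 else ∫ x in (v 1 : ℝ)..(v 1 + 1), (quadForm z (v 0) x : ℂ) ^ (-s)

/-- The difference between a lattice term and the corresponding integral. -/
def remTerm (z : ℍ) (s : ℂ) (v : Fin 2 → ℤ) : ℂ :=
  if v 0 = 0 then 0 else latTerm z s v - intTerm z s v

/-- The constant in the bound for `remTerm`. -/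
def remConst (ρ : ℝ) : ℝ := 5 / 2 * (ρ / 4) ^ (-2 : ℝ)

/-- The disc around `1` in which the Eisenstein series is continued. -/
abbrev disc : Set ℂ := Metric.ball 1 (1 / 4)

lemma re_of_mem_disc {s : ℂ} (hs : s ∈ disc) : 3 / 4 < s.re ∧ s.re < 5 / 4 := by
  have h := (Complex.abs_re_le_norm (s - 1)).trans_lt (mem_ball_iff_norm.mp hs)
  rw [abs_lt, Complex.sub_re, Complex.one_re] at h
  constructor <;> linarith

lemma norm_of_mem_disc {s : ℂ} (hs : s ∈ disc) : ‖s‖ ≤ 5 / 4 := by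
  have h := mem_ball_iff_norm.mp hs
  have := norm_add_le (s - 1) 1
  rw [sub_add_cancel, norm_one] at this
  linarith

/-- Replacing `v 1` by `x` moves it by at most `1 ≤ |v 0|`, which costs at most a factor `4` in the
sum of squares. -/
lemma quadForm_ge {z : ℍ} {ρ : ℝ} (h : IsLowerBound z ρ) {v : Fin 2 → ℤ} (hv : v 0 ≠ 0) {x : ℝ}
    (hx : x ∈ Set.Icc (v 1 : ℝ) (v 1 + 1)) : ρ / 4 * ‖v‖ ^ 2 ≤ quadForm z (v 0) x := by
  have hm : (1 : ℝ) ≤ (v 0 : ℝ) ^ 2 := by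
    have : (1 : ℤ) ≤ (v 0) ^ 2 := by
      have := sq_pos_of_ne_zero hv; lia
    exact_mod_cast this
  have h1 := norm_sq_le v
  have h2 := h.2 (v 0) x
  have h3 : (v 0 : ℝ) ^ 2 + (v 1 : ℝ) ^ 2 ≤ 4 * ((v 0 : ℝ) ^ 2 + x ^ 2) := by
    have h4 : ((v 1 : ℝ) - x) ^ 2 ≤ 1 := by
      rw [sq_le_one_iff_abs_le_one, abs_le]; constructor <;> linarith [hx.1, hx.2]
    nlinarith [sq_nonneg ((v 1 : ℝ) - 2 * x)]
  have := h.1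
  nlinarith

lemma one_le_norm_of_ne {v : Fin 2 → ℤ} (hv : v 0 ≠ 0) : 1 ≤ ‖v‖ := by
  refine le_trans ?_ (norm_le_pi_norm v 0)
  rw [Int.norm_eq_abs]
  exact_mod_cast Int.one_le_abs hv

lemma rpow_quadForm_le {z : ℍ} {ρ : ℝ} (h : IsLowerBound z ρ) (hρ : ρ ≤ 1) {s : ℂ} (hs : s ∈ disc)
    {v : Fin 2 → ℤ} (hv : v 0 ≠ 0) {x : ℝ} (hx : x ∈ Set.Icc (v 1 : ℝ) (v 1 + 1)) :
    quadForm z (v 0) x ^ (-(s.re + 1 / 2)) ≤ (ρ / 4) ^ (-2 : ℝ) * ‖v‖ ^ (-(5 / 2) : ℝ) := by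
  have hN := one_le_norm_of_ne hv
  have hρ0 := h.1
  obtain ⟨hs1, hs2⟩ := re_of_mem_disc hs
  refine (Real.rpow_le_rpow_of_nonpos (by positivity) (quadForm_ge h hv hx) (by linarith)).trans ?_
  rw [Real.mul_rpow (by positivity) (by positivity), ← Real.rpow_natCast,
    ← Real.rpow_mul (by positivity)]
  gcongr ?_ * ?_
  · exact Real.rpow_le_rpow_of_exponent_ge (by positivity) (by linarith) (by linarith)
  · exact Real.rpow_le_rpow_of_exponent_le hN (by push_cast; linarith)

/-- Mean value inequality on an interval of length `1`. In `remConst` the `5 / 2` bounds `2 ‖s‖` on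
`disc`. The exponent `5 / 2` of `‖v‖` is `2 (3/4 + 1/2)`; it exceeds `2`, so the bound is summable
over `ℤ²`. -/
lemma norm_remTerm_le {z : ℍ} {ρ : ℝ} (h : IsLowerBound z ρ) (hρ : ρ ≤ 1) {s : ℂ} (hs : s ∈ disc)
    (v : Fin 2 → ℤ) : ‖remTerm z s v‖ ≤ remConst ρ * ‖v‖ ^ (-(5 / 2) : ℝ) := by
  have hρ0 := h.1
  unfold remTerm
  split_ifs with hv
  · rw [norm_zero]; unfold remConst; positivity
  have hm : (v 0 : ℝ) ≠ 0 := by exact_mod_cast hv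
  have hc := continuous_quadForm_cpow z hm s
  have h1 : latTerm z s v - intTerm z s v =
      ∫ x in (v 1 : ℝ)..(v 1 + 1),
        ((quadForm z (v 0) (v 1) : ℂ) ^ (-s) - (quadForm z (v 0) x : ℂ) ^ (-s)) := by
    rw [intervalIntegral.integral_sub (by simp) (hc.intervalIntegrable _ _)]
    simp [latTerm, intTerm, hv]
  have h2 : ∀ x ∈ Set.uIoc (v 1 : ℝ) (v 1 + 1),
      ‖(quadForm z (v 0) (v 1) : ℂ) ^ (-s) - (quadForm z (v 0) x : ℂ) ^ (-s)‖ ≤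
        remConst ρ * ‖v‖ ^ (-(5 / 2) : ℝ) := by
    intro x hx
    rw [Set.uIoc_of_le (by linarith)] at hx
    have hx' : x ∈ Set.Icc (v 1 : ℝ) (v 1 + 1) := Set.Ioc_subset_Icc_self hx
    have hmv := Convex.norm_image_sub_le_of_norm_hasDerivWithin_le
      (s := Set.Icc (v 1 : ℝ) (v 1 + 1)) (C := remConst ρ * ‖v‖ ^ (-(5 / 2) : ℝ))
      (fun y _ => (hasDerivAt_quadForm_cpow z hm s y).hasDerivWithinAt)
      (fun y hy => ?_) (convex_Icc _ _) hx' (Set.left_mem_Icc.mpr (by linarith))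
    · refine hmv.trans ?_
      have : ‖(v 1 : ℝ) - x‖ ≤ 1 := by
        rw [Real.norm_eq_abs, abs_le]; constructor <;> linarith [hx.1, hx.2]
      have h0 : 0 ≤ remConst ρ * ‖v‖ ^ (-(5 / 2) : ℝ) := by unfold remConst; positivity
      nlinarith
    · refine (norm_deriv_quadForm_cpow_le z hm s y).trans ?_
      have e1 := rpow_quadForm_le h hρ hs hv hy
      have e2 := norm_of_mem_disc hs
      have e3 : 0 ≤ quadForm z (v 0) y ^ (-(s.re + 1 / 2)) :=
        Real.rpow_nonneg (quadForm_nonneg _ _ _) _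
      rw [remConst, mul_assoc (5 / 2)]
      refine mul_le_mul (by linarith) e1 e3 (by norm_num)
  rw [h1]
  simpa using intervalIntegral.norm_integral_le_of_norm_le_const h2

lemma summable_bound (ρ : ℝ) :
    Summable fun v : Fin 2 → ℤ => remConst ρ * ‖v‖ ^ (-(5 / 2) : ℝ) :=
  (EisensteinSeries.summable_one_div_norm_rpow (by norm_num)).mul_left _

lemma summable_remTerm (z : ℍ) {s : ℂ} (hs : s ∈ disc) : Summable (remTerm z s) := by
  obtain ⟨ρ, h⟩ := exists_isLowerBound z
  have h' : IsLowerBound z (min ρ 1) := h.mono (lt_min h.1 one_pos) (min_le_left _ _)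
  exact Summable.of_norm_bounded (summable_bound _) (norm_remTerm_le h' (min_le_right _ _) hs)

lemma differentiableOn_intTerm (z : ℍ) (v : Fin 2 → ℤ) :
    DifferentiableOn ℂ (fun s => intTerm z s v) disc := by
  unfold intTerm
  split_ifs with hv
  · exact differentiableOn_const 0
  have hm : (v 0 : ℝ) ≠ 0 := by exact_mod_cast hv
  simp_rw [intervalIntegral.integral_of_le (show (v 1 : ℝ) ≤ v 1 + 1 by linarith)]
  obtain ⟨ρ, h⟩ := exists_isLowerBound z
  have h' : IsLowerBound z (min ρ 1) := h.mono (lt_min h.1 one_pos) (min_le_left _ _)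
  intro s hs
  refine (hasDerivAt_integral_of_norm_le (U := disc) (F := fun s x => (quadForm z (v 0) x : ℂ) ^ (-s))
    (g := fun _ => ((min ρ 1) / 4) ^ (-2 : ℝ)) Metric.isOpen_ball ?_ ?_ ?_ ?_
      hs).2.differentiableAt.differentiableWithinAt
  · simp
  · exact fun s _ => (continuous_quadForm_cpow z hm s).aestronglyMeasurable
  · refine .of_forall fun x => Differentiable.differentiableOn ?_
    have := Complex.ofReal_ne_zero.mpr (quadForm_pos (z := z) hm x).ne'
    intro s
    exact differentiableAt_id.neg.const_cpow (Or.inl this)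
  · refine (ae_restrict_iff' measurableSet_Ioc).mpr (.of_forall fun x hx s hs => ?_)
    have hq := quadForm_pos (z := z) hm x
    rw [Complex.norm_cpow_eq_rpow_re_of_pos hq, Complex.neg_re]
    have hN := one_le_norm_of_ne hv
    have hge := quadForm_ge h' hv (Set.Ioc_subset_Icc_self hx)
    have h4 : 0 < min ρ 1 / 4 := by have := h'.1; positivity
    have hge' : min ρ 1 / 4 ≤ quadForm z (v 0) x := by
      exact (le_mul_of_one_le_right h4.le (one_le_pow₀ hN)).trans hge
    obtain ⟨hs1, hs2⟩ := re_of_mem_disc hs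
    refine (Real.rpow_le_rpow_of_nonpos h4 hge' (by linarith)).trans ?_
    exact Real.rpow_le_rpow_of_exponent_ge h4 (by linarith [min_le_right ρ 1]) (by linarith)

lemma differentiableOn_remTerm (z : ℍ) (v : Fin 2 → ℤ) :
    DifferentiableOn ℂ (fun s => remTerm z s v) disc := by
  unfold remTerm
  split_ifs with hv
  · exact differentiableOn_const 0
  refine DifferentiableOn.sub (Differentiable.differentiableOn ?_) (differentiableOn_intTerm z v)
  have hm : (v 0 : ℝ) ≠ 0 := by exact_mod_cast hv
  intro s
  exact differentiableAt_id.neg.const_cpow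
    (Or.inl (Complex.ofReal_ne_zero.mpr (quadForm_pos (z := z) hm (v 1)).ne'))

/-- The sum of the differences between lattice terms and integrals. -/
def remainder (z : ℍ) (s : ℂ) : ℂ := ∑' v, remTerm z s v

lemma differentiableOn_remainder (z : ℍ) : DifferentiableOn ℂ (remainder z) disc := by
  obtain ⟨ρ, h⟩ := exists_isLowerBound z
  have h' : IsLowerBound z (min ρ 1) := h.mono (lt_min h.1 one_pos) (min_le_left _ _)
  exact Complex.differentiableOn_tsum_of_summable_norm (summable_bound _) (differentiableOn_remTerm z)
    Metric.isOpen_ball (fun v s hs => norm_remTerm_le h' (min_le_right _ _) hs v)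

/-- On `𝒟` the lower bound `1 / 2` holds for every `z`, so the remainder stays bounded up to the
cusp. -/
lemma exists_norm_remainder_le :
    ∃ C : ℝ, ∀ z ∈ 𝒟, ∀ s ∈ disc, ‖remainder z s‖ ≤ C :=
  ⟨_, fun _ hz _ hs => tsum_of_norm_bounded (summable_bound (1 / 2)).hasSum
    (norm_remTerm_le (isLowerBound_half_of_mem_fd hz) (by norm_num) hs)⟩

lemma continuous_quadForm_cpow_uncurry {m : ℝ} (hm : m ≠ 0) (s : ℂ) :
    Continuous (Function.uncurry fun (z : ℍ) (x : ℝ) => (quadForm z m x : ℂ) ^ (-s)) := by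
  have h : Continuous fun p : ℍ × ℝ => quadForm p.1 m p.2 := by
    unfold quadForm; fun_prop
  refine continuous_iff_continuousAt.mpr fun p => ?_
  refine ContinuousAt.cpow (Complex.continuous_ofReal.comp h).continuousAt continuousAt_const ?_
  exact Complex.ofReal_mem_slitPlane.mpr (quadForm_pos hm _)

lemma continuous_remTerm (s : ℂ) (v : Fin 2 → ℤ) : Continuous fun z => remTerm z s v := by
  unfold remTerm intTerm latTerm
  split_ifs with hv
  · exact continuous_const
  have hm : (v 0 : ℝ) ≠ 0 := by exact_mod_cast hv
  have hc := continuous_quadForm_cpow_uncurry hm s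
  refine Continuous.sub ?_ ?_
  · exact hc.comp (continuous_id.prodMk continuous_const)
  · exact intervalIntegral.continuous_parametric_intervalIntegral_of_continuous' hc _ _

lemma continuousOn_remainder {s : ℂ} (hs : s ∈ disc) :
    ContinuousOn (fun z => remainder z s) 𝒟 :=
  continuousOn_tsum (fun v => (continuous_remTerm s v).continuousOn) (summable_bound (1 / 2))
    (fun v _ hz => norm_remTerm_le (isLowerBound_half_of_mem_fd hz) (by norm_num) hs v)

/-! ### The integral over a line -/

/-- The integral of `(1 + x²)^(-s)` over the real line. -/
def lineIntegral (s : ℂ) : ℂ := ∫ x : ℝ, ((1 + x ^ 2 : ℝ) : ℂ) ^ (-s)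

lemma continuous_one_add_sq_cpow (s : ℂ) :
    Continuous fun x : ℝ => ((1 + x ^ 2 : ℝ) : ℂ) ^ (-s) := by
  refine continuous_iff_continuousAt.mpr fun x => ?_
  refine ContinuousAt.cpow (Complex.continuous_ofReal.comp (by fun_prop)).continuousAt
    continuousAt_const ?_
  exact Complex.ofReal_mem_slitPlane.mpr (by positivity)

lemma norm_one_add_sq_cpow_le {s : ℂ} (hs : 3 / 4 < s.re) (x : ℝ) :
    ‖((1 + x ^ 2 : ℝ) : ℂ) ^ (-s)‖ ≤ (1 + x ^ 2) ^ (-(3 / 4) : ℝ) := by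
  rw [Complex.norm_cpow_eq_rpow_re_of_pos (by positivity)]
  exact Real.rpow_le_rpow_of_exponent_le (by nlinarith [sq_nonneg x]) (by simp; linarith)

lemma integrable_one_add_sq_rpow :
    Integrable fun x : ℝ => (1 + x ^ 2) ^ (-(3 / 4) : ℝ) := by
  have := integrable_rpow_neg_one_add_norm_sq (E := ℝ) (μ := volume) (r := 3 / 2) (by simp; norm_num)
  refine this.congr (.of_forall fun x => ?_)
  simp only [Real.norm_eq_abs, sq_abs]
  norm_num

lemma differentiableOn_lineIntegral : DifferentiableOn ℂ lineIntegral disc := by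
  intro s hs
  refine (hasDerivAt_integral_of_norm_le (U := disc)
    (F := fun s x => ((1 + x ^ 2 : ℝ) : ℂ) ^ (-s)) Metric.isOpen_ball
    integrable_one_add_sq_rpow ?_ ?_ ?_ hs).2.differentiableAt.differentiableWithinAt
  · exact fun s _ => (continuous_one_add_sq_cpow s).aestronglyMeasurable
  · refine .of_forall fun x => Differentiable.differentiableOn fun s => ?_
    exact differentiableAt_id.neg.const_cpow
      (Or.inl (Complex.ofReal_ne_zero.mpr (by positivity)))
  · exact .of_forall fun x s hs => norm_one_add_sq_cpow_le (re_of_mem_disc hs).1 x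

lemma lineIntegral_one : lineIntegral 1 = π := by
  have : ∀ x : ℝ, ((1 + x ^ 2 : ℝ) : ℂ) ^ (-1 : ℂ) = (((1 + x ^ 2)⁻¹ : ℝ) : ℂ) := fun x => by
    rw [Complex.cpow_neg_one, Complex.ofReal_inv]
  simp_rw [lineIntegral, this]
  rw [integral_complex_ofReal, integral_univ_inv_one_add_sq]

/-- Completing the square: this substitution turns the form into `(|m| y)² (1 + x²)`, so every row
integral is a multiple of `lineIntegral`. -/
lemma quadForm_cpow_eq (z : ℍ) {m : ℝ} (hm : m ≠ 0) (s : ℂ) (x : ℝ) :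
    (quadForm z m (|m| * z.im * x - m * z.re) : ℂ) ^ (-s) =
      ((|m| * z.im : ℝ) : ℂ) ^ (-(2 * s)) * ((1 + x ^ 2 : ℝ) : ℂ) ^ (-s) := by
  have ha : 0 < |m| * z.im := mul_pos (abs_pos.mpr hm) z.im_pos
  have h : quadForm z m (|m| * z.im * x - m * z.re) = (|m| * z.im) ^ 2 * (1 + x ^ 2) := by
    simp only [quadForm, mul_pow, add_sub_cancel, sq_abs]; ring
  rw [h, Complex.ofReal_mul, Complex.mul_cpow_ofReal_nonneg (by positivity) (by positivity)]
  congr 1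
  have h2 : -(2 * s) = ((2 : ℕ) : ℂ) * (-s) := by push_cast; ring
  rw [h2, Complex.cpow_nat_mul' (by rw [Complex.arg_ofReal_of_nonneg ha.le]; simp [Real.pi_pos])
    (by rw [Complex.arg_ofReal_of_nonneg ha.le]; simp [Real.pi_pos.le])]
  simp

lemma integrable_quadForm_cpow (z : ℍ) {m : ℝ} (hm : m ≠ 0) {s : ℂ} (hs : 3 / 4 < s.re) :
    Integrable fun x : ℝ => (quadForm z m x : ℂ) ^ (-s) := by
  have ha : 0 < |m| * z.im := mul_pos (abs_pos.mpr hm) z.im_pos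
  have h1 : Integrable fun x : ℝ => ((1 + x ^ 2 : ℝ) : ℂ) ^ (-s) :=
    integrable_one_add_sq_rpow.mono' (continuous_one_add_sq_cpow s).aestronglyMeasurable
      (.of_forall (norm_one_add_sq_cpow_le hs))
  have h2 := h1.const_mul (((|m| * z.im : ℝ) : ℂ) ^ (-(2 * s)))
  simp_rw [← quadForm_cpow_eq z hm] at h2
  have h3 := (integrable_comp_mul_left_iff
    (fun x : ℝ => (quadForm z m (x - m * z.re) : ℂ) ^ (-s)) ha.ne').mp h2
  simpa using h3.comp_add_right (m * z.re)

lemma integral_quadForm_cpow (z : ℍ) {m : ℝ} (hm : m ≠ 0) (s : ℂ) :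
    ∫ x : ℝ, (quadForm z m x : ℂ) ^ (-s) =
      ((|m| : ℝ) : ℂ) ^ (-(2 * s - 1)) * (z.im : ℂ) ^ (1 - 2 * s) * lineIntegral s := by
  have ha : 0 < |m| * z.im := mul_pos (abs_pos.mpr hm) z.im_pos
  have h1 := Measure.integral_comp_mul_left
    (fun x : ℝ => (quadForm z m (x - m * z.re) : ℂ) ^ (-s)) (|m| * z.im)
  simp_rw [quadForm_cpow_eq z hm, integral_const_mul] at h1
  rw [integral_sub_right_eq_self (fun x : ℝ => (quadForm z m x : ℂ) ^ (-s)),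
    abs_of_pos (inv_pos.mpr ha)] at h1
  have hne : ((|m| * z.im : ℝ) : ℂ) ≠ 0 := Complex.ofReal_ne_zero.mpr ha.ne'
  have e : ((|m| : ℝ) : ℂ) ^ (-(2 * s - 1)) * (z.im : ℂ) ^ (1 - 2 * s) =
      ((|m| * z.im : ℝ) : ℂ) * ((|m| * z.im : ℝ) : ℂ) ^ (-(2 * s)) := by
    rw [show -(2 * s - 1) = 1 - 2 * s by ring, Complex.ofReal_mul,
      ← Complex.mul_cpow_ofReal_nonneg (abs_nonneg m) z.im_pos.le, ← Complex.ofReal_mul,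
      show 1 - 2 * s = 1 + -(2 * s) by ring, Complex.cpow_add _ _ hne, Complex.cpow_one]
  rw [e, lineIntegral, mul_assoc, h1, Complex.real_smul, ← mul_assoc, ← Complex.ofReal_mul,
    mul_inv_cancel₀ ha.ne', Complex.ofReal_one, one_mul]

end

section

/-! ### The continuation of the Eisenstein series -/

lemma tsum_fin_two {f : (Fin 2 → ℤ) → ℂ} (hf : Summable f) :
    ∑' v, f v = ∑' m : ℤ, ∑' n : ℤ, f ![m, n] := by
  rw [← (finTwoArrowEquiv ℤ).symm.tsum_eq, Summable.tsum_prod]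
  · rfl
  · exact (finTwoArrowEquiv ℤ).symm.summable_iff.mpr hf

/-- The contribution of `m = 0` to the lattice sum. -/
lemma tsum_latTerm_zero_row (z : ℍ) {s : ℂ} (hs : 1 < s.re) :
    ∑' v : Fin 2 → ℤ, (if v 0 = 0 then latTerm z s v else 0) = 2 * riemannZeta (2 * s) := by
  have hsum : Summable fun v : Fin 2 → ℤ => (if v 0 = 0 then latTerm z s v else 0) := by
    refine Summable.of_norm_bounded (summable_norm_latTerm z hs) fun v => ?_
    split_ifs <;> simp
  rw [tsum_fin_two hsum, tsum_eq_single 0]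
  · have hs2 : 1 < (2 * s).re := by simp; linarith
    rw [← tsum_int_abs_cpow hs2]
    refine tsum_congr fun n => ?_
    have h : quadForm z 0 (n : ℝ) = |(n : ℝ)| ^ 2 := by simp [quadForm]
    simp only [Matrix.cons_val_zero, ↓reduceIte, latTerm, Matrix.cons_val_one, Int.cast_zero, h]
    have h2 : -(2 * s) = ((2 : ℕ) : ℂ) * (-s) := by push_cast; ring
    rw [h2, Complex.cpow_nat_mul', Complex.ofReal_pow]
    · rw [Complex.arg_ofReal_of_nonneg (abs_nonneg _)]; simp [Real.pi_pos]
    · rw [Complex.arg_ofReal_of_nonneg (abs_nonneg _)]; simp [Real.pi_pos.le]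
  · intro m hm
    simp [hm]

lemma summable_intTerm (z : ℍ) {s : ℂ} (hs : s ∈ disc) (hs1 : 1 < s.re) :
    Summable (intTerm z s) := by
  have h1 : Summable fun v : Fin 2 → ℤ => (if v 0 = 0 then 0 else latTerm z s v) := by
    refine Summable.of_norm_bounded (summable_norm_latTerm z hs1) fun v => ?_
    split_ifs <;> simp
  refine (h1.sub (summable_remTerm z hs)).congr fun v => ?_
  by_cases h : v 0 = 0 <;> simp [remTerm, intTerm, h]

/-- The unit intervals of row `m` tile the line, and the full integral scales as `|m|^(1 - 2s)`. The
resulting `ζ(2s - 1)` carries the pole of the Eisenstein series. -/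
lemma tsum_intTerm (z : ℍ) {s : ℂ} (hs : s ∈ disc) (hs1 : 1 < s.re) :
    ∑' v, intTerm z s v =
      2 * riemannZeta (2 * s - 1) * (z.im : ℂ) ^ (1 - 2 * s) * lineIntegral s := by
  have hs2 : 1 < (2 * s - 1).re := by simp; linarith
  rw [tsum_fin_two (summable_intTerm z hs hs1), ← tsum_int_abs_cpow hs2, mul_assoc, ← tsum_mul_right]
  refine tsum_congr fun m => ?_
  rcases eq_or_ne m 0 with rfl | hm
  -- For `m = 0`, `intTerm` is `0` by definition and the power of `|0|` is `0` as well.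
  · have h0 : -(2 * s - 1) ≠ 0 := neg_ne_zero.mpr (Complex.ne_zero_of_one_lt_re hs2)
    have h1 : ((|((0 : ℤ) : ℝ)| : ℝ) : ℂ) ^ (-(2 * s - 1)) = 0 := by
      rw [Int.cast_zero, abs_zero, Complex.ofReal_zero, Complex.zero_cpow h0]
    rw [h1, zero_mul]
    simp [intTerm]
  · have hm' : (m : ℝ) ≠ 0 := by exact_mod_cast hm
    rw [← mul_assoc, ← integral_quadForm_cpow z hm' s]
    have := (integrable_quadForm_cpow z hm' (s := s) (by linarith)).hasSum_intervalIntegral 0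
    rw [← this.tsum_eq]
    refine tsum_congr fun n => ?_
    simp [intTerm, hm]

lemma tsum_latTerm_eq (z : ℍ) {s : ℂ} (hs : s ∈ disc) (hs1 : 1 < s.re) :
    ∑' v, latTerm z s v = 2 * riemannZeta (2 * s) + remainder z s +
      2 * riemannZeta (2 * s - 1) * (z.im : ℂ) ^ (1 - 2 * s) * lineIntegral s := by
  have hsum : Summable fun v : Fin 2 → ℤ => (if v 0 = 0 then latTerm z s v else 0) := by
    refine Summable.of_norm_bounded (summable_norm_latTerm z hs1) fun v => ?_
    split_ifs <;> simp
  rw [← tsum_intTerm z hs hs1, ← tsum_latTerm_zero_row z hs1, remainder,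
    ← hsum.tsum_add (summable_remTerm z hs),
    ← (hsum.add (summable_remTerm z hs)).tsum_add (summable_intTerm z hs hs1)]
  refine tsum_congr fun v => ?_
  by_cases h : v 0 = 0 <;> simp [remTerm, intTerm, h]

/-- The function `(s - 1) E(z, s)`, continued to a neighbourhood of `s = 1`. -/
def eisReg (z : ℍ) (s : ℂ) : ℂ :=
  (s - 1) * (z.im : ℂ) ^ s +
    (z.im : ℂ) ^ (1 - s) * (zetaReg (2 * s - 1) / 2 * lineIntegral s / riemannZeta (2 * s)) +
    (s - 1) * (z.im : ℂ) ^ s * (remainder z s / (2 * riemannZeta (2 * s)))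

lemma zeta_two_mul_ne_zero {s : ℂ} (hs : s ∈ disc) : riemannZeta (2 * s) ≠ 0 :=
  riemannZeta_ne_zero_of_one_le_re (by have := (re_of_mem_disc hs).1; simp; linarith)

lemma two_mul_ne_one {s : ℂ} (hs : s ∈ disc) : 2 * s ≠ 1 := by
  intro h
  have h1 := congr_arg Complex.re h
  have := (re_of_mem_disc hs).1
  simp at h1
  linarith

/-- The division by `2` in the middle term of `eisReg` reflects `zetaReg (2s - 1) = 2 (s - 1) ζ(2s -
1)`. -/
lemma eisReg_eq (z : ℍ) {s : ℂ} (hs : s ∈ disc) (hs1 : 1 < s.re) :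
    eisReg z s = (s - 1) * eisenstein z s := by
  have hz := zeta_two_mul_ne_zero hs
  have hE : eisenstein z s =
      (z.im : ℂ) ^ s * (∑' v, latTerm z s v) / (2 * riemannZeta (2 * s)) := by
    rw [← two_mul_zeta_mul_eisenstein z hs1]; field_simp
  have hy : (z.im : ℂ) ≠ 0 := Complex.ofReal_ne_zero.mpr z.im_pos.ne'
  have hne : 2 * s - 1 ≠ 1 := by
    intro h
    have : s = 1 := by linear_combination h / 2
    simp [this] at hs1
  have hpow : (z.im : ℂ) ^ (1 - s) = (z.im : ℂ) ^ s * (z.im : ℂ) ^ (1 - 2 * s) := by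
    rw [← Complex.cpow_add _ _ hy]; congr 1; ring
  rw [hE, tsum_latTerm_eq z hs hs1, eisReg, zetaReg_of_ne hne, hpow]
  generalize riemannZeta (2 * s) = ζ₂ at hz ⊢
  field_simp
  ring

lemma one_mem_disc : (1 : ℂ) ∈ disc := Metric.mem_ball_self (by norm_num)

/-- The residue of the Eisenstein series at `s = 1`. -/
lemma eisReg_one (z : ℍ) : eisReg z 1 = 3 / π := by
  have hpi : (π : ℂ) ≠ 0 := Complex.ofReal_ne_zero.mpr Real.pi_pos.ne'
  have h1 : (2 : ℂ) * 1 - 1 = 1 := by norm_num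
  -- Only the middle term survives, and it equals `(1/2) π / (π²/6)`, independently of `z`.
  rw [eisReg, h1, zetaReg_one, lineIntegral_one, mul_one (2 : ℂ), riemannZeta_two]
  simp
  field_simp
  norm_num

lemma differentiableOn_zeta_two_mul : DifferentiableOn ℂ (fun s => riemannZeta (2 * s)) disc :=
  fun s hs => ((differentiableAt_riemannZeta (two_mul_ne_one hs)).comp s
    (differentiableAt_id.const_mul 2)).differentiableWithinAt

/-- The coefficient of `y^(1 - s)` in `eisReg`. -/
lemma differentiableOn_scattering :
    DifferentiableOn ℂ (fun s => zetaReg (2 * s - 1) / 2 * lineIntegral s / riemannZeta (2 * s))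
      disc := by
  refine DifferentiableOn.div (DifferentiableOn.mul (Differentiable.differentiableOn ?_)
    differentiableOn_lineIntegral) differentiableOn_zeta_two_mul fun s hs => zeta_two_mul_ne_zero hs
  exact (differentiable_zetaReg.comp ((differentiable_id.const_mul 2).sub_const 1)).div_const 2

lemma differentiableOn_eisReg (z : ℍ) : DifferentiableOn ℂ (eisReg z) disc := by
  have hy : (z.im : ℂ) ≠ 0 := Complex.ofReal_ne_zero.mpr z.im_pos.ne'
  have h1 : Differentiable ℂ fun s : ℂ => (z.im : ℂ) ^ s :=
    fun s => differentiableAt_id.const_cpow (Or.inl hy)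
  have h2 : Differentiable ℂ fun s : ℂ => (z.im : ℂ) ^ (1 - s) :=
    fun s => (differentiableAt_id.const_sub 1).const_cpow (Or.inl hy)
  have h3 : Differentiable ℂ fun s : ℂ => (s - 1) * (z.im : ℂ) ^ s :=
    (differentiable_id.sub_const 1).mul h1
  refine (h3.differentiableOn.add (h2.differentiableOn.mul differentiableOn_scattering)).add
    (h3.differentiableOn.mul ?_)
  exact (differentiableOn_remainder z).div (differentiableOn_zeta_two_mul.const_mul 2)
    fun s hs => mul_ne_zero two_ne_zero (zeta_two_mul_ne_zero hs)

lemma continuousOn_eisReg {s : ℂ} (hs : s ∈ disc) : ContinuousOn (fun z => eisReg z s) 𝒟 := by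
  have h (w : ℂ) : Continuous fun z : ℍ => (z.im : ℂ) ^ w := by
    refine continuous_iff_continuousAt.mpr fun z => ?_
    refine ContinuousAt.cpow (Complex.continuous_ofReal.comp continuous_im).continuousAt
      continuousAt_const (Complex.ofReal_mem_slitPlane.mpr z.im_pos)
  have h3 : Continuous fun z : ℍ => (s - 1) * (z.im : ℂ) ^ s := continuous_const.mul (h s)
  exact (h3.add ((h (1 - s)).mul continuous_const)).continuousOn.add
    (h3.continuousOn.mul ((continuousOn_remainder hs).div_const _))

/-- A smaller disc, with compact closure in `disc`. -/
abbrev smallDisc : Set ℂ := Metric.ball 1 (1 / 8)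

lemma smallDisc_subset : smallDisc ⊆ disc := Metric.ball_subset_ball (by norm_num)

lemma closedBall_subset_disc : Metric.closedBall (1 : ℂ) (1 / 8) ⊆ disc :=
  Metric.closedBall_subset_ball (by norm_num)

lemma half_le_im_of_mem_fd {z : ℍ} (hz : z ∈ 𝒟) : 1 / 2 ≤ z.im := by
  have := ModularGroup.three_le_four_mul_im_sq_of_mem_fd hz
  nlinarith [z.im_pos]

/-- The continued Eisenstein series has polynomial growth on the fundamental domain. -/
lemma exists_norm_eisReg_le :
    ∃ C : ℝ, ∀ z ∈ 𝒟, ∀ s ∈ smallDisc, ‖eisReg z s‖ ≤ C * (1 + z.im) ^ 2 := by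
  obtain ⟨C₁, h₁⟩ := exists_norm_remainder_le
  obtain ⟨C₂, h₂⟩ := (isCompact_closedBall (1 : ℂ) (1 / 8)).exists_bound_of_continuousOn
    (differentiableOn_scattering.continuousOn.mono closedBall_subset_disc)
  obtain ⟨C₃, h₃⟩ := (isCompact_closedBall (1 : ℂ) (1 / 8)).exists_bound_of_continuousOn
    (((differentiableOn_zeta_two_mul.const_mul 2).inv fun s hs =>
      mul_ne_zero two_ne_zero (zeta_two_mul_ne_zero hs)).continuousOn.mono closedBall_subset_disc)
  refine ⟨1 + 2 * C₂ + C₁ * C₃, fun z hz s hs => ?_⟩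
  have hs' := smallDisc_subset hs
  have hsc := Metric.ball_subset_closedBall hs
  obtain ⟨hr1, hr2⟩ := re_of_mem_disc hs'
  have hy := half_le_im_of_mem_fd hz
  have hs1 : ‖s - 1‖ ≤ 1 := (mem_ball_iff_norm.mp hs).le.trans (by norm_num)
  have hy1 : ‖(z.im : ℂ) ^ s‖ ≤ (1 + z.im) ^ 2 := by
    rw [Complex.norm_cpow_eq_rpow_re_of_pos z.im_pos]
    calc z.im ^ s.re ≤ (1 + z.im) ^ s.re :=
          Real.rpow_le_rpow z.im_pos.le (by linarith) (by linarith)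
      _ ≤ (1 + z.im) ^ (2 : ℝ) := Real.rpow_le_rpow_of_exponent_le (by linarith) (by linarith)
      _ = _ := by norm_num
  -- The exponent has either sign; when it is negative, the bound `1 / 2 ≤ Im z` on `𝒟` is used.
  have hy2 : ‖(z.im : ℂ) ^ (1 - s)‖ ≤ 2 * (1 + z.im) ^ 2 := by
    rw [Complex.norm_cpow_eq_rpow_re_of_pos z.im_pos, Complex.sub_re, Complex.one_re]
    rcases le_total s.re 1 with h | h
    · calc z.im ^ (1 - s.re) ≤ (1 + z.im) ^ (1 - s.re) :=
            Real.rpow_le_rpow z.im_pos.le (by linarith) (by linarith)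
        _ ≤ (1 + z.im) ^ (2 : ℝ) := Real.rpow_le_rpow_of_exponent_le (by linarith) (by linarith)
        _ = (1 + z.im) ^ 2 := by norm_num
        _ ≤ _ := by nlinarith [sq_nonneg (1 + z.im)]
    · calc z.im ^ (1 - s.re) ≤ (1 / 2 : ℝ) ^ (1 - s.re) :=
            Real.rpow_le_rpow_of_nonpos (by norm_num) hy (by linarith)
        _ ≤ (1 / 2 : ℝ) ^ (-1 : ℝ) :=
            Real.rpow_le_rpow_of_exponent_ge (by norm_num) (by norm_num) (by linarith)
        _ = 2 := by rw [Real.rpow_neg_one]; norm_num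
        _ ≤ _ := by nlinarith
  have hC₁ : 0 ≤ C₁ := (norm_nonneg _).trans (h₁ z hz s hs')
  have t1 : ‖(s - 1) * (z.im : ℂ) ^ s‖ ≤ (1 + z.im) ^ 2 := by
    rw [norm_mul]; nlinarith [norm_nonneg (s - 1), norm_nonneg ((z.im : ℂ) ^ s)]
  have t2 := h₂ s hsc
  have t3 : ‖remainder z s / (2 * riemannZeta (2 * s))‖ ≤ C₁ * C₃ := by
    rw [div_eq_mul_inv, norm_mul]
    exact mul_le_mul (h₁ z hz s hs') (h₃ s hsc) (norm_nonneg _) hC₁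
  calc ‖eisReg z s‖ ≤ ‖(s - 1) * (z.im : ℂ) ^ s‖ + ‖(z.im : ℂ) ^ (1 - s) *
          (zetaReg (2 * s - 1) / 2 * lineIntegral s / riemannZeta (2 * s))‖ +
        ‖(s - 1) * (z.im : ℂ) ^ s * (remainder z s / (2 * riemannZeta (2 * s)))‖ := norm_add₃_le
    _ ≤ (1 + z.im) ^ 2 + (2 * (1 + z.im) ^ 2) * C₂ + (1 + z.im) ^ 2 * (C₁ * C₃) := by
        rw [norm_mul ((z.im : ℂ) ^ (1 - s)), norm_mul ((s - 1) * (z.im : ℂ) ^ s)]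
        gcongr
    _ = _ := by ring

/-! ### Uniqueness of the continuation -/

open Filter Topology in
/-- A function which is analytic at `1` and agrees with `F` where `Re s > 1` near `1` determines
the continuation of `F`. -/
lemma continuation_spec {F G : ℂ → ℂ} (hG : AnalyticAt ℂ G 1)
    (h : ∀ᶠ s in 𝓝 (1 : ℂ), 1 < s.re → G s = F s) :
    (∃ g, IsContinuation F g) ∧ continuation F =ᶠ[𝓝 1] G := by
  classical
  have hex : ∃ g, IsContinuation F g := by
    -- `IsContinuation` asks for equality on the whole half-plane but for analyticity only at `1`,
    -- so patching `F` and `G` suffices.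
    refine ⟨fun s => if 1 < s.re then F s else G s, ?_, fun s hs => if_pos hs⟩
    refine hG.congr ?_
    filter_upwards [h] with s hs
    by_cases h1 : 1 < s.re
    · simp [h1, hs h1]
    · simp [h1]
  refine ⟨hex, ?_⟩
  have hc : IsContinuation F (continuation F) := by
    rw [continuation, dif_pos hex]; exact hex.choose_spec
  rw [EventuallyEq, ← hc.1.frequently_eq_iff_eventually_eq hG]
  -- By the identity theorem, agreement along one sequence tending to `1` from inside the half-plane
  -- is enough.
  have hu : Tendsto (fun n : ℕ => (1 : ℂ) + ((1 / ((n : ℝ) + 1) : ℝ) : ℂ)) atTop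
      (𝓝[≠] (1 : ℂ)) := by
    refine tendsto_nhdsWithin_iff.mpr ⟨?_, .of_forall fun n => ?_⟩
    · have := (Complex.continuous_ofReal.tendsto _).comp
        (tendsto_one_div_add_atTop_nhds_zero_nat (𝕜 := ℝ))
      simpa using this.const_add (1 : ℂ)
    · have : ((n : ℝ) + 1) ≠ 0 := by positivity
      have h2 : ((1 / ((n : ℝ) + 1) : ℝ) : ℂ) ≠ 0 := Complex.ofReal_ne_zero.mpr (by positivity)
      simpa using h2
  refine hu.frequently (Eventually.frequently ?_)
  filter_upwards [(hu.mono_right nhdsWithin_le_nhds).eventually h] with n hn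
  have hre : 1 < ((1 : ℂ) + ((1 / ((n : ℝ) + 1) : ℝ) : ℂ)).re := by
    rw [Complex.add_re, Complex.ofReal_re, Complex.one_re]
    have : 0 < 1 / ((n : ℝ) + 1) := by positivity
    linarith
  rw [hn hre, hc.2 _ hre]

end

section

/-! ### The invariant measure in coordinates -/

open scoped ENNReal

/-- The point `x + i y`, for `y > 0`. -/
abbrev pt (x y : ℝ) : ℍ := ofComplex ⟨x, y⟩

lemma coe_pt (x : ℝ) {y : ℝ} (hy : 0 < y) : ((pt x y : ℍ) : ℂ) = ⟨x, y⟩ := by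
  rw [pt, ofComplex_apply_of_im_pos (z := ⟨x, y⟩) hy]

lemma re_pt (x : ℝ) {y : ℝ} (hy : 0 < y) : (pt x y).re = x := by
  rw [← coe_re, coe_pt x hy]

lemma im_pt (x : ℝ) {y : ℝ} (hy : 0 < y) : (pt x y).im = y := by
  rw [← coe_im, coe_pt x hy]

lemma measurable_ofComplex : Measurable (ofComplex : ℂ → ℍ) := by
  have h : (ofComplex : ℂ → ℍ) = fun w => if hw : 0 < w.im then (⟨w, hw⟩ : ℍ) else
      Classical.choice inferInstance := funext ofComplex_apply_eq_ite
  rw [h]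
  exact Measurable.dite (s := {w : ℂ | 0 < w.im}) (f := fun x => (⟨x.1, x.2⟩ : ℍ))
    (g := fun _ => Classical.choice inferInstance)
    (measurable_comap_iff.mpr measurable_subtype_coe) measurable_const
    (measurableSet_lt measurable_const Complex.measurable_im)

/-- The measure on `ℍ` is Lebesgue measure pulled back from `ℂ` with density `1 / y²`. The indicator
of `y > 0` makes the junk values of `ofComplex` harmless. -/
lemma lintegral_eq_prod {u : ℍ → ℝ≥0∞} (hu : Measurable u) :
    ∫⁻ z, u z = ∫⁻ p : ℝ × ℝ, (Set.Ioi 0).indicator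
      (fun y => ENNReal.ofReal (1 / y ^ 2) * u (pt p.1 y)) p.2 := by
  have hd : Measurable fun z : ℍ => ENNReal.ofReal (1 / z.im ^ 2) := by
    refine ENNReal.measurable_ofReal.comp (measurable_const.div (Measurable.pow_const ?_ 2))
    exact continuous_im.measurable
  have hd' : (fun z : ℍ => ((((1 / NNReal.mk z.im z.im_pos.le : NNReal) ^ 2 : NNReal)) : ℝ≥0∞)) =
      fun z : ℍ => ENNReal.ofReal (1 / z.im ^ 2) := by
    funext z
    rw [ENNReal.ofReal, ENNReal.coe_inj]
    ext
    rw [Real.coe_toNNReal _ (by positivity)]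
    simp
  set h : ℂ → ℝ≥0∞ := fun w => ENNReal.ofReal (1 / w.im ^ 2) * u (ofComplex w) with hh
  have hm : Measurable h := by
    refine Measurable.mul (ENNReal.measurable_ofReal.comp (measurable_const.div
      (Complex.measurable_im.pow_const 2))) (hu.comp measurable_ofComplex)
  have hr : Set.range UpperHalfPlane.coe = {w : ℂ | 0 < w.im} := by
    ext w; constructor
    · rintro ⟨z, rfl⟩; exact z.im_pos
    · intro hw; exact ⟨⟨w, hw⟩, rfl⟩
  rw [volume_def, hd', lintegral_withDensity_eq_lintegral_mul _ hd hu]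
  have e1 : ∀ z : ℍ, ((fun z : ℍ => ENNReal.ofReal (1 / z.im ^ 2)) * u) z = h z := by
    intro z; simp [hh]
  simp_rw [e1]
  rw [← measurableEmbedding_coe.lintegral_map (f := h), measurableEmbedding_coe.map_comap, hr,
    ← lintegral_indicator (measurableSet_lt measurable_const Complex.measurable_im),
    ← (Complex.volume_preserving_equiv_real_prod.symm).lintegral_comp
      (hm.indicator (measurableSet_lt measurable_const Complex.measurable_im))]
  refine lintegral_congr fun p => ?_
  simp only [Set.indicator, Complex.measurableEquivRealProd_symm_apply, hh]
  rfl

lemma measurable_prod_integrand {u : ℍ → ℝ≥0∞} (hu : Measurable u) :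
    Measurable fun p : ℝ × ℝ => (Set.Ioi (0 : ℝ)).indicator
      (fun y => ENNReal.ofReal (1 / y ^ 2) * u (pt p.1 y)) p.2 := by
  have h : Measurable fun p : ℝ × ℝ => ENNReal.ofReal (1 / p.2 ^ 2) * u (pt p.1 p.2) := by
    refine Measurable.mul (ENNReal.measurable_ofReal.comp (measurable_const.div
      (measurable_snd.pow_const 2))) (hu.comp (measurable_ofComplex.comp ?_))
    exact Complex.measurableEquivRealProd.symm.measurable
  exact h.indicator (measurableSet_lt measurable_const measurable_snd)

/-- Integration over the upper half-plane: inner integral over `y`. -/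
lemma lintegral_eq_xy {u : ℍ → ℝ≥0∞} (hu : Measurable u) :
    ∫⁻ z, u z = ∫⁻ x, ∫⁻ y in Set.Ioi 0, ENNReal.ofReal (1 / y ^ 2) * u (pt x y) := by
  rw [lintegral_eq_prod hu, Measure.volume_eq_prod,
    lintegral_prod _ (measurable_prod_integrand hu).aemeasurable]
  exact lintegral_congr fun x => lintegral_indicator measurableSet_Ioi _

/-- Integration over the upper half-plane: inner integral over `x`. -/
lemma lintegral_eq_yx {u : ℍ → ℝ≥0∞} (hu : Measurable u) :
    ∫⁻ z, u z = ∫⁻ y in Set.Ioi 0, ENNReal.ofReal (1 / y ^ 2) * ∫⁻ x, u (pt x y) := by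
  have hm := measurable_prod_integrand hu
  rw [lintegral_eq_prod hu, Measure.volume_eq_prod, lintegral_prod_symm _ hm.aemeasurable,
    ← lintegral_indicator measurableSet_Ioi]
  refine lintegral_congr fun y => ?_
  by_cases hy : y ∈ Set.Ioi (0 : ℝ)
  · simp only [hy, Set.indicator_of_mem]
    exact lintegral_const_mul' _ _ ENNReal.ofReal_ne_top
  · simp [hy]

/-! ### The area of the fundamental domain -/

lemma lintegral_Ioi_inv_sq {a : ℝ} (ha : 0 < a) :
    ∫⁻ y in Set.Ioi a, ENNReal.ofReal (1 / y ^ 2) = ENNReal.ofReal (1 / a) := by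
  have e : ∀ y ∈ Set.Ioi a, 1 / y ^ 2 = y ^ (-2 : ℝ) := fun y hy => by
    rw [Real.rpow_neg (ha.trans hy).le]; norm_num
  have hi : IntegrableOn (fun y : ℝ => y ^ (-2 : ℝ)) (Set.Ioi a) :=
    integrableOn_Ioi_rpow_of_lt (by norm_num) ha
  rw [setLIntegral_congr_fun (g := fun y => ENNReal.ofReal (y ^ (-2 : ℝ))) measurableSet_Ioi
    (fun y hy => by simp only [e y hy]), ← ofReal_integral_eq_lintegral_ofReal hi
    ((ae_restrict_iff' measurableSet_Ioi).mpr (.of_forall fun y hy =>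
      Real.rpow_nonneg (ha.trans hy).le _)), integral_Ioi_rpow_of_lt (by norm_num) ha]
  congr 1
  norm_num
  rw [Real.rpow_neg_one]

lemma pt_mem_fd_iff (x : ℝ) {y : ℝ} (hy : 0 < y) :
    pt x y ∈ 𝒟 ↔ |x| ≤ 1 / 2 ∧ 1 ≤ x ^ 2 + y ^ 2 := by
  change 1 ≤ Complex.normSq (pt x y : ℂ) ∧ |(pt x y).re| ≤ 1 / 2 ↔ _
  rw [re_pt x hy, coe_pt x hy, Complex.normSq_mk, and_comm, sq, sq]

lemma measurableSet_fd : MeasurableSet 𝒟 := ModularGroup.isClosed_fd.measurableSet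

lemma measurableSet_fdo : MeasurableSet 𝒟ᵒ := ModularGroup.isOpen_fdo.measurableSet

lemma integral_inv_sqrt_one_sub_sq :
    ∫ x in (-(1 / 2) : ℝ)..(1 / 2), 1 / √(1 - x ^ 2) = π / 3 := by
  have hx1 : ∀ x ∈ Set.uIcc (-(1 / 2) : ℝ) (1 / 2), 0 < 1 - x ^ 2 := by
    intro x hx
    rw [Set.uIcc_of_le (by norm_num)] at hx
    nlinarith [hx.1, hx.2]
  rw [intervalIntegral.integral_eq_sub_of_hasDerivAt (f := Real.arcsin)]
  · have h : Real.arcsin (1 / 2) = π / 6 := by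
      rw [← Real.sin_pi_div_six, Real.arcsin_sin] <;> linarith [Real.pi_pos]
    rw [Real.arcsin_neg, h]; ring
  · intro x hx
    rw [Set.uIcc_of_le (by norm_num)] at hx
    exact Real.hasDerivAt_arcsin (by linarith [hx.1]) (by linarith [hx.2])
  · refine ContinuousOn.intervalIntegrable ?_
    refine continuousOn_const.div (Continuous.continuousOn (by fun_prop)) fun x hx => ?_
    exact (Real.sqrt_pos.mpr (hx1 x hx)).ne'

/-- Above `x`, the domain is `y ≥ √(1 - x²)`; integrating `1 / y²` leaves `1 / √(1 - x²)`, the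
derivative of `arcsin`. -/
lemma volume_fd : (volume : Measure ℍ) 𝒟 = ENNReal.ofReal (π / 3) := by
  rw [← lintegral_indicator_one measurableSet_fd,
    lintegral_eq_xy (measurable_one.indicator measurableSet_fd)]
  have key : ∀ x : ℝ, ∫⁻ y in Set.Ioi 0,
      ENNReal.ofReal (1 / y ^ 2) * (𝒟 : Set ℍ).indicator 1 (pt x y) =
      (Set.Icc (-(1 / 2)) (1 / 2)).indicator (fun x => ENNReal.ofReal (1 / √(1 - x ^ 2))) x := by
    intro x
    by_cases hx : x ∈ Set.Icc (-(1 / 2) : ℝ) (1 / 2)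
    · have hx2 : 0 < 1 - x ^ 2 := by nlinarith [hx.1, hx.2]
      have hs := Real.sqrt_pos.mpr hx2
      rw [Set.indicator_of_mem hx, ← lintegral_Ioi_inv_sq hs, setLIntegral_congr (Ioi_ae_eq_Ici (a := √(1 - x ^ 2))),
        ← lintegral_indicator measurableSet_Ici, ← lintegral_indicator measurableSet_Ioi]
      refine lintegral_congr fun y => ?_
      by_cases hy : 0 < y
      · rw [Set.indicator_of_mem (show y ∈ Set.Ioi 0 from hy)]
        have : pt x y ∈ 𝒟 ↔ y ∈ Set.Ici √(1 - x ^ 2) := by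
          rw [pt_mem_fd_iff x hy, Set.mem_Ici, Real.sqrt_le_left hy.le, abs_le]
          constructor
          · rintro ⟨-, h⟩; linarith
          · intro h; exact ⟨hx, by linarith⟩
        by_cases hm : pt x y ∈ 𝒟
        · rw [Set.indicator_of_mem hm, Set.indicator_of_mem (this.mp hm)]; simp
        · rw [Set.indicator_of_notMem hm, Set.indicator_of_notMem (mt this.mpr hm)]; simp
      · rw [Set.indicator_of_notMem (by simpa using hy), Set.indicator_of_notMem]
        exact fun h => hy (hs.trans_le h)
    · rw [Set.indicator_of_notMem hx, lintegral_eq_zero_iff' ?_]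
      · refine (ae_restrict_iff' measurableSet_Ioi).mpr (.of_forall fun y hy => ?_)
        have : pt x y ∉ 𝒟 := fun h => hx (abs_le.mp ((pt_mem_fd_iff x hy).mp h).1)
        simp [this]
      · refine Measurable.aemeasurable ?_
        refine Measurable.mul (ENNReal.measurable_ofReal.comp (by fun_prop))
          ((measurable_one.indicator measurableSet_fd).comp (measurable_ofComplex.comp ?_))
        exact Complex.measurableEquivRealProd.symm.measurable.comp
          (measurable_const.prodMk measurable_id)
  simp_rw [key]
  have hpos : ∀ x ∈ Set.Icc (-(1 / 2) : ℝ) (1 / 2), 0 < 1 - x ^ 2 := fun x hx => by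
    nlinarith [hx.1, hx.2]
  have hc : ContinuousOn (fun x : ℝ => 1 / √(1 - x ^ 2)) (Set.Icc (-(1 / 2)) (1 / 2)) :=
    continuousOn_const.div (Continuous.continuousOn (by fun_prop)) fun x hx =>
      (Real.sqrt_pos.mpr (hpos x hx)).ne'
  rw [lintegral_indicator measurableSet_Icc, ← ofReal_integral_eq_lintegral_ofReal
    hc.integrableOn_Icc (.of_forall fun x => by positivity), integral_Icc_eq_integral_Ioc,
    ← intervalIntegral.integral_of_le (by norm_num), integral_inv_sqrt_one_sub_sq]

lemma vol_eq : vol = π / 3 := by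
  rw [vol, Measure.real, volume_fd, ENNReal.toReal_ofReal (by positivity)]

lemma volume_fd_ne_top : (volume : Measure ℍ) 𝒟 ≠ ∞ := by
  rw [volume_fd]; exact ENNReal.ofReal_ne_top

end

section

/-! ### The fundamental domain and unfolding -/

open scoped ENNReal

instance : Countable SL(2, ℤ) :=
  haveI : Countable (Matrix (Fin 2) (Fin 2) ℤ) := inferInstanceAs (Countable (Fin 2 → Fin 2 → ℤ))
  Subtype.countable

instance : Countable Cosets := Quotient.countable

lemma volume_eq_zero_of_coe {S : Set ℍ} (h : volume ((↑) '' S : Set ℂ) = 0) :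
    (volume : Measure ℍ) S = 0 := by
  rw [volume_eq_lintegral, Measure.restrict_eq_zero.mpr h, lintegral_zero_measure]

lemma volume_vertical_line (c : ℝ) : volume {w : ℂ | w.re = c} = 0 := by
  have h : {w : ℂ | w.re = c} = Complex.measurableEquivRealProd ⁻¹' ({c} ×ˢ Set.univ) := by
    ext w; simp [Complex.measurableEquivRealProd]
  rw [h, Complex.volume_preserving_equiv_real_prod.measure_preimage
    ((measurableSet_singleton c).prod MeasurableSet.univ).nullMeasurableSet,
    Measure.volume_eq_prod, Measure.prod_prod]
  simp

/-- The boundary lies in the unit circle and two vertical lines. -/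
lemma volume_fd_diff_fdo : (volume : Measure ℍ) (𝒟 \ 𝒟ᵒ) = 0 := by
  refine volume_eq_zero_of_coe (measure_mono_null (t := Metric.sphere (0 : ℂ) 1 ∪
    ({w : ℂ | w.re = 1 / 2} ∪ {w : ℂ | w.re = -(1 / 2)})) ?_ ?_)
  · rintro _ ⟨z, ⟨⟨h1, h2⟩, h3⟩, rfl⟩
    by_cases hn : 1 < Complex.normSq (z : ℂ)
    · right
      have : ¬ |z.re| < 1 / 2 := fun h => h3 ⟨hn, h⟩
      have h4 : |z.re| = 1 / 2 := le_antisymm h2 (not_lt.mp this)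
      rcases abs_cases z.re with ⟨h5, -⟩ | ⟨h5, -⟩
      · left; change z.re = 1 / 2; linarith
      · right; change z.re = -(1 / 2); linarith
    · left
      have h4 : Complex.normSq (z : ℂ) = 1 := le_antisymm (not_lt.mp hn) h1
      rw [Complex.normSq_eq_norm_sq] at h4
      rw [mem_sphere_zero_iff_norm]
      nlinarith [norm_nonneg (z : ℂ)]
  · refine measure_union_null (Measure.addHaar_sphere _ _ _)
      (measure_union_null (volume_vertical_line _) (volume_vertical_line _))

lemma fdo_ae_eq_fd : (𝒟ᵒ : Set ℍ) =ᵐ[volume] 𝒟 :=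
  ae_eq_set.mpr ⟨by simp [Set.sdiff_eq_empty.mpr ModularGroup.fdo_subset_fd], volume_fd_diff_fdo⟩

lemma measurePreserving_SL (g : SL(2, ℤ)) : MeasurePreserving (fun z : ℍ => g • z) :=
  measurePreserving_smul (g : GL (Fin 2) ℝ) (volume : Measure ℍ)

lemma neg_SL_ne (g : SL(2, ℤ)) : -g ≠ g := by
  intro h
  have h1 : ∀ i j, g i j = 0 := fun i j => by
    have := congr_arg (fun g : SL(2, ℤ) => g i j) h
    simp at this
    lia
  have := Matrix.SpecialLinearGroup.det_coe g
  rw [Matrix.det_fin_two] at this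
  simp [h1] at this

/-- Almost every orbit of `SL₂(ℤ)` meets the open fundamental domain in one point, for two
elements of the group. -/
lemma ae_exists_mem_fdo :
    ∀ᵐ z : ℍ, ∃ g₀ : SL(2, ℤ), ∀ g : SL(2, ℤ), g • z ∈ 𝒟ᵒ ↔ g = g₀ ∨ g = -g₀ := by
  -- The group is countable, so the translates of the boundary together are still null.
  have h : ∀ᵐ z : ℍ, ∀ g : SL(2, ℤ), g • z ∉ 𝒟 \ 𝒟ᵒ := by
    rw [ae_all_iff]
    intro g
    have := (measurePreserving_SL g).quasiMeasurePreserving.preimage_null volume_fd_diff_fdo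
    exact measure_eq_zero_iff_ae_notMem.mp this
  filter_upwards [h] with z hz
  obtain ⟨g₀, h₀⟩ := ModularGroup.exists_smul_mem_fd z
  have h₀' : g₀ • z ∈ 𝒟ᵒ := by_contra fun hn => hz g₀ ⟨h₀, hn⟩
  refine ⟨g₀, fun g => ⟨fun hgz => ?_, ?_⟩⟩
  · have h1 : (g * g₀⁻¹) • (g₀ • z) ∈ 𝒟ᵒ := by rwa [smul_smul, inv_mul_cancel_right]
    rcases ModularGroup.eq_one_or_neg_one_of_mem_fdo_mem_fdo h₀' h1 with h2 | h2
    · exact Or.inl (mul_inv_eq_one.mp h2)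
    · exact Or.inr (by rw [← inv_mul_cancel_right g g₀, h2, neg_mul, one_mul])
  · rintro (rfl | rfl)
    · exact h₀'
    · rwa [ModularGroup.SL_neg_smul]

/-- The value is `2` because `g` and `-g` act alike. The ring is general since both `ℝ≥0∞` and `ℂ`
are needed. -/
lemma ae_tsum_indicator_fdo {R : Type*} [NonAssocSemiring R] [TopologicalSpace R] :
    ∀ᵐ z : ℍ, ∑' g : SL(2, ℤ), (𝒟ᵒ : Set ℍ).indicator (1 : ℍ → R) (g • z) = 2 := by
  filter_upwards [ae_exists_mem_fdo] with z ⟨g₀, hz⟩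
  rw [tsum_eq_sum (s := {g₀, -g₀})]
  · rw [Finset.sum_pair (neg_SL_ne g₀).symm, Set.indicator_of_mem ((hz _).mpr (Or.inl rfl)),
      Set.indicator_of_mem ((hz _).mpr (Or.inr rfl)), Pi.one_apply, Pi.one_apply, one_add_one_eq_two]
  · intro g hg
    exact Set.indicator_of_notMem (fun hgz => hg (by simpa using (hz g).mp hgz)) _

/-- Unfolding the sum over the whole group. -/
lemma setLIntegral_fd_tsum {u : ℍ → ℝ≥0∞} (hu : Measurable u) :
    ∫⁻ z in 𝒟, ∑' g : SL(2, ℤ), u (g • z) = 2 * ∫⁻ z, u z := by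
  have hm (g : SL(2, ℤ)) : Measurable fun z : ℍ => g • z := (measurePreserving_SL g).measurable
  have hi : Measurable ((𝒟ᵒ : Set ℍ).indicator (1 : ℍ → ℝ≥0∞)) :=
    measurable_one.indicator measurableSet_fdo
  have hum (g : SL(2, ℤ)) : Measurable fun z : ℍ => u (g • z) := hu.comp (hm g)
  have him (g : SL(2, ℤ)) :
      Measurable fun z : ℍ => (𝒟ᵒ : Set ℍ).indicator (1 : ℍ → ℝ≥0∞) (g⁻¹ • z) * u z :=
    (hi.comp (hm g⁻¹)).mul hu
  rw [← setLIntegral_congr fdo_ae_eq_fd, lintegral_tsum fun g => (hum g).aemeasurable]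
  -- Invariance of the measure moves `g` from `u` to the indicator of `𝒟ᵒ`; the indicators then sum
  -- to `2`.
  have key : ∀ g : SL(2, ℤ), ∫⁻ z in 𝒟ᵒ, u (g • z) =
      ∫⁻ z, (𝒟ᵒ : Set ℍ).indicator 1 (g⁻¹ • z) * u z := fun g => by
    rw [← (measurePreserving_SL g).lintegral_comp (him g),
      ← lintegral_indicator measurableSet_fdo]
    refine lintegral_congr fun z => ?_
    rw [inv_smul_smul]
    by_cases hz : z ∈ 𝒟ᵒ <;> simp [hz]
  simp_rw [key]
  rw [← lintegral_tsum fun g => (him g).aemeasurable,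
    ← lintegral_const_mul _ hu]
  refine lintegral_congr_ae ?_
  filter_upwards [ae_tsum_indicator_fdo (R := ℝ≥0∞)] with z hz
  rw [ENNReal.tsum_mul_right, ← hz]
  congr 1
  exact (Equiv.inv SL(2, ℤ)).tsum_eq
    (fun g => (𝒟ᵒ : Set ℍ).indicator (1 : ℍ → ℝ≥0∞) (g • z))

/-! ### Decomposition of `SL₂(ℤ)` over `Γ_∞`. -/

open ModularGroup in
lemma eq_T_zpow_or_neg {η : SL(2, ℤ)} (h : η ∈ GammaInf) :
    ∃ n : ℤ, η = T ^ n ∨ η = -T ^ n := by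
  have hc : η 1 0 = 0 := h
  have had := η.det_coe
  replace had : η 0 0 * η 1 1 = 1 := by rw [Matrix.det_fin_two, hc] at had; lia
  rcases Int.eq_one_or_neg_one_of_mul_eq_one' had with ⟨ha, hd⟩ | ⟨ha, hd⟩
  · refine ⟨η 0 1, Or.inl ?_⟩
    ext i j
    fin_cases i <;> fin_cases j <;>
      simp [ha, hc, hd, coe_T_zpow, show (1 : Fin (0 + 2)) = (1 : Fin 2) from rfl]
  · refine ⟨-(η 0 1), Or.inr ?_⟩
    ext i j
    fin_cases i <;> fin_cases j <;>
      simp [ha, hc, hd, coe_T_zpow, show (1 : Fin (0 + 2)) = (1 : Fin 2) from rfl]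

/-- The element `± T^n γ`, with `γ` a representative of a coset. -/
def groupElt (p : Cosets × ℤ × Bool) : SL(2, ℤ) :=
  if p.2.2 then ModularGroup.T ^ p.2.1 * p.1.out else -(ModularGroup.T ^ p.2.1 * p.1.out)

lemma mk_groupElt (p : Cosets × ℤ × Bool) :
    Quotient.mk (QuotientGroup.rightRel GammaInf) (groupElt p) = p.1 := by
  conv_rhs => rw [← Quotient.out_eq p.1]
  have h := ModularGroup.T_pow_mul_apply_one p.2.1 p.1.out
  rw [coset_eq_iff, groupElt]
  split_ifs
  · rw [h]; ring
  · rw [Matrix.SpecialLinearGroup.coe_neg, Matrix.neg_apply, Matrix.neg_apply, h]; ring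

open ModularGroup in
lemma groupElt_injective : Function.Injective groupElt := by
  intro p q h
  have hc : p.1 = q.1 := by rw [← mk_groupElt p, ← mk_groupElt q, h]
  obtain ⟨c, n, b⟩ := p
  obtain ⟨c', n', b'⟩ := q
  obtain rfl : c = c' := hc
  have e00 : ∀ m : ℤ, (T ^ m) 0 0 = 1 := fun m => by simp [coe_T_zpow]
  have e01 : ∀ m : ℤ, (T ^ m) 0 1 = m := fun m => by simp [coe_T_zpow]
  unfold groupElt at h
  cases b <;> cases b' <;> simp only [Bool.false_eq_true, ↓reduceIte, ← neg_mul, neg_inj,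
    mul_left_inj] at h
  · have := congr_arg (fun g : SL(2, ℤ) => g 0 1) h
    simp only [e01] at this
    rw [this]
  · have := congr_arg (fun g : SL(2, ℤ) => g 0 0) h
    simp [e00] at this
  · have := congr_arg (fun g : SL(2, ℤ) => g 0 0) h
    simp [e00] at this
  · have := congr_arg (fun g : SL(2, ℤ) => g 0 1) h
    simp only [e01] at this
    rw [this]

lemma groupElt_surjective : Function.Surjective groupElt := by
  intro g
  set c : Cosets := Quotient.mk (QuotientGroup.rightRel GammaInf) g with hcdef
  have hm : g * c.out⁻¹ ∈ GammaInf :=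
    QuotientGroup.rightRel_apply.mp (Quotient.eq.mp (Quotient.out_eq c))
  obtain ⟨n, hn | hn⟩ := eq_T_zpow_or_neg hm
  · exact ⟨(c, n, true), by simp [groupElt, ← hn]⟩
  · exact ⟨(c, n, false), by simp [groupElt, ← neg_mul, ← hn]⟩

/-- Elements of `SL₂(ℤ)` as `± T^n γ`, with `γ` a representative of a coset. -/
def groupEquiv : Cosets × ℤ × Bool ≃ SL(2, ℤ) :=
  Equiv.ofBijective groupElt ⟨groupElt_injective, groupElt_surjective⟩

lemma groupEquiv_smul (c : Cosets) (n : ℤ) (b : Bool) (z : ℍ) :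
    groupEquiv (c, n, b) • z = ModularGroup.T ^ n • (c.out • z) := by
  change groupElt (c, n, b) • z = _
  unfold groupElt
  split_ifs
  · rw [mul_smul]
  · rw [ModularGroup.SL_neg_smul, mul_smul]

/-- The vertical strip `0 ≤ Re z < 1`. -/
def strip : Set ℍ := {z | z.re ∈ Set.Ico (0 : ℝ) 1}

lemma measurableSet_strip : MeasurableSet strip :=
  continuous_re.measurable measurableSet_Ico

lemma tsum_indicator_strip (h : ℍ → ℝ≥0∞) (hT : ∀ (n : ℤ) (z : ℍ), h (ModularGroup.T ^ n • z) = h z)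
    (w : ℍ) : ∑' n : ℤ, strip.indicator h (ModularGroup.T ^ n • w) = h w := by
  have hmem : ∀ n : ℤ, ModularGroup.T ^ n • w ∈ strip ↔ n = -⌊w.re⌋ := fun n => by
    change (ModularGroup.T ^ n • w).re ∈ Set.Ico (0 : ℝ) 1 ↔ _
    rw [ModularGroup.re_T_zpow_smul, Set.mem_Ico, eq_neg_iff_add_eq_zero, add_comm n,
      ← Int.floor_add_intCast, Int.floor_eq_zero_iff, Set.mem_Ico]
  rw [tsum_eq_single (-⌊w.re⌋) fun n hn => Set.indicator_of_notMem (mt (hmem n).mp hn) _,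
    Set.indicator_of_mem ((hmem _).mpr rfl), hT]

/-- Unfolding a sum over the cosets of `Γ_∞`. -/
lemma setLIntegral_fd_tsum_cosets {h : ℍ → ℝ≥0∞} (hm : Measurable h)
    (hT : ∀ (n : ℤ) (z : ℍ), h (ModularGroup.T ^ n • z) = h z) :
    ∫⁻ z in 𝒟, ∑' c : Cosets, h (c.out • z) = ∫⁻ z in strip, h z := by
  -- In `g = ± T^n γ` the sum over `n` hits the strip exactly once and the sign gives `2`, which
  -- cancels the `2` of `setLIntegral_fd_tsum`.
  have key : ∀ z : ℍ, ∑' g : SL(2, ℤ), strip.indicator h (g • z) =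
      2 * ∑' c : Cosets, h (c.out • z) := fun z => by
    rw [← groupEquiv.tsum_eq, ENNReal.tsum_prod (f := fun c q => strip.indicator h (groupEquiv (c, q) • z)), ← ENNReal.tsum_mul_left]
    refine tsum_congr fun c => ?_
    rw [ENNReal.tsum_prod (f := fun n b => strip.indicator h (groupEquiv (c, n, b) • z))]
    simp_rw [groupEquiv_smul]
    rw [← tsum_indicator_strip h hT (c.out • z), ← ENNReal.tsum_mul_left]
    refine tsum_congr fun n => ?_
    simp [two_mul]
  have h1 := setLIntegral_fd_tsum (hm.indicator measurableSet_strip)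
  simp_rw [key] at h1
  rw [lintegral_indicator measurableSet_strip] at h1
  have hmc (c : Cosets) : Measurable fun z : ℍ => h (c.out • z) :=
    hm.comp (measurePreserving_SL c.out).measurable
  rw [lintegral_const_mul _ (Measurable.tsum hmc)] at h1
  exact (ENNReal.mul_right_inj (by norm_num) (by norm_num)).mp h1

lemma setLIntegral_strip {h : ℍ → ℝ≥0∞} (hm : Measurable h) :
    ∫⁻ z in strip, h z =
      ∫⁻ y in Set.Ioi 0, ENNReal.ofReal (1 / y ^ 2) * ∫⁻ x in Set.Ico 0 1, h (pt x y) := by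
  rw [← lintegral_indicator measurableSet_strip,
    lintegral_eq_yx (hm.indicator measurableSet_strip)]
  refine setLIntegral_congr_fun measurableSet_Ioi fun y hy => ?_
  rw [← lintegral_indicator measurableSet_Ico]
  congr 1
  refine lintegral_congr fun x => ?_
  have : pt x y ∈ strip ↔ x ∈ Set.Ico (0 : ℝ) 1 := by
    change (pt x y).re ∈ Set.Ico (0 : ℝ) 1 ↔ _
    rw [re_pt x hy]
  by_cases hx : x ∈ Set.Ico (0 : ℝ) 1
  · rw [Set.indicator_of_mem hx, Set.indicator_of_mem (this.mpr hx)]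
  · rw [Set.indicator_of_notMem hx, Set.indicator_of_notMem (mt this.mp hx)]

end

section

/-! ### Fourier expansions and Hecke relations -/

variable {k : ℤ}

/-- The exponential `e(z) = e^(2 π i z)`. -/
def expc (w : ℂ) : ℂ := Complex.exp (2 * π * Complex.I * w)

lemma expc_add (v w : ℂ) : expc (v + w) = expc v * expc w := by
  rw [expc, mul_add, Complex.exp_add]; rfl

lemma expc_pow (w : ℂ) (m : ℕ) : expc w ^ m = expc (m * w) := by
  rw [expc, ← Complex.exp_nat_mul, expc]; congr 1; ring

lemma qParam_one (w : ℂ) : Function.Periodic.qParam 1 w = expc w := by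
  simp [Function.Periodic.qParam, expc]

lemma norm_expc (w : ℂ) : ‖expc w‖ = Real.exp (-(2 * π * w.im)) := by
  rw [expc, Complex.norm_exp]
  simp

lemma hasSum_fourier (f : CuspForm 𝒮ℒ k) (z : ℍ) :
    HasSum (fun m => fourierCoeff f m * expc z ^ m) (f z) := by
  have := ModularForm.hasSum_qExpansion f one_pos one_mem_strictPeriods_SL z
  simp only [qParam_one] at this
  exact this

lemma fourierCoeff_unique (f : CuspForm 𝒮ℒ k) {c : ℕ → ℂ}
    (h : ∀ z : ℍ, HasSum (fun m => c m * expc z ^ m) (f z)) (m : ℕ) : c m = fourierCoeff f m := by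
  refine ModularFormClass.qExpansion_coeff_unique one_pos one_mem_strictPeriods_SL (f := f) ?_ m
  simpa only [qParam_one, smul_eq_mul] using h

lemma fourierCoeff_zero (f : CuspForm 𝒮ℒ k) : fourierCoeff f 0 = 0 :=
  CuspFormClass.qExpansion_coeff_zero f one_pos one_mem_strictPeriods_SL

/-- The weight of a Hecke form is positive. -/
lemma IsHeckeForm.weight_pos {f : CuspForm 𝒮ℒ k} (hf : IsHeckeForm f) : 0 < k := by
  by_contra hk
  have hconst : ∃ c : ℂ, ⇑f = Function.const _ c := by
    rcases (not_lt.mp hk).lt_or_eq with h | h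
    · exact ⟨0, ModularFormClass.levelOne_neg_weight_eq_zero h f⟩
    · subst h; exact ModularFormClass.levelOne_weight_zero_const f
  obtain ⟨c, hc⟩ := hconst
  -- In weight at most `0` the form is constant, so its first coefficient is `0`, against the
  -- normalization.
  have h1 := fourierCoeff_unique f (c := fun m => if m = 0 then c else 0) (fun z => by
    rw [hc]
    convert! hasSum_single (f := fun m : ℕ => (if m = 0 then c else 0) * expc z ^ m) 0
      (fun m hm => by simp [hm]) using 1
    simp) 1
  rw [hf.coeff_one] at h1
  simp at h1

/-- A geometric sum over powers of a primitive `d`-th root of unity. -/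
lemma sum_range_expc {d : ℕ} (hd : d ≠ 0) (m : ℕ) :
    ∑ b ∈ Finset.range d, expc (m * (b / d)) = if d ∣ m then (d : ℂ) else 0 := by
  have hprim : IsPrimitiveRoot (expc (1 / d)) d := by
    have := Complex.isPrimitiveRoot_exp d hd
    rwa [show expc (1 / d) = Complex.exp (2 * π * Complex.I / d) by rw [expc]; ring_nf]
  have hterm : ∀ b : ℕ, expc (m * (b / d)) = (expc (1 / d) ^ m) ^ b := fun b => by
    rw [expc_pow, expc_pow]; congr 1; ring
  simp_rw [hterm]
  split_ifs with h
  · rw [(hprim.pow_eq_one_iff_dvd m).mpr h]; simp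
  · have h1 : expc (1 / d) ^ m - 1 ≠ 0 :=
      sub_ne_zero.mpr (mt (hprim.pow_eq_one_iff_dvd m).mp h)
    have h2 := mul_geom_sum (expc (1 / d) ^ m) d
    rw [← pow_mul, mul_comm m d, pow_mul, hprim.pow_eq_one, one_pow, sub_self] at h2
    exact (mul_eq_zero.mp h2).resolve_left h1

/-- The contribution of `a d = n` to a Fourier coefficient of `T_n f`. -/
lemma hasSum_hecke_term (f : CuspForm 𝒮ℒ k) {a d : ℕ} (ha : a ≠ 0) (hd : d ≠ 0) (z : ℍ) :
    HasSum (fun l => (if a ∣ l then (d : ℂ) * fourierCoeff f (d * (l / a)) else 0) * expc z ^ l)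
      (∑ b ∈ Finset.range d, f (ofComplex (((a : ℂ) * z + b) / d))) := by
  have hd' : (d : ℂ) ≠ 0 := Nat.cast_ne_zero.mpr hd
  have him : ∀ b : ℕ, 0 < (((a : ℂ) * z + b) / d).im := fun b => by
    have : (((a : ℂ) * z + b) / d).im = a * z.im / d := by
      rw [Complex.div_natCast_im]; simp
    rw [this]
    have := z.im_pos
    positivity
  have h1 : ∀ b ∈ Finset.range d, HasSum
      (fun m => fourierCoeff f m * (expc (m * (a * z / d)) * expc (m * (b / d))))
      (f (ofComplex (((a : ℂ) * z + b) / d))) := fun b _ => by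
    have := hasSum_fourier f (ofComplex (((a : ℂ) * z + b) / d))
    rw [ofComplex_apply_of_im_pos (him b)] at this ⊢
    refine this.congr_fun fun m => ?_
    rw [expc_pow, ← expc_add]
    congr 2
    change _ = _ * ((_ + _) / _)
    ring
  have h2 := hasSum_sum h1
  have h3 : (fun m : ℕ => ∑ b ∈ Finset.range d,
      fourierCoeff f m * (expc (m * (a * z / d)) * expc (m * (b / d)))) =
      fun m : ℕ => (if d ∣ m then (d : ℂ) else 0) * fourierCoeff f m * expc (m * (a * z / d)) := by
    funext m
    rw [← sum_range_expc hd m, Finset.sum_mul, Finset.sum_mul]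
    exact Finset.sum_congr rfl fun b _ => by ring
  rw [h3] at h2
  have hinj (c : ℕ) (hc : c ≠ 0) : Function.Injective fun l : ℕ => c * l :=
    fun x y h => Nat.eq_of_mul_eq_mul_left (Nat.pos_of_ne_zero hc) h
  -- Only indices `m = d l` survive the sum over `b`; such a term carries `e(a l z)` and so belongs
  -- to the index `a l`.
  rw [← (hinj d hd).hasSum_iff] at h2
  · rw [← (hinj a ha).hasSum_iff]
    · refine h2.congr_fun fun l => ?_
      simp only [Function.comp_apply, dvd_mul_right, if_true]
      rw [Nat.mul_div_cancel_left _ (Nat.pos_of_ne_zero ha), expc_pow]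
      congr 2
      push_cast
      field_simp
    · intro l hl
      have : ¬ a ∣ l := fun ⟨c, hc⟩ => hl ⟨c, hc.symm⟩
      simp [this]
  · intro l hl
    have : ¬ d ∣ l := fun ⟨c, hc⟩ => hl ⟨c, hc.symm⟩
    simp [this]

/-- The Fourier coefficients of `T_n f`. -/
def heckeCoeff (f : CuspForm 𝒮ℒ k) (n l : ℕ) : ℂ :=
  ∑ x ∈ n.divisorsAntidiagonal,
    if x.1 ∣ l then (x.1 : ℂ) ^ (k - 1) * fourierCoeff f (x.2 * (l / x.1)) else 0

lemma hasSum_heckeOp (f : CuspForm 𝒮ℒ k) (n : ℕ) (z : ℍ) :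
    HasSum (fun l => heckeCoeff f n l * expc z ^ l) (heckeOp k n f z) := by
  have h : ∀ x ∈ n.divisorsAntidiagonal, HasSum
      (fun l => (if x.1 ∣ l then (x.1 : ℂ) ^ (k - 1) * fourierCoeff f (x.2 * (l / x.1)) else 0) *
        expc z ^ l)
      ((n : ℂ) ^ (k - 1) * ∑ b ∈ Finset.range x.2,
        (x.2 : ℂ) ^ (-k) * f (ofComplex (((x.1 : ℂ) * z + b) / x.2))) := by
    intro x hx
    obtain ⟨hx1, hn⟩ := Nat.mem_divisorsAntidiagonal.mp hx
    have ha : x.1 ≠ 0 := by rintro h; simp [h] at hx1; exact hn hx1.symm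
    have hd : x.2 ≠ 0 := by rintro h; simp [h] at hx1; exact hn hx1.symm
    have hd' : (x.2 : ℂ) ≠ 0 := Nat.cast_ne_zero.mpr hd
    have := (hasSum_hecke_term f ha hd z).mul_left ((n : ℂ) ^ (k - 1) * (x.2 : ℂ) ^ (-k))
    rw [← Finset.mul_sum, ← mul_assoc]
    refine this.congr_fun fun l => ?_
    have hpow : (n : ℂ) ^ (k - 1) * (x.2 : ℂ) ^ (-k) * x.2 = (x.1 : ℂ) ^ (k - 1) := by
      rw [← hx1, Nat.cast_mul, mul_zpow, mul_assoc, mul_assoc, ← zpow_add_one₀ hd', ← zpow_add₀ hd']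
      simp
    split_ifs
    · rw [← hpow]; ring
    · simp
  have h2 := hasSum_sum h
  rw [← Finset.mul_sum] at h2
  refine h2.congr_fun fun l => ?_
  rw [heckeCoeff, Finset.sum_mul]

/-- The multiplication law for the Fourier coefficients of a Hecke form. -/
lemma IsHeckeForm.fourierCoeff_mul {f : CuspForm 𝒮ℒ k} (hf : IsHeckeForm f) {n : ℕ} (hn : 1 ≤ n)
    (l : ℕ) : fourierCoeff f n * fourierCoeff f l = heckeCoeff f n l := by
  obtain ⟨c, hc⟩ := hf.eigen n hn
  have key : ∀ l, c * fourierCoeff f l = heckeCoeff f n l := fun l => by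
    have h1 := fourierCoeff_unique (c • f) (c := fun l => c * fourierCoeff f l) (fun z => by
      have := (hasSum_fourier f z).mul_left c
      simpa [mul_assoc] using this) l
    have h2 := fourierCoeff_unique (c • f) (c := heckeCoeff f n) (fun z => by
      have := hasSum_heckeOp f n z
      rw [hc z] at this
      simpa using this) l
    rw [h1, h2]
  -- Compare coefficients at `1`: only `a = 1` divides `1`, and `a_f(1) = 1`.
  have hc1 : c = fourierCoeff f n := by
    have h1 := key 1
    rw [hf.coeff_one, mul_one, heckeCoeff, Finset.sum_eq_single (1, n)] at h1
    · simpa using h1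
    · rintro ⟨a, d⟩ hx hne
      rw [if_neg]
      rintro h
      have ha : a = 1 := Nat.dvd_one.mp h
      obtain ⟨hx1, -⟩ := Nat.mem_divisorsAntidiagonal.mp hx
      simp only [ha, one_mul] at hx1
      exact hne (by simp [ha, hx1])
    · intro h
      exact absurd (Nat.mem_divisorsAntidiagonal.mpr ⟨one_mul n, by lia⟩) h
  rw [← hc1, key]

/-- The eigenvalue of `T_n` is `a_f(n)`. -/
lemma IsHeckeForm.heckeOp_eq {f : CuspForm 𝒮ℒ k} (hf : IsHeckeForm f) {n : ℕ} (hn : 1 ≤ n) (z : ℍ) :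
    heckeOp k n f z = fourierCoeff f n * f z := by
  have h1 := hasSum_heckeOp f n z
  have h2 := (hasSum_fourier f z).mul_left (fourierCoeff f n)
  refine h1.unique (h2.congr_fun fun l => ?_)
  rw [← hf.fourierCoeff_mul hn, mul_assoc]

lemma IsHeckeForm.fourierCoeff_mul_of_coprime {f : CuspForm 𝒮ℒ k} (hf : IsHeckeForm f) {m n : ℕ}
    (h : m.Coprime n) : fourierCoeff f (m * n) = fourierCoeff f m * fourierCoeff f n := by
  rcases Nat.eq_zero_or_pos m with rfl | hm
  · simp [fourierCoeff_zero]
  rw [hf.fourierCoeff_mul hm, heckeCoeff, Finset.sum_eq_single (1, m)]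
  · simp
  · rintro ⟨a, d⟩ hx hne
    obtain ⟨hx1, -⟩ := Nat.mem_divisorsAntidiagonal.mp hx
    rw [if_neg]
    rintro hd
    have ha : a = 1 := Nat.eq_one_of_dvd_coprimes h ⟨d, hx1.symm⟩ hd
    simp only [ha, one_mul] at hx1
    exact hne (by simp [ha, hx1])
  · intro h
    exact absurd (Nat.mem_divisorsAntidiagonal.mpr ⟨one_mul m, by lia⟩) h

lemma IsHeckeForm.fourierCoeff_prime_pow {f : CuspForm 𝒮ℒ k} (hf : IsHeckeForm f) {p : ℕ}
    (hp : p.Prime) (e : ℕ) : fourierCoeff f p * fourierCoeff f (p ^ (e + 1)) =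
      fourierCoeff f (p ^ (e + 2)) + (p : ℂ) ^ (k - 1) * fourierCoeff f (p ^ e) := by
  -- The two terms come from the divisors `1` and `p` of `p`.
  rw [hf.fourierCoeff_mul hp.one_lt.le, heckeCoeff, Nat.sum_divisorsAntidiagonal (f := fun a d =>
    if a ∣ p ^ (e + 1) then (a : ℂ) ^ (k - 1) * fourierCoeff f (d * (p ^ (e + 1) / a)) else 0),
    hp.sum_divisors, add_comm]
  simp only [one_dvd, if_true, Nat.div_one, Nat.cast_one, one_zpow, one_mul]
  rw [if_pos (dvd_pow_self p e.succ_ne_zero), pow_succ p e, Nat.mul_div_cancel _ hp.pos,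
    Nat.div_self hp.pos, one_mul]
  congr 2
  ring

end

section

/-! ### The Rankin–Selberg integral -/

open scoped ENNReal

variable {k : ℤ}

lemma expc_mul_conj (m n : ℕ) (x : ℝ) :
    expc x ^ m * conj (expc x ^ n) = Complex.exp (2 * π * Complex.I * ((m : ℂ) - n) * x) := by
  rw [expc_pow, expc_pow, expc, expc, ← Complex.exp_conj, ← Complex.exp_add]
  congr 1
  simp [Complex.conj_ofNat]
  ring

lemma norm_expc_ofReal (x : ℝ) : ‖expc x‖ = 1 := by
  rw [norm_expc]; simp

lemma continuous_expc : Continuous expc := by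
  unfold expc; fun_prop

lemma integral_expc_mul_conj (m n : ℕ) :
    ∫ x in (0 : ℝ)..1, expc x ^ m * conj (expc x ^ n) = if m = n then 1 else 0 := by
  simp_rw [expc_mul_conj]
  split_ifs with h
  · simp [h]
  · have hne : 2 * π * Complex.I * ((m : ℂ) - n) ≠ 0 := by
      refine mul_ne_zero Complex.two_pi_I_ne_zero (sub_ne_zero.mpr ?_)
      exact_mod_cast h
    rw [integral_exp_mul_complex hne]
    have : Complex.exp (2 * π * Complex.I * ((m : ℂ) - n) * ((1 : ℝ) : ℂ)) = 1 := by
      rw [Complex.exp_eq_one_iff]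
      exact ⟨(m : ℤ) - n, by push_cast; ring⟩
    rw [this]
    simp

/-- Parseval's identity for an absolutely convergent Fourier series. -/
lemma hasSum_parseval {c : ℕ → ℂ} (hc : Summable fun m => ‖c m‖) :
    HasSum (fun m => ‖c m‖ ^ 2) (∫ x in (0 : ℝ)..1, ‖∑' m, c m * expc x ^ m‖ ^ 2) := by
  set F : ℕ × ℕ → ℝ → ℂ := fun p x => (c p.1 * conj (c p.2)) * (expc x ^ p.1 * conj (expc x ^ p.2))
    with hF
  have hcx : ∀ x : ℝ, Summable fun m => ‖c m * expc x ^ m‖ := fun x => by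
    simpa [norm_expc_ofReal] using hc
  have hcx' : ∀ x : ℝ, Summable fun m => ‖conj (c m * expc x ^ m)‖ := fun x => by
    simpa [norm_expc_ofReal] using hc
  have hsum : ∀ x : ℝ, ∑' p, F p x = ((‖∑' m, c m * expc x ^ m‖ ^ 2 : ℝ) : ℂ) := fun x => by
    have h1 := tsum_mul_tsum_of_summable_norm (hcx x) (hcx' x)
    rw [← Complex.conj_tsum, Complex.mul_conj, Complex.normSq_eq_norm_sq] at h1
    rw [h1]
    refine tsum_congr fun p => ?_
    simp only [hF, map_mul]
    ring
  have hcont : ∀ p, Continuous (F p) := fun p => by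
    have h1 : Continuous fun x : ℝ => expc x := continuous_expc.comp Complex.continuous_ofReal
    exact continuous_const.mul ((h1.pow _).mul (Complex.continuous_conj.comp (h1.pow _)))
  have hnorm : ∀ p x, ‖F p x‖ = ‖c p.1‖ * ‖c p.2‖ := fun p x => by
    simp [hF, norm_expc_ofReal]
  have hS : Summable fun p : ℕ × ℕ => ‖c p.1‖ * ‖c p.2‖ :=
    hc.mul_of_nonneg hc (fun _ => norm_nonneg _) (fun _ => norm_nonneg _)
  -- The squared norm is an absolutely convergent double series; integrated termwise, only its
  -- diagonal remains.
  have key := hasSum_integral_of_summable_integral_norm (μ := volume.restrict (Set.Ioc (0 : ℝ) 1))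
    (F := F) (fun p => ((hcont p).integrableOn_Icc).mono_set Set.Ioc_subset_Icc_self)
    (by simpa [hnorm] using hS)
  simp_rw [hsum] at key
  have hInt : ∀ p : ℕ × ℕ, ∫ x in Set.Ioc (0 : ℝ) 1, F p x =
      if p.1 = p.2 then ((‖c p.1‖ ^ 2 : ℝ) : ℂ) else 0 := fun p => by
    rw [← intervalIntegral.integral_of_le zero_le_one]
    simp only [hF]
    rw [intervalIntegral.integral_const_mul, integral_expc_mul_conj]
    split_ifs with h
    · rw [h, mul_one, Complex.mul_conj, Complex.normSq_eq_norm_sq]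
    · simp
  simp_rw [hInt] at key
  have hinj : Function.Injective fun m : ℕ => (m, m) := fun a b h => by simpa using h
  rw [← hinj.hasSum_iff, integral_complex_ofReal] at key
  · rw [intervalIntegral.integral_of_le zero_le_one]
    simp only [Function.comp_def, if_true] at key
    exact Complex.hasSum_ofReal.mp key
  · rintro ⟨a, b⟩ h
    rw [if_neg]
    rintro hab
    have hab : a = b := hab
    exact h ⟨a, by simp [hab]⟩

lemma continuous_cuspForm (f : CuspForm 𝒮ℒ k) : Continuous f :=
  (ModularFormClass.holo f).continuous

lemma continuous_Psi (f : CuspForm 𝒮ℒ k) : Continuous (Psi f) := by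
  unfold Psi
  refine ((continuous_cuspForm f).norm.pow 2).mul (continuous_im.zpow₀ k fun z => Or.inl ?_)
  exact z.im_pos.ne'

lemma Psi_nonneg (f : CuspForm 𝒮ℒ k) (z : ℍ) : 0 ≤ Psi f z := by
  have := z.im_pos
  unfold Psi; positivity

lemma petersson_self (f : CuspForm 𝒮ℒ k) (z : ℍ) : petersson k f f z = (Psi f z : ℂ) := by
  rw [petersson, Psi, mul_comm (conj _), Complex.mul_conj, Complex.normSq_eq_norm_sq]
  push_cast
  rfl

lemma Psi_smul (f : CuspForm 𝒮ℒ k) (g : SL(2, ℤ)) (z : ℍ) : Psi f (g • z) = Psi f z := by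
  have h := SlashInvariantFormClass.petersson_smul (k := k) (f := f) (f' := f) (τ := z)
    (g := (g : GL (Fin 2) ℝ)) (Γ := 𝒮ℒ) ⟨g, rfl⟩
  rw [petersson_self, petersson_self] at h
  exact_mod_cast h

lemma exists_Psi_le (f : CuspForm 𝒮ℒ k) : ∃ C : ℝ, ∀ z, Psi f z ≤ C := by
  obtain ⟨C, hC⟩ := CuspFormClass.petersson_bounded_left k 𝒮ℒ f f
  refine ⟨C, fun z => ?_⟩
  have := hC z
  rw [petersson_self, Complex.norm_real, Real.norm_of_nonneg (Psi_nonneg f z)] at this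
  exact this

lemma summable_fourier_norm (f : CuspForm 𝒮ℒ k) {y : ℝ} (hy : 0 < y) :
    Summable fun m => ‖fourierCoeff f m * expc (y * Complex.I) ^ m‖ := by
  have h := (hasSum_fourier f (pt 0 y)).summable
  rw [coe_pt 0 hy] at h
  have e : (⟨0, y⟩ : ℂ) = y * Complex.I := by apply Complex.ext <;> simp
  rw [e] at h
  exact h.norm

lemma cuspForm_pt (f : CuspForm 𝒮ℒ k) (x : ℝ) {y : ℝ} (hy : 0 < y) :
    f (pt x y) = ∑' m, (fourierCoeff f m * expc (y * Complex.I) ^ m) * expc x ^ m := by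
  rw [← (hasSum_fourier f (pt x y)).tsum_eq]
  refine tsum_congr fun m => ?_
  have e : ((pt x y : ℍ) : ℂ) = y * Complex.I + x := by
    rw [coe_pt x hy]; apply Complex.ext <;> simp
  rw [e, expc_add, mul_pow, mul_assoc]

/-- Parseval's identity on a horizontal line. -/
lemma lintegral_norm_sq (f : CuspForm 𝒮ℒ k) {y : ℝ} (hy : 0 < y) :
    ∫⁻ x in Set.Ico 0 1, ENNReal.ofReal (‖f (pt x y)‖ ^ 2) =
      ∑' n, ENNReal.ofReal (‖fourierCoeff f n‖ ^ 2 * Real.exp (-(4 * π * n * y))) := by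
  have hP := hasSum_parseval (summable_fourier_norm f hy)
  simp_rw [← cuspForm_pt f _ hy] at hP
  have hcont : Continuous fun x : ℝ => ‖f (pt x y)‖ ^ 2 := by
    refine ((continuous_cuspForm f).comp ?_).norm.pow 2
    refine continuous_iff_continuousAt.mpr fun x => ?_
    have h1 : ContinuousAt (ofComplex : ℂ → ℍ) ⟨x, y⟩ :=
      (mdifferentiableAt_ofComplex (z := ⟨x, y⟩) hy).continuousAt
    refine ContinuousAt.comp (f := fun x : ℝ => (⟨x, y⟩ : ℂ)) h1 ?_
    have : (fun x : ℝ => (⟨x, y⟩ : ℂ)) = fun x : ℝ => (x : ℂ) + y * Complex.I := by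
      funext x; apply Complex.ext <;> simp
    rw [this]; fun_prop
  rw [setLIntegral_congr Ico_ae_eq_Ioc, ← ofReal_integral_eq_lintegral_ofReal
    (hcont.integrableOn_Icc.mono_set Set.Ioc_subset_Icc_self) (.of_forall fun x => by positivity),
    ← intervalIntegral.integral_of_le zero_le_one, ← hP.tsum_eq,
    ENNReal.ofReal_tsum_of_nonneg (fun _ => by positivity) hP.summable]
  refine tsum_congr fun n => ?_
  rw [norm_mul, mul_pow, norm_pow, norm_expc, ← Real.exp_nat_mul, ← Real.exp_nat_mul]
  congr 3
  simp
  ring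

lemma lintegral_rpow_mul_exp {a r : ℝ} (ha : 0 < a) (hr : 0 < r) :
    ∫⁻ y in Set.Ioi 0, ENNReal.ofReal (y ^ (a - 1) * Real.exp (-(r * y))) =
      ENNReal.ofReal (Real.Gamma a / r ^ a) := by
  have h := Real.integral_rpow_mul_exp_neg_mul_Ioi ha hr
  have hpos : 0 < (1 / r) ^ a * Real.Gamma a :=
    mul_pos (Real.rpow_pos_of_pos (by positivity) _) (Real.Gamma_pos_of_pos ha)
  -- A non-integrable function would have integral `0`, but the known value is positive.
  have hInt : IntegrableOn (fun y : ℝ => y ^ (a - 1) * Real.exp (-(r * y))) (Set.Ioi 0) := by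
    by_contra hn
    rw [integral_undef hn] at h
    exact hpos.ne h
  rw [← ofReal_integral_eq_lintegral_ofReal hInt
    ((ae_restrict_iff' measurableSet_Ioi).mpr (.of_forall fun y (hy : 0 < y) => by positivity)), h,
    one_div, Real.inv_rpow hr.le, div_eq_inv_mul]

/-- The Rankin–Selberg unfolding, at a real point. -/
lemma rankinSelberg (f : CuspForm 𝒮ℒ k) {σ : ℝ} (hσ : 0 < σ + k - 1) :
    ∫⁻ z in 𝒟, ENNReal.ofReal (Psi f z) * ∑' c : Cosets, ENNReal.ofReal (cosetIm z c ^ σ) =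
      ∑' n : ℕ, ENNReal.ofReal
        (‖fourierCoeff f n‖ ^ 2 * (Real.Gamma (σ + k - 1) / (4 * π * n) ^ (σ + k - 1))) := by
  set h : ℍ → ℝ≥0∞ := fun z => ENNReal.ofReal (Psi f z) * ENNReal.ofReal (z.im ^ σ) with hh
  have hm : Measurable h := by
    refine Measurable.mul (ENNReal.measurable_ofReal.comp (continuous_Psi f).measurable)
      (ENNReal.measurable_ofReal.comp ?_)
    exact continuous_im.measurable.pow_const σ
  have hT : ∀ (n : ℤ) (z : ℍ), h (ModularGroup.T ^ n • z) = h z := fun n z => by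
    simp only [hh]
    rw [Psi_smul, ModularGroup.im_T_zpow_smul]
  have h1 : ∀ z : ℍ, ENNReal.ofReal (Psi f z) * ∑' c : Cosets, ENNReal.ofReal (cosetIm z c ^ σ) =
      ∑' c : Cosets, h (c.out • z) := fun z => by
    rw [← ENNReal.tsum_mul_left]
    refine tsum_congr fun c => ?_
    simp only [hh]
    rw [Psi_smul, cosetIm_eq]
  simp_rw [h1]
  rw [setLIntegral_fd_tsum_cosets hm hT, setLIntegral_strip hm]
  have h2 : ∀ y ∈ Set.Ioi (0 : ℝ),
      ENNReal.ofReal (1 / y ^ 2) * ∫⁻ x in Set.Ico 0 1, h (pt x y) =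
      ∑' n : ℕ, ENNReal.ofReal (‖fourierCoeff f n‖ ^ 2) * ENNReal.ofReal
        (y ^ ((σ + k - 1) - 1) * Real.exp (-(4 * π * n * y))) := by
    intro y hy
    have hy : 0 < y := hy
    have e1 : ∀ x, h (pt x y) =
        ENNReal.ofReal (‖f (pt x y)‖ ^ 2) * ENNReal.ofReal (y ^ k * y ^ σ) := fun x => by
      simp only [hh, Psi, im_pt x hy]
      rw [← ENNReal.ofReal_mul (by positivity), ← ENNReal.ofReal_mul (by positivity), mul_assoc]
    simp_rw [e1]
    rw [lintegral_mul_const' _ _ ENNReal.ofReal_ne_top, lintegral_norm_sq f hy, mul_left_comm,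
      ← ENNReal.ofReal_mul (by positivity), ← ENNReal.tsum_mul_right]
    refine tsum_congr fun n => ?_
    rw [← ENNReal.ofReal_mul (by positivity), ← ENNReal.ofReal_mul (by positivity)]
    congr 1
    -- The powers come from the invariant measure, from `Ψ` and from the Eisenstein series.
    have e2 : y ^ ((σ + k - 1) - 1) = 1 / y ^ 2 * (y ^ k * y ^ σ) := by
      rw [← Real.rpow_intCast, ← Real.rpow_natCast, one_div, ← Real.rpow_neg hy.le,
        ← Real.rpow_add hy, ← Real.rpow_add hy]
      congr 1
      push_cast
      ring
    rw [e2]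
    ring
  rw [setLIntegral_congr_fun measurableSet_Ioi h2, lintegral_tsum]
  · refine tsum_congr fun n => ?_
    rw [lintegral_const_mul' _ _ ENNReal.ofReal_ne_top]
    rcases Nat.eq_zero_or_pos n with rfl | hn
    · simp [fourierCoeff_zero]
    · rw [lintegral_rpow_mul_exp hσ (by positivity), ← ENNReal.ofReal_mul (by positivity)]
  · intro n
    refine Measurable.aemeasurable (Measurable.const_mul (ENNReal.measurable_ofReal.comp ?_) _)
    fun_prop

end

section

/-! ### Hecke operators are self-adjoint -/

open scoped ENNReal ModularForm
open Matrix (GeneralLinearGroup)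

variable {k : ℤ} {n : ℕ}

/-- The triples `((a, d), b)` with `a d = n` and `0 ≤ b < d`. -/
abbrev HeckeIndex (n : ℕ) : Type :=
  {q : Σ _ : ℕ × ℕ, ℕ // q ∈ n.divisorsAntidiagonal.sigma fun x => Finset.range x.2}

/-- The upper triangular representatives of the integral matrices of determinant `n`. -/
def heckeRep (q : HeckeIndex n) : FixedDetMatrix (Fin 2) ℤ n :=
  ⟨!![(q.1.1.1 : ℤ), q.1.2; 0, q.1.1.2], by
    have h := (Nat.mem_divisorsAntidiagonal.mp (Finset.mem_sigma.mp q.2).1).1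
    rw [Matrix.det_fin_two_of, mul_zero, sub_zero]
    exact_mod_cast h⟩

lemma coe_heckeRep (q : HeckeIndex n) :
    (heckeRep q).1 = !![(q.1.1.1 : ℤ), q.1.2; 0, q.1.1.2] := rfl

variable [NeZero n]

/-- An integral matrix of determinant `n` as an element of `GL₂(ℝ)`. -/
def toGL (A : FixedDetMatrix (Fin 2) ℤ n) : GL (Fin 2) ℝ :=
  Matrix.GeneralLinearGroup.mkOfDetNeZero (A.1.map (Int.cast : ℤ → ℝ)) (by
    have h := Int.cast_det (R := ℝ) A.1
    rw [A.2] at h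
    rw [← h]
    exact_mod_cast NeZero.ne n)

lemma coe_toGL (A : FixedDetMatrix (Fin 2) ℤ n) :
    (toGL A : Matrix (Fin 2) (Fin 2) ℝ) = A.1.map (Int.cast : ℤ → ℝ) := rfl

lemma det_toGL (A : FixedDetMatrix (Fin 2) ℤ n) : (toGL A).det.val = n := by
  rw [Matrix.GeneralLinearGroup.val_det_apply, coe_toGL, ← Int.cast_det, A.2]
  simp

lemma toGL_smul (g : SL(2, ℤ)) (A : FixedDetMatrix (Fin 2) ℤ n) :
    toGL (g • A) = (g : GL (Fin 2) ℝ) * toGL A := by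
  apply Units.ext
  rw [Units.val_mul, coe_toGL, coe_toGL, FixedDetMatrices.smul_coe]
  ext i j
  simp [Matrix.mul_apply]

/-- The adjugate, as an involution of the integral matrices of determinant `n`. -/
def adj : FixedDetMatrix (Fin 2) ℤ n ≃ FixedDetMatrix (Fin 2) ℤ n where
  toFun A := ⟨A.1.adjugate, by rw [Matrix.det_adjugate, A.2]; simp⟩
  invFun A := ⟨A.1.adjugate, by rw [Matrix.det_adjugate, A.2]; simp⟩
  left_inv A := by apply FixedDetMatrices.ext'; simp [Matrix.adjugate_adjugate]
  right_inv A := by apply FixedDetMatrices.ext'; simp [Matrix.adjugate_adjugate]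

lemma coe_adj_mul (A : FixedDetMatrix (Fin 2) ℤ n) :
    ((toGL (adj A) * toGL A : GL (Fin 2) ℝ) : Matrix (Fin 2) (Fin 2) ℝ) =
      (n : ℝ) • (1 : Matrix (Fin 2) (Fin 2) ℝ) := by
  rw [Units.val_mul, coe_toGL, coe_toGL]
  have h : A.1.adjugate * A.1 = (n : ℤ) • (1 : Matrix (Fin 2) (Fin 2) ℤ) := by
    rw [Matrix.adjugate_mul, A.2]
  have h2 := congr_arg (fun M : Matrix (Fin 2) (Fin 2) ℤ => M.map (Int.castRingHom ℝ)) h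
  simp only [Matrix.map_mul] at h2
  refine h2.trans ?_
  ext i j
  rw [Matrix.map_apply, Matrix.smul_apply, Matrix.smul_apply, Matrix.one_apply, Matrix.one_apply]
  split_ifs <;> simp

lemma sigma_eq_self {g : GL (Fin 2) ℝ} (hg : 0 < g.det.val) (w : ℂ) : σ g w = w := by
  rw [σ, if_pos hg]; rfl

/-- The determinant is `c²`, and `(c²)^(k-1) c^(-k) = c^(k-2)`. It applies to `adj A · A`, which is
the scalar `n`. -/
lemma slash_scalar (f : ℍ → ℂ) {g : GL (Fin 2) ℝ} {c : ℝ} (hc : 0 < c)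
    (hg : (g : Matrix (Fin 2) (Fin 2) ℝ) = c • 1) (z : ℍ) :
    g • z = z ∧ (f ∣[k] g) z = (c : ℂ) ^ (k - 2) * f z := by
  have hdet : g.det.val = c ^ 2 := by
    rw [Matrix.GeneralLinearGroup.val_det_apply, hg]; simp
  have hpos : 0 < g.det.val := by rw [hdet]; positivity
  have hcc : (c : ℂ) ≠ 0 := by exact_mod_cast hc.ne'
  have hden : denom g z = c := by simp [denom, hg]
  have hs : g • z = z := by
    apply UpperHalfPlane.ext
    rw [UpperHalfPlane.coe_smul_of_det_pos hpos, hden]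
    simp [num, hg, hcc]
  refine ⟨hs, ?_⟩
  rw [ModularForm.slash_apply, hs, hden, hdet, abs_of_pos (by positivity)]
  rw [sigma_eq_self hpos]
  push_cast
  rw [← zpow_natCast, ← zpow_mul, mul_assoc, ← zpow_add₀ hcc, mul_comm]
  congr 2
  push_cast; ring

/-- The contribution of a matrix to the inner product of `f` and its image under `T_n`. -/
def kernelTerm (f : CuspForm 𝒮ℒ k) (A : FixedDetMatrix (Fin 2) ℤ n) (z : ℍ) : ℂ :=
  petersson k f ((f : ℍ → ℂ) ∣[k] toGL A) z

lemma det_toGL_pos (A : FixedDetMatrix (Fin 2) ℤ n) : 0 < (toGL A).det.val := by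
  rw [det_toGL]; exact_mod_cast NeZero.pos n

lemma adj_smul_smul (A : FixedDetMatrix (Fin 2) ℤ n) (z : ℍ) :
    toGL (adj A) • toGL A • z = z := by
  rw [← mul_smul]
  exact (slash_scalar (k := 0) 0 (by exact_mod_cast NeZero.pos n) (coe_adj_mul A) z).1

lemma kernelTerm_smul (f : CuspForm 𝒮ℒ k) (g : SL(2, ℤ)) (A : FixedDetMatrix (Fin 2) ℤ n) :
    kernelTerm f (g • A) = kernelTerm f A := by
  have h : (f : ℍ → ℂ) ∣[k] (g : GL (Fin 2) ℝ) = f :=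
    SlashInvariantFormClass.slash_action_eq f _ ⟨g, rfl⟩
  funext z
  rw [kernelTerm, kernelTerm, toGL_smul, SlashAction.slash_mul, h]

/-- Apply `petersson_slash` to `f ∣ adj A` and `f`: slashing by `A` turns `f ∣ adj A` into `n^(k-2)
f`, and the same power of `n` appears on the other side. -/
lemma kernelTerm_adj (f : CuspForm 𝒮ℒ k) (A : FixedDetMatrix (Fin 2) ℤ n) (z : ℍ) :
    kernelTerm f A z = conj (kernelTerm f (adj A) (toGL A • z)) := by
  have hn : (n : ℂ) ≠ 0 := by exact_mod_cast NeZero.ne n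
  have h := petersson_slash k ((f : ℍ → ℂ) ∣[k] toGL (adj A)) f (toGL A) z
  rw [sigma_eq_self (det_toGL_pos A), det_toGL, ← SlashAction.slash_mul,
    petersson_symm k f ((f : ℍ → ℂ) ∣[k] toGL (adj A))] at h
  have h2 : petersson k ((f : ℍ → ℂ) ∣[k] (toGL (adj A) * toGL A)) ((f : ℍ → ℂ) ∣[k] toGL A) z =
      (n : ℂ) ^ (k - 2) * kernelTerm f A z := by
    rw [kernelTerm, petersson, petersson,
      (slash_scalar (k := k) f (by exact_mod_cast NeZero.pos n) (coe_adj_mul A) z).2]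
    simp
    ring
  rw [h2, Nat.abs_cast, Complex.ofReal_natCast] at h
  exact mul_left_cancel₀ (zpow_ne_zero _ hn) h

/-- Since `Ψ` is bounded on `ℍ`, this bounds the kernel uniformly in `A` and `z`. -/
lemma norm_kernelTerm_sq (f : CuspForm 𝒮ℒ k) (A : FixedDetMatrix (Fin 2) ℤ n) (z : ℍ) :
    ‖kernelTerm f A z‖ ^ 2 = Psi f z * ((n : ℝ) ^ (k - 2) * Psi f (toGL A • z)) := by
  have h := petersson_slash k f f (toGL A) z
  rw [sigma_eq_self (det_toGL_pos A), det_toGL, petersson_self] at h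
  have h2 : petersson k ((f : ℍ → ℂ) ∣[k] toGL A) ((f : ℍ → ℂ) ∣[k] toGL A) z =
      ((‖((f : ℍ → ℂ) ∣[k] toGL A) z‖ ^ 2 * z.im ^ k : ℝ) : ℂ) := by
    rw [petersson, mul_comm (conj _), Complex.mul_conj, Complex.normSq_eq_norm_sq]
    push_cast
    rfl
  rw [h2, Nat.abs_cast] at h
  have h3 : ‖((f : ℍ → ℂ) ∣[k] toGL A) z‖ ^ 2 * z.im ^ k = (n : ℝ) ^ (k - 2) * Psi f (toGL A • z) := by
    exact_mod_cast h
  rw [← h3, kernelTerm, petersson, Psi]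
  simp only [norm_mul, norm_zpow, Complex.norm_real, Complex.norm_conj, Real.norm_of_nonneg z.im_pos.le]
  ring

lemma exists_norm_kernelTerm_le (f : CuspForm 𝒮ℒ k) :
    ∃ C : ℝ, 0 ≤ C ∧ ∀ (A : FixedDetMatrix (Fin 2) ℤ n) (z : ℍ), ‖kernelTerm f A z‖ ≤ C := by
  obtain ⟨C, hC⟩ := exists_Psi_le f
  refine ⟨√(C * ((n : ℝ) ^ (k - 2) * C)), Real.sqrt_nonneg _, fun A z => Real.le_sqrt_of_sq_le ?_⟩
  rw [norm_kernelTerm_sq]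
  have h0 := (Psi_nonneg f z).trans (hC z)
  gcongr
  · have := Psi_nonneg f (toGL A • z); positivity
  · exact hC z
  · exact hC _

lemma continuous_slash (f : CuspForm 𝒮ℒ k) (A : FixedDetMatrix (Fin 2) ℤ n) :
    Continuous ((f : ℍ → ℂ) ∣[k] toGL A) := by
  have h : (f : ℍ → ℂ) ∣[k] toGL A = fun z => f (toGL A • z) * |(toGL A).det.val| ^ (k - 1) *
      denom (toGL A) z ^ (-k) := by
    funext z
    rw [ModularForm.slash_apply, sigma_eq_self (det_toGL_pos A)]
  rw [h]
  refine (((continuous_cuspForm f).comp (continuous_const_smul _)).mul continuous_const).mul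
    (Continuous.zpow₀ ?_ _ fun z => Or.inl (denom_ne_zero _ z))
  unfold denom
  fun_prop

lemma continuous_kernelTerm (f : CuspForm 𝒮ℒ k) (A : FixedDetMatrix (Fin 2) ℤ n) :
    Continuous (kernelTerm f A) :=
  petersson_continuous k (continuous_cuspForm f) (continuous_slash f A)

lemma heckeOp_eq_sum_slash (f : CuspForm 𝒮ℒ k) (z : ℍ) :
    heckeOp k n f z = ∑ q : HeckeIndex n, ((f : ℍ → ℂ) ∣[k] toGL (heckeRep q)) z := by
  rw [heckeOp, Finset.mul_sum]
  simp_rw [Finset.mul_sum]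
  rw [Finset.sum_sigma', ← Finset.sum_coe_sort]
  refine Finset.sum_congr rfl fun q _ => ?_
  have hd : denom (toGL (heckeRep q)) z = q.1.1.2 := by
    simp [denom, coe_toGL, coe_heckeRep]
  have hs : toGL (heckeRep q) • z = ofComplex (((q.1.1.1 : ℂ) * z + q.1.2) / q.1.1.2) := by
    rw [← ofComplex_apply (toGL (heckeRep q) • z), coe_smul_of_det_pos (det_toGL_pos _), hd]
    simp [num, coe_toGL, coe_heckeRep]
  rw [ModularForm.slash_apply, sigma_eq_self (det_toGL_pos _), hs, hd, det_toGL, Nat.abs_cast]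
  push_cast
  ring

/-- Hermite normal form. For uniqueness, the connecting matrix is upper triangular with positive,
hence unit, diagonal, and `0 ≤ b < d` excludes a translation. -/
lemma heckeRep_bijective :
    Function.Bijective fun p : HeckeIndex n × SL(2, ℤ) => p.2 • heckeRep p.1 := by
  constructor
  · rintro ⟨q, g⟩ ⟨q', g'⟩ h
    simp only at h
    obtain ⟨u, rfl⟩ : ∃ u, g = g' * u := ⟨g'⁻¹ * g, by group⟩
    rw [mul_smul] at h
    have h := MulAction.injective g' h
    obtain ⟨⟨⟨a, d⟩, b⟩, hq⟩ := q
    obtain ⟨⟨⟨a', d'⟩, b'⟩, hq'⟩ := q'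
    have h0 := congr_arg (fun M => M.1) h
    simp only [FixedDetMatrices.smul_coe, coe_heckeRep] at h0
    have hu := u.det_coe
    rw [Matrix.det_fin_two] at hu
    have e00 := congr_fun (congr_fun h0 0) 0
    have e01 := congr_fun (congr_fun h0 0) 1
    have e10 := congr_fun (congr_fun h0 1) 0
    have e11 := congr_fun (congr_fun h0 1) 1
    simp [Matrix.mul_apply] at e00 e01 e10 e11
    simp only [Finset.mem_sigma, Nat.mem_divisorsAntidiagonal, Finset.mem_range] at hq hq'
    have ha : a ≠ 0 := by rintro rfl; simp at hq; exact hq.1.2 hq.1.1.symm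
    have ha' : a' ≠ 0 := by rintro rfl; simp at hq'; exact hq'.1.2 hq'.1.1.symm
    have hc : u 1 0 = 0 := by simpa [ha] using e10
    rw [hc] at hu e11
    have hu1 : u 0 0 = 1 := by
      rcases Int.eq_one_or_neg_one_of_mul_eq_one' (show u 0 0 * u 1 1 = 1 by linarith) with h1 | h1
      · exact h1.1
      · rw [h1.1] at e00; lia
    have hu2 : u 1 1 = 1 := by rw [hu1] at hu; linarith
    rw [hu1] at e00 e01
    rw [hu2] at e11
    obtain rfl : a = a' := by lia
    obtain rfl : d = d' := by lia
    have hb : u 0 1 = 0 := by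
      have h1 : u 0 1 * d < d := by lia
      have h2 : -(d : ℤ) < u 0 1 * d := by lia
      have hd : (0 : ℤ) < d := by lia
      have h3 : u 0 1 < 1 := by nlinarith
      have h4 : -1 < u 0 1 := by nlinarith
      lia
    obtain rfl : b = b' := by rw [hb] at e01; lia
    have : u = 1 := by
      ext i j
      fin_cases i <;> fin_cases j <;> simp [hc, hb, hu1, hu2]
    simp [this]
  · intro A
    have hn0 : (n : ℤ) ≠ 0 := by exact_mod_cast NeZero.ne n
    induction A using FixedDetMatrices.induction_on hn0 with
    | h0 A h10 h00 h01 h11 =>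
      have hdet := A.2
      rw [Matrix.det_fin_two, h10, mul_zero, sub_zero] at hdet
      have hn : (0 : ℤ) < n := by exact_mod_cast NeZero.pos n
      have hd : 0 < A.1 1 1 := by
        by_contra hneg
        nlinarith
      rw [abs_of_nonneg h01, abs_of_pos hd] at h11
      refine ⟨(⟨⟨((A.1 0 0).toNat, (A.1 1 1).toNat), (A.1 0 1).toNat⟩, ?_⟩, 1), ?_⟩
      · simp only [Finset.mem_sigma, Nat.mem_divisorsAntidiagonal, Finset.mem_range]
        refine ⟨⟨?_, NeZero.ne n⟩, by lia⟩
        zify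
        rw [Int.toNat_of_nonneg h00.le, Int.toNat_of_nonneg hd.le, hdet]
      · simp only [one_smul]
        ext i j
        fin_cases i <;> fin_cases j <;> simp [heckeRep, h10, h00.le, hd.le, h01]
    | hS B hB =>
      obtain ⟨p, rfl⟩ := hB
      exact ⟨(p.1, ModularGroup.S * p.2), mul_smul _ _ _⟩
    | hT B hB =>
      obtain ⟨p, rfl⟩ := hB
      exact ⟨(p.1, ModularGroup.T * p.2), mul_smul _ _ _⟩

/-- Integral matrices of determinant `n` as products of elements of `SL₂(ℤ)` and representatives. -/
def heckeEquiv : HeckeIndex n × SL(2, ℤ) ≃ FixedDetMatrix (Fin 2) ℤ n :=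
  Equiv.ofBijective _ heckeRep_bijective

/-! ### Truncated integrals and the symmetry of `T_n`. -/

/-- The contribution of a matrix to the inner product of `f` and its image under `T_n`, cut off
to a fundamental domain in both variables. -/
def cutoffTerm (f : CuspForm 𝒮ℒ k) (A : FixedDetMatrix (Fin 2) ℤ n) (z : ℍ) : ℂ :=
  (𝒟ᵒ : Set ℍ).indicator (fun z =>
    (𝒟ᵒ : Set ℍ).indicator (1 : ℍ → ℂ) (toGL A • z) * kernelTerm f A z) z

/-- The substitution `z ↦ A z` exchanges the two cut-offs, because `adj A` acts as the inverse of
`A`. -/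
lemma integral_cutoffTerm_adj (f : CuspForm 𝒮ℒ k) (A : FixedDetMatrix (Fin 2) ℤ n) :
    ∫ z, cutoffTerm f A z = conj (∫ z, cutoffTerm f (adj A) z) := by
  rw [← integral_conj]
  conv_rhs => rw [← (measurePreserving_smul (toGL A) (volume : Measure ℍ)).integral_comp
    (MeasurableEquiv.smul (toGL A)).measurableEmbedding]
  refine integral_congr_ae (Filter.Eventually.of_forall fun z => ?_)
  simp only [cutoffTerm]
  by_cases h1 : z ∈ (𝒟ᵒ : Set ℍ) <;> by_cases h2 : toGL A • z ∈ (𝒟ᵒ : Set ℍ) <;>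
    simp [h1, h2, adj_smul_smul, ← kernelTerm_adj]

lemma measurable_cutoffTerm (f : CuspForm 𝒮ℒ k) (A : FixedDetMatrix (Fin 2) ℤ n) :
    Measurable (cutoffTerm f A) :=
  (((measurable_one.indicator measurableSet_fdo).comp (measurable_const_smul (toGL A))).mul
    (continuous_kernelTerm f A).measurable).indicator measurableSet_fdo

lemma toGL_smul_smul (g : SL(2, ℤ)) (A : FixedDetMatrix (Fin 2) ℤ n) (z : ℍ) :
    toGL (g • A) • z = g • toGL A • z := by
  rw [toGL_smul, mul_smul]; rfl

/-- For almost every `z`, exactly two `g` bring `A z` into `𝒟ᵒ`, so the norms sum to at most `2 C`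
on a set of finite area. -/
lemma tsum_lintegral_cutoffTerm_ne_top (f : CuspForm 𝒮ℒ k) (A : FixedDetMatrix (Fin 2) ℤ n) :
    ∑' g : SL(2, ℤ), ∫⁻ z, ‖cutoffTerm f (g • A) z‖ₑ ≠ ∞ := by
  obtain ⟨C, hC0, hC⟩ := exists_norm_kernelTerm_le (n := n) f
  rw [← lintegral_tsum fun g => (measurable_cutoffTerm f (g • A)).enorm.aemeasurable]
  have hae := (measurePreserving_smul (toGL A) (volume : Measure ℍ)).quasiMeasurePreserving.ae
    (ae_tsum_indicator_fdo (R := ℝ≥0∞))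
  have hle : ∀ᵐ z : ℍ, ∑' g : SL(2, ℤ), ‖cutoffTerm f (g • A) z‖ₑ ≤
      (𝒟ᵒ : Set ℍ).indicator (fun _ => 2 * ENNReal.ofReal C) z := by
    filter_upwards [hae] with z hz
    by_cases hzF : z ∈ (𝒟ᵒ : Set ℍ)
    · rw [Set.indicator_of_mem hzF, ← hz, ← ENNReal.tsum_mul_right]
      refine ENNReal.tsum_le_tsum fun g => ?_
      rw [cutoffTerm, Set.indicator_of_mem hzF, enorm_mul, toGL_smul_smul]
      gcongr
      · by_cases h : g • toGL A • z ∈ (𝒟ᵒ : Set ℍ)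
        · rw [Set.indicator_of_mem h, Set.indicator_of_mem h]; simp
        · rw [Set.indicator_of_notMem h, enorm_zero]; exact zero_le
      · rw [← ofReal_norm]
        exact ENNReal.ofReal_le_ofReal (hC _ _)
    · simp [cutoffTerm, hzF]
  refine ((lintegral_mono_ae hle).trans_lt ?_).ne
  rw [lintegral_indicator measurableSet_fdo, setLIntegral_const, measure_congr fdo_ae_eq_fd]
  exact ENNReal.mul_lt_top (ENNReal.mul_lt_top (by norm_num) ENNReal.ofReal_lt_top)
    volume_fd_ne_top.lt_top

lemma integrable_cutoffTerm (f : CuspForm 𝒮ℒ k) (A : FixedDetMatrix (Fin 2) ℤ n) :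
    Integrable (cutoffTerm f A) := by
  refine ⟨(measurable_cutoffTerm f A).aestronglyMeasurable, ?_⟩
  have h := (ENNReal.le_tsum (f := fun g : SL(2, ℤ) => ∫⁻ z, ‖cutoffTerm f (g • A) z‖ₑ) 1).trans_lt
    (tsum_lintegral_cutoffTerm_ne_top f A).lt_top
  rw [one_smul] at h
  exact h

lemma summable_integral_norm_cutoffTerm (f : CuspForm 𝒮ℒ k) (A : FixedDetMatrix (Fin 2) ℤ n) :
    Summable fun g : SL(2, ℤ) => ∫ z, ‖cutoffTerm f (g • A) z‖ := by
  refine (ENNReal.summable_toReal (tsum_lintegral_cutoffTerm_ne_top f A)).congr fun g => ?_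
  rw [integral_norm_eq_lintegral_enorm (measurable_cutoffTerm f (g • A)).aestronglyMeasurable]

lemma hasSum_integral_cutoffTerm (f : CuspForm 𝒮ℒ k) (A : FixedDetMatrix (Fin 2) ℤ n) :
    HasSum (fun g : SL(2, ℤ) => ∫ z, cutoffTerm f (g • A) z) (2 * ∫ z in 𝒟, kernelTerm f A z) := by
  have h := hasSum_integral_of_summable_integral_norm
    (fun g : SL(2, ℤ) => integrable_cutoffTerm f (g • A)) (summable_integral_norm_cutoffTerm f A)
  suffices he : 2 * ∫ z in 𝒟, kernelTerm f A z = ∫ z, ∑' g : SL(2, ℤ), cutoffTerm f (g • A) z by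
    rw [he]; exact h
  rw [← setIntegral_congr_set fdo_ae_eq_fd, ← integral_indicator measurableSet_fdo,
    ← integral_const_mul]
  have hae := (measurePreserving_smul (toGL A) (volume : Measure ℍ)).quasiMeasurePreserving.ae
    (ae_tsum_indicator_fdo (R := ℂ))
  refine integral_congr_ae ?_
  filter_upwards [hae] with z hz
  by_cases hzF : z ∈ (𝒟ᵒ : Set ℍ)
  · rw [Set.indicator_of_mem hzF, ← hz, ← tsum_mul_right]
    refine tsum_congr fun g => ?_
    rw [cutoffTerm, Set.indicator_of_mem hzF, toGL_smul_smul, kernelTerm_smul]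
  · simp [cutoffTerm, hzF]

lemma summable_integral_cutoffTerm (f : CuspForm 𝒮ℒ k) :
    Summable fun p : HeckeIndex n × SL(2, ℤ) => ∫ z, cutoffTerm f (heckeEquiv p) z := by
  have h : Summable fun p : HeckeIndex n × SL(2, ℤ) => ∫ z, ‖cutoffTerm f (heckeEquiv p) z‖ := by
    rw [summable_prod_of_nonneg fun _ => integral_nonneg fun _ => norm_nonneg _]
    exact ⟨fun q => summable_integral_norm_cutoffTerm f (heckeRep q), (hasSum_fintype _).summable⟩
  exact Summable.of_norm_bounded h fun p => norm_integral_le_integral_norm _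

lemma integrableOn_kernelTerm (f : CuspForm 𝒮ℒ k) (A : FixedDetMatrix (Fin 2) ℤ n) :
    IntegrableOn (kernelTerm f A) 𝒟 := by
  obtain ⟨C, -, hC⟩ := exists_norm_kernelTerm_le (n := n) f
  exact IntegrableOn.of_bound volume_fd_ne_top.lt_top
    (continuous_kernelTerm f A).aestronglyMeasurable C (Filter.Eventually.of_forall (hC A))

/-- Group the matrices into left `SL₂(ℤ)`-orbits. Over an orbit the second cut-off sums to `2`, and
the orbit representatives make up `T_n`. -/
lemma tsum_integral_cutoffTerm (f : CuspForm 𝒮ℒ k) :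
    ∑' A : FixedDetMatrix (Fin 2) ℤ n, ∫ z, cutoffTerm f A z =
      2 * ∫ z in 𝒟, petersson k f (heckeOp k n f) z := by
  rw [← heckeEquiv.tsum_eq, (summable_integral_cutoffTerm f).tsum_prod, tsum_fintype]
  have h : ∀ q : HeckeIndex n, ∑' g : SL(2, ℤ), ∫ z, cutoffTerm f (heckeEquiv (q, g)) z =
      2 * ∫ z in 𝒟, kernelTerm f (heckeRep q) z := fun q =>
    (hasSum_integral_cutoffTerm f (heckeRep q)).tsum_eq
  simp_rw [h]
  rw [← Finset.mul_sum, ← integral_finsetSum _ fun q _ => integrableOn_kernelTerm f (heckeRep q)]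
  congr 2
  funext z
  rw [petersson, heckeOp_eq_sum_slash, Finset.mul_sum, Finset.sum_mul]
  rfl

/-- The operator `T_n` is symmetric for the Petersson inner product. -/
lemma conj_integral_petersson_heckeOp (f : CuspForm 𝒮ℒ k) :
    conj (∫ z in 𝒟, petersson k f (heckeOp k n f) z) =
      ∫ z in 𝒟, petersson k f (heckeOp k n f) z := by
  have h := tsum_integral_cutoffTerm (n := n) f
  have h2 := congr_arg (starRingEnd ℂ) h
  -- Reindexing by the adjugate shows that the sum over all matrices equals its own conjugate.
  rw [Complex.conj_tsum, ← adj.tsum_eq] at h2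
  simp_rw [← integral_cutoffTerm_adj] at h2
  rw [h, map_mul, Complex.conj_ofNat] at h2
  exact (mul_left_cancel₀ two_ne_zero h2).symm

/-! ### Positivity of the Petersson norm and reality of the coefficients. -/

lemma integrableOn_Psi (f : CuspForm 𝒮ℒ k) : IntegrableOn (Psi f) 𝒟 := by
  obtain ⟨C, hC⟩ := exists_Psi_le f
  refine IntegrableOn.of_bound volume_fd_ne_top.lt_top
    (continuous_Psi f).aestronglyMeasurable C (Filter.Eventually.of_forall fun z => ?_)
  rw [Real.norm_of_nonneg (Psi_nonneg f z)]
  exact hC z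

/-- If `Ψ` vanished a.e. on `𝒟`, the unfolded series at `σ = 1` would be `0`, but its term `n = 1`
is positive. A possibly infinite coset sum does no harm, as `0 * ∞ = 0` in `ℝ≥0∞`. -/
lemma IsHeckeForm.normSqPet_pos {f : CuspForm 𝒮ℒ k} (hf : IsHeckeForm f) : 0 < normSqPet f := by
  have hk : (0 : ℝ) < k := by exact_mod_cast hf.weight_pos
  refine lt_of_le_of_ne (integral_nonneg fun z => Psi_nonneg f z) fun h0 => ?_
  have hz : Psi f =ᵐ[volume.restrict 𝒟] 0 :=
    (integral_eq_zero_iff_of_nonneg (fun z => Psi_nonneg f z) (integrableOn_Psi f)).mp h0.symm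
  have h := rankinSelberg f (σ := 1) (by linarith)
  rw [lintegral_congr_ae (g := fun _ => 0) (by filter_upwards [hz] with z hz; simp [hz]),
    lintegral_zero, eq_comm, ENNReal.tsum_eq_zero] at h
  have h1 := h 1
  rw [hf.coeff_one, ENNReal.ofReal_eq_zero] at h1
  have : 0 < Real.Gamma (1 + k - 1) / (4 * π * (1 : ℕ)) ^ ((1 : ℝ) + k - 1) :=
    div_pos (Real.Gamma_pos_of_pos (by linarith)) (Real.rpow_pos_of_pos (by simp [Real.pi_pos]) _)
  rw [norm_one, one_pow, one_mul] at h1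
  linarith

/-- Eigenvalues of a symmetric operator are real: `⟨f, T_n f⟩ = a_f(n) ‖f‖²` is real and `‖f‖² ≠ 0`.
-/
lemma IsHeckeForm.conj_fourierCoeff {f : CuspForm 𝒮ℒ k} (hf : IsHeckeForm f) :
    conj (fourierCoeff f n) = fourierCoeff f n := by
  have h := conj_integral_petersson_heckeOp (n := n) f
  have h1 : ∀ z, petersson k f (heckeOp k n f) z = fourierCoeff f n * (Psi f z : ℂ) := fun z => by
    rw [← petersson_self, petersson, petersson, hf.heckeOp_eq (NeZero.one_le)]
    ring
  simp_rw [h1] at h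
  rw [integral_const_mul, integral_complex_ofReal, map_mul, Complex.conj_ofReal] at h
  refine mul_right_cancel₀ ?_ h
  exact_mod_cast hf.normSqPet_pos.ne'

end

section

/-! ### The Rankin–Selberg Dirichlet series -/

open scoped ENNReal Topology

variable {k : ℤ}

/-- Exponential decay at the cusp beats the growth allowed in `exists_norm_eisReg_le`; below a fixed
height, boundedness of `Ψ` suffices. -/
lemma exists_Psi_mul_sq_le (f : CuspForm 𝒮ℒ k) : ∃ C : ℝ, ∀ z, Psi f z * (1 + z.im) ^ 2 ≤ C := by
  obtain ⟨C, hC⟩ := exists_Psi_le f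
  obtain ⟨a, ha, hO⟩ := (CuspFormClass.zero_at_infty f).petersson_exp_decay_left k 𝒮ℒ f
  obtain ⟨C', hC'⟩ := hO.bound
  have hlim : Filter.Tendsto (fun y : ℝ => C' * (Real.exp (-a * y) * (1 + y) ^ 2)) Filter.atTop
      (𝓝 (C' * 0)) := by
    refine Filter.Tendsto.const_mul _ ?_
    have h := fun r : ℝ => tendsto_rpow_mul_exp_neg_mul_atTop_nhds_zero r a ha
    have h' := ((h 0).add ((h 1).const_mul 2)).add (h 2)
    simp only [mul_zero, add_zero, Real.rpow_zero, Real.rpow_one, Real.rpow_two] at h'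
    exact h'.congr fun y => by ring
  have hev : ∀ᶠ y : ℝ in Filter.atTop, C' * (Real.exp (-a * y) * (1 + y) ^ 2) ≤ 1 :=
    (hlim.eventually_le_const (by simp))
  obtain ⟨B, -, hB⟩ := atImInfty_basis.eventually_iff.mp
    (hC'.and (Filter.tendsto_comap.eventually hev))
  have h0 : 0 ≤ C := (Psi_nonneg f I).trans (hC I)
  refine ⟨max 1 (C * (1 + B) ^ 2), fun z => ?_⟩
  by_cases hz : B ≤ z.im
  · obtain ⟨h1, h2⟩ := hB hz
    rw [petersson_self, Complex.norm_real, Real.norm_of_nonneg (Psi_nonneg f z),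
      Real.norm_of_nonneg (Real.exp_pos _).le] at h1
    refine le_max_of_le_left (le_trans ?_ h2)
    rw [← mul_assoc]
    gcongr
  · refine le_max_of_le_right ?_
    have := z.im_pos
    push Not at hz
    gcongr
    exact hC z

/-- The Rankin–Selberg integral of `Ψ` against the continuation of `(s - 1) E(·, s)`. -/
def rankinIntegral (f : CuspForm 𝒮ℒ k) (s : ℂ) : ℂ := ∫ z in 𝒟, (Psi f z : ℂ) * eisReg z s

lemma one_mem_smallDisc : (1 : ℂ) ∈ smallDisc := by simp [smallDisc]

lemma exists_norm_Psi_mul_eisReg_le (f : CuspForm 𝒮ℒ k) :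
    ∃ C : ℝ, ∀ z ∈ 𝒟, ∀ s ∈ smallDisc, ‖(Psi f z : ℂ) * eisReg z s‖ ≤ C := by
  obtain ⟨C, hC⟩ := exists_Psi_mul_sq_le f
  obtain ⟨C', hC'⟩ := exists_norm_eisReg_le
  have h0 : 0 ≤ C' := by
    have h := (norm_nonneg _).trans (hC' _ ModularGroup.I_mem_fd 1 one_mem_smallDisc)
    simp at h
    linarith
  refine ⟨C' * C, fun z hz s hs => ?_⟩
  have h1 := hC' z hz s hs
  rw [norm_mul, Complex.norm_real, Real.norm_of_nonneg (Psi_nonneg f z)]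
  have := Psi_nonneg f z
  calc Psi f z * ‖eisReg z s‖ ≤ Psi f z * (C' * (1 + z.im) ^ 2) := by gcongr
    _ = C' * (Psi f z * (1 + z.im) ^ 2) := by ring
    _ ≤ C' * C := by gcongr; exact hC z

lemma aestronglyMeasurable_Psi_mul_eisReg (f : CuspForm 𝒮ℒ k) {s : ℂ} (hs : s ∈ smallDisc) :
    AEStronglyMeasurable (fun z => (Psi f z : ℂ) * eisReg z s) (volume.restrict 𝒟) :=
  ContinuousOn.aestronglyMeasurable ((Complex.continuous_ofReal.comp
    (continuous_Psi f)).continuousOn.mul (continuousOn_eisReg (smallDisc_subset hs))) measurableSet_fd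

lemma integrableOn_Psi_mul_eisReg (f : CuspForm 𝒮ℒ k) {s : ℂ} (hs : s ∈ smallDisc) :
    IntegrableOn (fun z => (Psi f z : ℂ) * eisReg z s) 𝒟 := by
  obtain ⟨C, hC⟩ := exists_norm_Psi_mul_eisReg_le f
  refine IntegrableOn.of_bound volume_fd_ne_top.lt_top
    (aestronglyMeasurable_Psi_mul_eisReg f hs) C ?_
  filter_upwards [ae_restrict_mem measurableSet_fd] with z hz using hC z hz s hs

/-- At `s = 1` the derivative is the pairing sought, since `Ẽ(z, 1)` is the derivative of `eisReg z`
there. -/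
lemma hasDerivAt_rankinIntegral (f : CuspForm 𝒮ℒ k) {s : ℂ} (hs : s ∈ smallDisc) :
    IntegrableOn (fun z => (Psi f z : ℂ) * deriv (eisReg z) s) 𝒟 ∧
      HasDerivAt (rankinIntegral f) (∫ z in 𝒟, (Psi f z : ℂ) * deriv (eisReg z) s) s := by
  obtain ⟨C, hC⟩ := exists_norm_Psi_mul_eisReg_le f
  have h := hasDerivAt_integral_of_norm_le (μ := volume.restrict 𝒟)
    (F := fun s z => (Psi f z : ℂ) * eisReg z s) (U := smallDisc) Metric.isOpen_ball
    (g := fun _ => C) (integrableOn_const volume_fd_ne_top)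
    (fun s hs => aestronglyMeasurable_Psi_mul_eisReg f hs)
    (Filter.Eventually.of_forall fun z =>
      ((differentiableOn_eisReg z).mono smallDisc_subset).const_mul _)
    (by filter_upwards [ae_restrict_mem measurableSet_fd] with z hz using hC z hz) hs
  have hd : ∀ z, deriv (fun s => (Psi f z : ℂ) * eisReg z s) s = (Psi f z : ℂ) * deriv (eisReg z) s :=
    fun z => deriv_const_mul _ ((differentiableOn_eisReg z).differentiableAt
      (Metric.isOpen_ball.mem_nhds (smallDisc_subset hs)))
  simp_rw [hd] at h
  exact h

lemma differentiableOn_rankinIntegral (f : CuspForm 𝒮ℒ k) :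
    DifferentiableOn ℂ (rankinIntegral f) smallDisc := fun _ hs =>
  (hasDerivAt_rankinIntegral f hs).2.differentiableAt.differentiableWithinAt

lemma rankinIntegral_one (f : CuspForm 𝒮ℒ k) : rankinIntegral f 1 = (normSqPet f : ℂ) / vol := by
  simp only [rankinIntegral, eisReg_one]
  rw [integral_mul_const, integral_complex_ofReal, normSqPet, vol_eq]
  have := Complex.ofReal_ne_zero.mpr Real.pi_ne_zero
  push_cast
  field_simp

/-! ### From the integral to the Dirichlet series `∑ λ_f(n)² n^(-s)`. -/

lemma IsHeckeForm.heckeEig_sq {f : CuspForm 𝒮ℒ k} (hf : IsHeckeForm f) {n : ℕ} (hn : n ≠ 0) :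
    heckeEig f n ^ 2 = ((‖fourierCoeff f n‖ ^ 2 / (n : ℝ) ^ (k - 1) : ℝ) : ℂ) := by
  have : NeZero n := ⟨hn⟩
  rw [heckeEig, div_pow, ← Complex.cpow_nat_mul]
  have h1 : ((2 : ℕ) : ℂ) * (((k : ℂ) - 1) / 2) = ((k - 1 : ℤ) : ℂ) := by push_cast; ring
  rw [h1, Complex.cpow_intCast]
  push_cast
  rw [← Complex.mul_conj', hf.conj_fourierCoeff, sq]

/-- The archimedean factor `(4π)^(-(s+k-1)) Γ(s+k-1)`. -/
def gammaFactor (k : ℤ) (s : ℂ) : ℂ := (4 * π : ℂ) ^ (-(s + k - 1)) * Complex.Gamma (s + k - 1)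

lemma IsHeckeForm.rankinSelberg_term {f : CuspForm 𝒮ℒ k} (hf : IsHeckeForm f) {σ : ℝ} (n : ℕ) :
    ((‖fourierCoeff f n‖ ^ 2 * (Real.Gamma (σ + k - 1) / (4 * π * n) ^ (σ + k - 1)) : ℝ) : ℂ) =
      gammaFactor k σ * LSeries.term (fun n => heckeEig f n ^ 2) σ n := by
  rcases eq_or_ne n 0 with rfl | hn
  · simp [fourierCoeff_zero]
  have hn0 : (0 : ℝ) < n := by exact_mod_cast Nat.pos_of_ne_zero hn
  have h4 : (0 : ℝ) < 4 * π := by positivity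
  have hg : gammaFactor k σ = ((Real.Gamma (σ + k - 1) / (4 * π) ^ (σ + k - 1) : ℝ) : ℂ) := by
    rw [gammaFactor, div_eq_mul_inv, ← Real.rpow_neg h4.le, mul_comm, Complex.ofReal_mul,
      Complex.ofReal_cpow h4.le, ← Complex.Gamma_ofReal]
    push_cast
    rfl
  rw [LSeries.term_of_ne_zero hn, hf.heckeEig_sq hn, hg, ← Complex.ofReal_natCast n,
    ← Complex.ofReal_cpow hn0.le, ← Complex.ofReal_div, ← Complex.ofReal_mul]
  congr 1
  rw [Real.mul_rpow h4.le hn0.le, add_sub_assoc, Real.rpow_add hn0,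
    show ((k : ℝ) - 1) = ((k - 1 : ℤ) : ℝ) by push_cast; ring, Real.rpow_intCast]
  field_simp

lemma eisenstein_ofReal (z : ℍ) (σ : ℝ) :
    eisenstein z σ = ((∑' c, cosetIm z c ^ σ : ℝ) : ℂ) := by
  rw [eisenstein, Complex.ofReal_tsum]
  refine tsum_congr fun c => ?_
  rw [Complex.ofReal_cpow (cosetIm_pos z c).le]

lemma summable_cosetIm_rpow (z : ℍ) {σ : ℝ} (hσ : 1 < σ) : Summable fun c => cosetIm z c ^ σ := by
  have h := summable_cosetIm_cpow z (s := σ) (by simpa using hσ)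
  rw [← Complex.summable_ofReal]
  refine h.congr fun c => ?_
  rw [Complex.ofReal_cpow (cosetIm_pos z c).le]

lemma ofReal_mem_smallDisc {σ : ℝ} (h1 : 1 < σ) (h2 : σ < 9 / 8) : (σ : ℂ) ∈ smallDisc := by
  rw [smallDisc, Metric.mem_ball, ← Complex.ofReal_one, Complex.dist_eq, ← Complex.ofReal_sub,
    Complex.norm_real, Real.norm_of_nonneg (by linarith)]
  linarith

/-- The Rankin–Selberg identity for real `s` to the right of `1`. -/
lemma IsHeckeForm.hasSum_rankinSelberg {f : CuspForm 𝒮ℒ k} (hf : IsHeckeForm f) {σ : ℝ}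
    (h1 : 1 < σ) (h2 : σ < 9 / 8) :
    HasSum (fun n => gammaFactor k σ * LSeries.term (fun n => heckeEig f n ^ 2) σ n)
      (rankinIntegral f σ / (σ - 1)) := by
  have hs := ofReal_mem_smallDisc h1 h2
  have hk : (0 : ℝ) < k := by exact_mod_cast hf.weight_pos
  have hσ1 : (σ : ℂ) - 1 ≠ 0 := by
    rw [← Complex.ofReal_one, ← Complex.ofReal_sub]
    exact_mod_cast (sub_pos.mpr h1).ne'
  set u : ℍ → ℝ := fun z => Psi f z * ∑' c, cosetIm z c ^ σ with hu
  have hE0 : ∀ z, 0 ≤ ∑' c, cosetIm z c ^ σ := fun z =>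
    tsum_nonneg fun c => Real.rpow_nonneg (cosetIm_pos z c).le _
  have hu0 : ∀ z, 0 ≤ u z := fun z => mul_nonneg (Psi_nonneg f z) (hE0 z)
  have hueq : ∀ z, (u z : ℂ) = (Psi f z : ℂ) * eisReg z σ / (σ - 1) := fun z => by
    rw [eisReg_eq z (smallDisc_subset hs) (by simpa using h1), eisenstein_ofReal]
    simp only [hu]
    push_cast
    field_simp
  have hInt : IntegrableOn u 𝒟 := by
    have h : IntegrableOn (fun z => (u z : ℂ)) 𝒟 := by
      simp_rw [hueq]
      exact (integrableOn_Psi_mul_eisReg f hs).div_const _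
    exact h.re
  have hval : ((∫ z in 𝒟, u z : ℝ) : ℂ) = rankinIntegral f σ / (σ - 1) := by
    rw [← integral_complex_ofReal]
    simp_rw [hueq]
    rw [integral_div, rankinIntegral]
  have hRS := rankinSelberg f (σ := σ) (by linarith)
  have hL : ∫⁻ z in 𝒟, ENNReal.ofReal (Psi f z) * ∑' c : Cosets, ENNReal.ofReal (cosetIm z c ^ σ) =
      ENNReal.ofReal (∫ z in 𝒟, u z) := by
    rw [ofReal_integral_eq_lintegral_ofReal hInt (Filter.Eventually.of_forall hu0)]
    refine lintegral_congr fun z => ?_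
    rw [← ENNReal.ofReal_tsum_of_nonneg (fun c => Real.rpow_nonneg (cosetIm_pos z c).le _)
      (summable_cosetIm_rpow z h1), ← ENNReal.ofReal_mul (Psi_nonneg f z)]
  rw [hL] at hRS
  set v : ℕ → ℝ := fun n => ‖fourierCoeff f n‖ ^ 2 * (Real.Gamma (σ + k - 1) / (4 * π * n) ^ (σ + k - 1))
    with hv
  have hv0 : ∀ n, 0 ≤ v n := fun n => by
    have := Real.Gamma_pos_of_pos (show 0 < σ + k - 1 by linarith)
    simp only [hv]
    positivity
  -- Convergence is an output: the `ℝ≥0∞`-valued sum equals a finite integral.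
  have hvs : Summable v := by
    have h := ENNReal.summable_toReal (f := fun n => ENNReal.ofReal (v n))
      (by rw [← hRS]; exact ENNReal.ofReal_ne_top)
    exact h.congr fun n => ENNReal.toReal_ofReal (hv0 n)
  rw [← ENNReal.ofReal_tsum_of_nonneg hv0 hvs,
    ENNReal.ofReal_eq_ofReal_iff (integral_nonneg hu0) (tsum_nonneg hv0)] at hRS
  rw [← hval, hRS]
  exact (Complex.hasSum_ofReal.mpr hvs.hasSum).congr_fun fun n => (hf.rankinSelberg_term n).symm

lemma gammaFactor_ne_zero {k : ℤ} {s : ℂ} (h : 0 < (s + k - 1).re) : gammaFactor k s ≠ 0 :=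
  mul_ne_zero (by simp [Complex.cpow_eq_zero_iff, Real.pi_ne_zero]) (Complex.Gamma_ne_zero_of_re_pos h)

lemma differentiableAt_gammaFactor {k : ℤ} {s : ℂ} (h : 0 < (s + k - 1).re) :
    DifferentiableAt ℂ (gammaFactor k) s := by
  unfold gammaFactor
  refine DifferentiableAt.mul ?_ ?_
  · refine DifferentiableAt.const_cpow (by fun_prop) (Or.inl ?_)
    simp [Real.pi_ne_zero]
  · refine DifferentiableAt.comp (g := Complex.Gamma) s
      (Complex.differentiableAt_Gamma _ fun m hm => ?_) (by fun_prop)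
    rw [hm] at h
    simp at h
    have : (0 : ℝ) ≤ m := m.cast_nonneg
    linarith

/-- Convergence at a real `σ` with `1 < σ < min (Re s, 9/8)` comes from unfolding and passes to the
right. No bound on `λ_f` enters. -/
lemma IsHeckeForm.lseriesSummable {f : CuspForm 𝒮ℒ k} (hf : IsHeckeForm f) {s : ℂ}
    (hs : 1 < s.re) : LSeriesSummable (fun n => heckeEig f n ^ 2) s := by
  have hk : (0 : ℝ) < k := by exact_mod_cast hf.weight_pos
  obtain ⟨σ, h1, h2⟩ := exists_between (lt_min hs (show (1 : ℝ) < 9 / 8 by norm_num))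
  rw [lt_min_iff] at h2
  refine LSeriesSummable.of_re_le_re (s := σ) (by simpa using h2.1.le) ?_
  have h := (hf.hasSum_rankinSelberg h1 h2.2).summable
  rwa [summable_mul_left_iff (gammaFactor_ne_zero (by simp; linarith))] at h

/-- The Rankin–Selberg identity to the right of `1`. -/
lemma IsHeckeForm.rankinIntegral_eq {f : CuspForm 𝒮ℒ k} (hf : IsHeckeForm f) {s : ℂ}
    (hs : s ∈ smallDisc) (hs1 : 1 < s.re) :
    rankinIntegral f s = (s - 1) * gammaFactor k s * LSeries (fun n => heckeEig f n ^ 2) s := by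
  have hk : (0 : ℝ) < k := by exact_mod_cast hf.weight_pos
  set U : Set ℂ := smallDisc ∩ {s | 1 < s.re} with hU
  have hUo : IsOpen U := Metric.isOpen_ball.inter (isOpen_lt continuous_const Complex.continuous_re)
  have hUc : IsPreconnected U :=
    ((convex_ball _ _).inter (convex_halfSpace_re_gt 1)).isPreconnected
  have ha1 : AnalyticOnNhd ℂ (rankinIntegral f) U :=
    ((differentiableOn_rankinIntegral f).mono Set.inter_subset_left).analyticOnNhd hUo
  have hab : LSeries.abscissaOfAbsConv (fun n => heckeEig f n ^ 2) ≤ (1 : ℝ) :=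
    LSeries.abscissaOfAbsConv_le_of_forall_lt_LSeriesSummable fun y hy =>
      hf.lseriesSummable (by simpa using hy)
  have ha2 : AnalyticOnNhd ℂ
      (fun s => (s - 1) * gammaFactor k s * LSeries (fun n => heckeEig f n ^ 2) s) U := by
    refine AnalyticOnNhd.mul (DifferentiableOn.analyticOnNhd (fun s hs => ?_) hUo)
      ((LSeries_analyticOnNhd _).mono fun s hs => hab.trans_lt (EReal.coe_lt_coe_iff.mpr hs.2))
    have h1 : 1 < s.re := hs.2
    exact ((differentiableAt_id.sub_const 1).mul
      (differentiableAt_gammaFactor (by simp; linarith))).differentiableWithinAt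
  have hreal : ∀ σ : ℝ, 1 < σ → σ < 9 / 8 →
      rankinIntegral f σ = (σ - 1) * gammaFactor k σ * LSeries (fun n => heckeEig f n ^ 2) σ := by
    intro σ h1 h2
    have hσ1 : (σ : ℂ) - 1 ≠ 0 := by
      rw [← Complex.ofReal_one, ← Complex.ofReal_sub]
      exact_mod_cast (sub_pos.mpr h1).ne'
    have h := (hf.hasSum_rankinSelberg h1 h2).tsum_eq
    rw [tsum_mul_left] at h
    change gammaFactor k σ * LSeries (fun n => heckeEig f n ^ 2) σ = _ at h
    rw [mul_assoc, h]
    field_simp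
  -- The midpoint of `(1, 9/8)`; agreement on that real interval spreads to all of `U`.
  set σ₀ : ℝ := 17 / 16 with hσ₀
  have hmem : (σ₀ : ℂ) ∈ U := ⟨ofReal_mem_smallDisc (by norm_num) (by norm_num), by
    simp [hσ₀]; norm_num⟩
  refine ha1.eqOn_of_preconnected_of_frequently_eq ha2 hUc hmem ?_ ⟨hs, hs1⟩
  have htend : Filter.Tendsto (fun x : ℝ => (x : ℂ)) (𝓝[≠] σ₀) (𝓝[≠] (σ₀ : ℂ)) :=
    tendsto_nhdsWithin_iff.mpr ⟨(Complex.continuous_ofReal.tendsto _).mono_left nhdsWithin_le_nhds,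
      by filter_upwards [self_mem_nhdsWithin] with x hx; simpa using hx⟩
  refine htend.frequently (Filter.Eventually.frequently ?_)
  filter_upwards [nhdsWithin_le_nhds (Ioo_mem_nhds (show (1 : ℝ) < σ₀ by norm_num)
    (show σ₀ < 9 / 8 by norm_num))] with x hx using hreal x hx.1 hx.2

end

section

/-! ### The Euler product of the symmetric square -/

open scoped Topology

variable {k : ℤ} {f : CuspForm 𝒮ℒ k}

lemma IsHeckeForm.heckeEig_one (hf : IsHeckeForm f) : heckeEig f 1 = 1 := by
  simp [heckeEig, hf.coeff_one]

lemma heckeEig_zero (f : CuspForm 𝒮ℒ k) : heckeEig f 0 = 0 := by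
  simp [heckeEig, fourierCoeff_zero]

lemma IsHeckeForm.heckeEig_mul (hf : IsHeckeForm f) {m n : ℕ} (h : m.Coprime n) :
    heckeEig f (m * n) = heckeEig f m * heckeEig f n := by
  rcases eq_or_ne m 0 with rfl | hm
  · simp [heckeEig_zero]
  rcases eq_or_ne n 0 with rfl | hn
  · simp [heckeEig_zero]
  rw [heckeEig, heckeEig, heckeEig, hf.fourierCoeff_mul_of_coprime h, Nat.cast_mul,
    Complex.natCast_mul_natCast_cpow, mul_div_mul_comm]

lemma natCast_pow_cpow (p e : ℕ) (s : ℂ) : ((p ^ e : ℕ) : ℂ) ^ s = ((p : ℂ) ^ s) ^ e := by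
  induction e with
  | zero => simp
  | succ e ih => rw [pow_succ, Nat.cast_mul, Complex.natCast_mul_natCast_cpow, ih, pow_succ]

lemma IsHeckeForm.heckeEig_prime_pow (hf : IsHeckeForm f) {p : ℕ} (hp : p.Prime) (e : ℕ) :
    heckeEig f (p ^ (e + 2)) = heckeEig f p * heckeEig f (p ^ (e + 1)) - heckeEig f (p ^ e) := by
  have hp0 : (p : ℂ) ≠ 0 := by exact_mod_cast hp.ne_zero
  have h := hf.fourierCoeff_prime_pow hp e
  have hw : ((p : ℂ) ^ (((k : ℂ) - 1) / 2)) ^ 2 = (p : ℂ) ^ (k - 1) := by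
    rw [← Complex.cpow_nat_mul, ← Complex.cpow_intCast]
    congr 1
    push_cast; ring
  have hw0 : (p : ℂ) ^ (((k : ℂ) - 1) / 2) ≠ 0 := by simp [Complex.cpow_eq_zero_iff, hp0]
  simp only [heckeEig, natCast_pow_cpow]
  set w := (p : ℂ) ^ (((k : ℂ) - 1) / 2)
  rw [← hw] at h
  field_simp
  linear_combination -(w ^ 2 * w ^ (e * 2)) * h

/-- If `α + β = l` and `α β = 1`, the squares `u_e²` obey the third-order recurrence with roots
`α²`, `1`, `β²`. Its symmetric functions are `l² - 1`, `l² - 1`, `1`, and the initial values leave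
the numerator `1 + X`. -/
lemma tsum_sq_recurrence {u : ℕ → ℂ} {l X : ℂ} (h0 : u 0 = 1) (h1 : u 1 = l)
    (hu : ∀ e, u (e + 2) = l * u (e + 1) - u e) (hs : Summable fun e => u e ^ 2 * X ^ e) :
    (∑' e, u e ^ 2 * X ^ e) * ((1 - X) * (1 - (l ^ 2 - 2) * X + X ^ 2)) = 1 + X := by
  -- Summability of the shifted series is obtained by dividing by `X ^ j`.
  rcases eq_or_ne X 0 with rfl | hX
  · rw [tsum_eq_single 0 fun e he => by simp [he]]
    simp [h0]
  have hsum : ∀ j, Summable fun e => u (e + j) ^ 2 * X ^ e := fun j => by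
    have h := ((summable_nat_add_iff j).mpr hs).mul_right (X ^ j)⁻¹
    refine h.congr fun e => ?_
    rw [pow_add]
    field_simp
  have hstep : ∀ j, ∑' e, u (e + j) ^ 2 * X ^ e =
      u j ^ 2 + X * ∑' e, u (e + (j + 1)) ^ 2 * X ^ e := fun j => by
    rw [(hsum j).tsum_eq_zero_add, ← tsum_mul_left]
    simp only [zero_add, pow_zero, mul_one]
    congr 1
    refine tsum_congr fun e => ?_
    rw [pow_succ, show e + 1 + j = e + (j + 1) by ring]
    ring
  have h3 : ∑' e, u (e + 3) ^ 2 * X ^ e = (l ^ 2 - 1) * ∑' e, u (e + 2) ^ 2 * X ^ e -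
      (l ^ 2 - 1) * ∑' e, u (e + 1) ^ 2 * X ^ e + ∑' e, u (e + 0) ^ 2 * X ^ e := by
    rw [← tsum_mul_left, ← tsum_mul_left, ← ((hsum 2).mul_left _).tsum_sub ((hsum 1).mul_left _),
      ← (((hsum 2).mul_left _).sub ((hsum 1).mul_left _)).tsum_add (hsum 0)]
    refine tsum_congr fun e => ?_
    rw [show e + 3 = (e + 1) + 2 by ring, hu (e + 1), hu e, add_zero]
    ring
  have e0 := hstep 0
  have e1 := hstep 1
  have e2 := hstep 2
  have hu2 : u 2 = l ^ 2 - 1 := by rw [hu 0, zero_add, h1, h0]; ring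
  simp only [zero_add, Nat.reduceAdd, h0, h1, hu2, add_zero] at e0 e1 e2 h3
  set S0 := ∑' e, u e ^ 2 * X ^ e
  set S1 := ∑' e, u (e + 1) ^ 2 * X ^ e
  set S2 := ∑' e, u (e + 2) ^ 2 * X ^ e
  set S3 := ∑' e, u (e + 3) ^ 2 * X ^ e
  linear_combination (1 - (l ^ 2 - 1) * X + (l ^ 2 - 1) * X ^ 2) * e0 +
    (X - (l ^ 2 - 1) * X ^ 2) * e1 + X ^ 2 * e2 + X ^ 3 * h3

lemma satakeA_add_satakeB (f : CuspForm 𝒮ℒ k) (p : ℕ) :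
    satakeA f p + satakeB f p = heckeEig f p := by
  rw [satakeA, satakeB]; ring

lemma satakeA_mul_satakeB (f : CuspForm 𝒮ℒ k) (p : ℕ) : satakeA f p * satakeB f p = 1 := by
  have h : ((heckeEig f p ^ 2 - 4) ^ (1 / 2 : ℂ)) ^ 2 = heckeEig f p ^ 2 - 4 := by
    rw [← Complex.cpow_mul_nat]; simp
  rw [satakeA, satakeB]
  linear_combination -(1 / 4 : ℂ) * h

lemma IsHeckeForm.term_mul (hf : IsHeckeForm f) (s : ℂ) {m n : ℕ} (h : m.Coprime n) :
    LSeries.term (fun n => heckeEig f n ^ 2) s (m * n) =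
      LSeries.term (fun n => heckeEig f n ^ 2) s m * LSeries.term (fun n => heckeEig f n ^ 2) s n := by
  rcases eq_or_ne m 0 with rfl | hm
  · simp
  rcases eq_or_ne n 0 with rfl | hn
  · simp
  rw [LSeries.term_of_ne_zero (mul_ne_zero hm hn), LSeries.term_of_ne_zero hm,
    LSeries.term_of_ne_zero hn, hf.heckeEig_mul h, Nat.cast_mul, Complex.natCast_mul_natCast_cpow,
    mul_pow, mul_div_mul_comm]

lemma term_prime_pow (f : CuspForm 𝒮ℒ k) (s : ℂ) {p : ℕ} (hp : p.Prime) (e : ℕ) :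
    LSeries.term (fun n => heckeEig f n ^ 2) s (p ^ e) =
      heckeEig f (p ^ e) ^ 2 * ((p : ℂ) ^ (-s)) ^ e := by
  rw [LSeries.term_of_ne_zero (pow_ne_zero e hp.ne_zero), natCast_pow_cpow, Complex.cpow_neg, inv_pow,
    div_eq_mul_inv]

lemma norm_prime_cpow_lt_one {p : ℕ} (hp : p.Prime) {s : ℂ} (hs : 0 < s.re) :
    ‖(p : ℂ) ^ (-s)‖ < 1 := by
  rw [Complex.norm_natCast_cpow_of_pos hp.pos, Complex.neg_re]
  exact Real.rpow_lt_one_of_one_lt_of_neg (by exact_mod_cast hp.one_lt) (by linarith)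

/-- The numerator `1 + X = (1 - X²) / (1 - X)` is the local factor of `ζ(s) / ζ(2s)`. -/
lemma IsHeckeForm.symSqFactor_eq (hf : IsHeckeForm f) {s : ℂ} (hs : 1 < s.re) (p : Nat.Primes) :
    symSqFactor f s p = (∑' e, LSeries.term (fun n => heckeEig f n ^ 2) s ((p : ℕ) ^ e)) /
      (1 - (p : ℂ) ^ (-s))⁻¹ * (1 - (p : ℂ) ^ (-(2 * s)))⁻¹ := by
  have hp := p.2
  set X := (p : ℂ) ^ (-s) with hX
  have hX1 : ‖X‖ < 1 := norm_prime_cpow_lt_one hp (by linarith)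
  have hXX : (p : ℂ) ^ (-(2 * s)) = X ^ 2 := by
    rw [hX, ← Complex.cpow_nat_mul]; congr 1; push_cast; ring
  have hm : 1 - X ≠ 0 := fun h => by
    rw [sub_eq_zero] at h; rw [← h] at hX1; simp at hX1
  have hpl : 1 + X ≠ 0 := fun h => by
    rw [add_eq_zero_iff_eq_neg, eq_comm, neg_eq_iff_eq_neg] at h
    rw [h] at hX1; simp at hX1
  simp_rw [term_prime_pow f s hp, ← hX]
  have hsum : Summable fun e => heckeEig f ((p : ℕ) ^ e) ^ 2 * X ^ e := by
    have h := (hf.lseriesSummable hs).comp_injective (Nat.pow_right_injective hp.two_le)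
    exact h.congr fun e => term_prime_pow f s hp e
  have key := tsum_sq_recurrence (u := fun e => heckeEig f ((p : ℕ) ^ e)) (l := heckeEig f p)
    (by simpa using hf.heckeEig_one) (by simp) (hf.heckeEig_prime_pow hp) hsum
  have hfac : symSqFactor f s p = ((1 - X) * (1 - (heckeEig f p ^ 2 - 2) * X + X ^ 2))⁻¹ := by
    rw [symSqFactor, ← hX, ← satakeA_add_satakeB]
    have h := satakeA_mul_satakeB f p
    congr 1
    rw [h]
    linear_combination (1 - X) * (2 * X + X ^ 2 * (satakeA f p * satakeB f p + 1)) * h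
  -- The denominator is nonzero because its product with a convergent sum is `1 + X ≠ 0`; no bound
  -- on the Satake parameters is needed.
  have hne : (1 - X) * (1 - (heckeEig f p ^ 2 - 2) * X + X ^ 2) ≠ 0 := fun h => by
    rw [h, mul_zero] at key
    exact hpl key.symm
  have h2 : 1 - X ^ 2 ≠ 0 := by
    rw [show 1 - X ^ 2 = (1 - X) * (1 + X) by ring]
    exact mul_ne_zero hm hpl
  rw [hfac, hXX, div_inv_eq_mul, eq_comm, ← div_eq_mul_inv, div_eq_iff h2, eq_comm,
    inv_mul_eq_iff_eq_mul₀ hne]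
  linear_combination -(1 - X) * key

/-- The Euler product of `L(sym² f, s)` in terms of the Rankin–Selberg Dirichlet series. -/
lemma IsHeckeForm.hasProd_symSqFactor (hf : IsHeckeForm f) {s : ℂ} (hs : 1 < s.re) :
    HasProd (fun p : Nat.Primes => symSqFactor f s p)
      (LSeries (fun n => heckeEig f n ^ 2) s / riemannZeta s * riemannZeta (2 * s)) := by
  have h1 := EulerProduct.eulerProduct_hasProd (f := LSeries.term (fun n => heckeEig f n ^ 2) s)
    (by simp [LSeries.term_of_ne_zero, hf.heckeEig_one]) (hf.term_mul s) (hf.lseriesSummable hs).norm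
    (LSeries.term_zero _ _)
  have h2 := riemannZeta_eulerProduct_hasProd hs
  have h3 := riemannZeta_eulerProduct_hasProd (s := 2 * s) (by simp; linarith)
  have h := (h1.div₀ h2 (riemannZeta_ne_zero_of_one_le_re hs.le)).mul h3
  rw [funext (hf.symSqFactor_eq hs)]
  exact h

end

section

/-! ### Values at `s = 1` -/

open scoped Topology

variable {k : ℤ} {f : CuspForm 𝒮ℒ k}

/-- As `eisReg z 1 = 3 / π = 1 / V`, subtracting the polar part makes `Ẽ` the difference quotient of
`eisReg z` at `1`, which extends analytically by `dslope`. -/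
lemma regEisenstein_spec (z : ℍ) : (∃ g, IsContinuation (regEisensteinSeries z) g) ∧
    regEisenstein z 1 = deriv (eisReg z) 1 := by
  have hnhds : disc ∈ 𝓝 (1 : ℂ) := Metric.isOpen_ball.mem_nhds one_mem_disc
  have hG : AnalyticAt ℂ (dslope (eisReg z) 1) 1 :=
    ((Complex.differentiableOn_dslope hnhds).mpr (differentiableOn_eisReg z)).analyticAt hnhds
  have h : ∀ᶠ s in 𝓝 (1 : ℂ), 1 < s.re → dslope (eisReg z) 1 s = regEisensteinSeries z s := by
    filter_upwards [hnhds] with s hs hs1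
    have hne : s ≠ 1 := by rintro rfl; simp at hs1
    have hne' : s - 1 ≠ 0 := sub_ne_zero.mpr hne
    have hπ := Complex.ofReal_ne_zero.mpr Real.pi_ne_zero
    rw [dslope_of_ne _ hne, slope_def_field, eisReg_one, eisReg_eq z hs hs1, regEisensteinSeries, vol_eq]
    push_cast
    field_simp
  obtain ⟨h1, h2⟩ := continuation_spec hG h
  exact ⟨h1, by rw [regEisenstein, h2.eq_of_nhds, dslope_same]⟩

/-- The derivative is a limit of difference quotients at real `x > 1`, where `E(z, x)` is real. -/
lemma conj_deriv_eisReg_one (z : ℍ) : conj (deriv (eisReg z) 1) = deriv (eisReg z) 1 := by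
  have hnhds : disc ∈ 𝓝 (1 : ℂ) := Metric.isOpen_ball.mem_nhds one_mem_disc
  have hd := ((differentiableOn_eisReg z).differentiableAt hnhds).hasDerivAt
  have htend : Filter.Tendsto (fun x : ℝ => (x : ℂ)) (𝓝[>] 1) (𝓝[≠] (1 : ℂ)) := by
    refine tendsto_nhdsWithin_iff.mpr ⟨?_, ?_⟩
    · exact ((Complex.continuous_ofReal.tendsto' 1 1 (by simp)).mono_left nhdsWithin_le_nhds)
    · filter_upwards [self_mem_nhdsWithin] with x hx
      have : (1 : ℝ) < x := hx
      simpa using this.ne'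
  have hl := (hasDerivAt_iff_tendsto_slope.mp hd).comp htend
  have him := (Complex.continuous_im.tendsto _).comp hl
  have hz : (deriv (eisReg z) 1).im = 0 := by
    refine tendsto_nhds_unique him (tendsto_const_nhds.congr' ?_)
    filter_upwards [Ioo_mem_nhdsGT (show (1 : ℝ) < 9 / 8 by norm_num)] with x hx
    simp only [Function.comp_apply]
    rw [slope_def_field, eisReg_one, eisReg_eq z (smallDisc_subset (ofReal_mem_smallDisc hx.1 hx.2))
      (by simpa using hx.1), eisenstein_ofReal]
    have : ((x : ℂ) - 1) * ((∑' c, cosetIm z c ^ x : ℝ) : ℂ) - 3 / π =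
      (((x - 1) * (∑' c, cosetIm z c ^ x) - 3 / π : ℝ) : ℂ) := by push_cast; ring
    rw [this, show (x : ℂ) - 1 = ((x - 1 : ℝ) : ℂ) by push_cast; ring, ← Complex.ofReal_div,
      Complex.ofReal_im]
  exact Complex.conj_eq_iff_im.mpr hz

/-- `ζ(2s) H(s) / ((s - 1) ζ(s))`, where `H` is the Rankin–Selberg integral; this is `Λ(sym² f, s)`
near `s = 1`. -/
def completedSymSq (f : CuspForm 𝒮ℒ k) (s : ℂ) : ℂ :=
  riemannZeta (2 * s) * rankinIntegral f s / zetaReg s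

lemma hasDerivAt_zeta_two_mul :
    HasDerivAt (fun s : ℂ => riemannZeta (2 * s)) (deriv riemannZeta 2 * 2) 1 := by
  have h := (differentiableAt_riemannZeta (s := 2) (by norm_num)).hasDerivAt
  exact HasDerivAt.comp (h₂ := riemannZeta) (1 : ℂ) (by simpa using h)
    (by simpa using (hasDerivAt_id (1 : ℂ)).const_mul 2)

lemma analyticAt_completedSymSq (f : CuspForm 𝒮ℒ k) : AnalyticAt ℂ (completedSymSq f) 1 := by
  have hnhds : smallDisc ∈ 𝓝 (1 : ℂ) := Metric.isOpen_ball.mem_nhds one_mem_smallDisc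
  refine ((((differentiableOn_zeta_two_mul).analyticAt
    (Metric.isOpen_ball.mem_nhds one_mem_disc)).mul
    ((differentiableOn_rankinIntegral f).analyticAt hnhds)).div (analyticAt_zetaReg 1) ?_)
  rw [zetaReg_one]
  exact one_ne_zero

lemma IsHeckeForm.weight_re_pos (hf : IsHeckeForm f) : 0 < ((1 : ℂ) + k - 1).re := by
  have hk : (0 : ℝ) < k := by exact_mod_cast hf.weight_pos
  simpa using hk

lemma IsHeckeForm.eventually_re_pos (hf : IsHeckeForm f) :
    ∀ᶠ s : ℂ in 𝓝 1, 0 < (s + k - 1).re :=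
  continuousAt_const.eventually_lt (by fun_prop) hf.weight_re_pos

/-- `completedSymSq` is analytic at `1` by construction, so divided by the nonvanishing gamma factor
it continues the Euler product. -/
lemma IsHeckeForm.symSq_spec (hf : IsHeckeForm f) :
    (∃ g, IsContinuation (symSqEulerProduct f) g) ∧ symSqLambda f =ᶠ[𝓝 1] completedSymSq f := by
  have hnhds : smallDisc ∈ 𝓝 (1 : ℂ) := Metric.isOpen_ball.mem_nhds one_mem_smallDisc
  have hγ : AnalyticAt ℂ (gammaFactor k) 1 := by
    rw [Complex.analyticAt_iff_eventually_differentiableAt]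
    filter_upwards [hf.eventually_re_pos] with s hs using differentiableAt_gammaFactor hs
  have hG : AnalyticAt ℂ (fun s => completedSymSq f s / gammaFactor k s) 1 :=
    (analyticAt_completedSymSq f).div hγ (gammaFactor_ne_zero hf.weight_re_pos)
  have h : ∀ᶠ s in 𝓝 (1 : ℂ), 1 < s.re →
      completedSymSq f s / gammaFactor k s = symSqEulerProduct f s := by
    filter_upwards [hnhds, hf.eventually_re_pos] with s hs hγs hs1
    have hne : s ≠ 1 := by rintro rfl; simp at hs1
    have h1 : s - 1 ≠ 0 := sub_ne_zero.mpr hne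
    have h2 := gammaFactor_ne_zero hγs
    have h3 := riemannZeta_ne_zero_of_one_le_re hs1.le
    rw [symSqEulerProduct, (hf.hasProd_symSqFactor hs1).tprod_eq, completedSymSq,
      hf.rankinIntegral_eq hs hs1, zetaReg_of_ne hne]
    field_simp
  obtain ⟨h1, h2⟩ := continuation_spec hG h
  refine ⟨h1, ?_⟩
  filter_upwards [h2, hf.eventually_re_pos] with s hs hγs
  have hne := gammaFactor_ne_zero hγs
  rw [symSqLambda, symSqL, hs, ← gammaFactor]
  field_simp

/-- Quotient rule, with denominator of value `1` and derivative `γ` at `s = 1`. -/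
lemma hasDerivAt_completedSymSq (f : CuspForm 𝒮ℒ k) : HasDerivAt (completedSymSq f)
    (deriv riemannZeta 2 * 2 * rankinIntegral f 1 +
      riemannZeta 2 * (∫ z in 𝒟, (Psi f z : ℂ) * deriv (eisReg z) 1) -
      riemannZeta 2 * rankinIntegral f 1 * Real.eulerMascheroniConstant) 1 := by
  have h1 := hasDerivAt_zeta_two_mul
  have h2 := (hasDerivAt_rankinIntegral f one_mem_smallDisc).2
  have h3 := (differentiable_zetaReg 1).hasDerivAt
  rw [deriv_zetaReg_one] at h3
  have h := (h1.mul h2).div h3 (by rw [zetaReg_one]; exact one_ne_zero)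
  refine h.congr_deriv ?_
  simp [zetaReg_one]

end

end RegEis

end

theorem proposition4p1 (k : ℤ) (f : CuspForm 𝒮ℒ k) (hf : IsHeckeForm f) :
    -- the Eisenstein series converges for `Re s > 1`, and `Ẽ(z, s)` is regular at `s = 1`
    (∀ (z : ℍ) (s : ℂ), 1 < s.re → Summable fun c => (cosetIm z c : ℂ) ^ s) ∧
    (∀ z : ℍ, ∃ g : ℂ → ℂ, IsContinuation (regEisensteinSeries z) g) ∧
    -- the Euler product of `L(sym² f, s)` converges for `Re s > 1`, and `L(sym² f, s)` is
    -- regular at `s = 1`, with `Λ(sym² f, 1) ≠ 0`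
    (∀ s : ℂ, 1 < s.re → Multipliable fun p : Nat.Primes => symSqFactor f s p) ∧
    (∃ g : ℂ → ℂ, IsContinuation (symSqEulerProduct f) g) ∧
    symSqLambda f 1 ≠ 0 ∧
    -- the integrals defining `‖f‖²` and the pairing converge
    IntegrableOn (Psi f) 𝒟 ∧
    IntegrableOn (fun z : ℍ => (Psi f z : ℂ) * conj (regEisenstein z 1)) 𝒟 ∧
    -- the value of the pairing `⟨Ψ, Ẽ(·, 1)⟩`
    ∫ z in 𝒟, (Psi f z : ℂ) * conj (regEisenstein z 1) =
      (normSqPet f : ℂ) / vol *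
        (deriv (symSqLambda f) 1 / symSqLambda f 1 + Real.eulerMascheroniConstant
          - 2 * (deriv riemannZeta 2 / riemannZeta 2)) := by
  obtain ⟨hcont, hΛ⟩ := hf.symSq_spec
  have hreg : ∀ z : ℍ, conj (regEisenstein z 1) = deriv (eisReg z) 1 := fun z => by
    rw [(regEisenstein_spec z).2, conj_deriv_eisReg_one]
  have hval : symSqLambda f 1 = riemannZeta 2 * rankinIntegral f 1 := by
    rw [hΛ.eq_of_nhds, completedSymSq, zetaReg_one, mul_one, div_one]
  have hζ : riemannZeta 2 ≠ 0 := riemannZeta_ne_zero_of_one_le_re (by norm_num)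
  have hH : rankinIntegral f 1 ≠ 0 := by
    rw [rankinIntegral_one, vol_eq]
    refine div_ne_zero (Complex.ofReal_ne_zero.mpr hf.normSqPet_pos.ne') ?_
    exact Complex.ofReal_ne_zero.mpr (by positivity)
  simp_rw [hreg]
  refine ⟨fun z s hs => summable_cosetIm_cpow z hs, fun z => (regEisenstein_spec z).1,
    fun s hs => (hf.hasProd_symSqFactor hs).multipliable, hcont, ?_, integrableOn_Psi f,
    (hasDerivAt_rankinIntegral f one_mem_smallDisc).1, ?_⟩
  · rw [hval]
    exact mul_ne_zero hζ hH
  -- Dividing the derivative by `ζ(2) H(1)` gives `2 ζ'/ζ(2) + H'/H(1) - γ`; then solve for `H'(1)`,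
  -- with `H(1) = ‖f‖² / V`.
  · rw [hΛ.deriv_eq, (hasDerivAt_completedSymSq f).deriv, hval, ← rankinIntegral_one]
    field_simp
    ring
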